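/- **Setting.** $|\cdot|$ is the norm $|x|=\sum_i|x_i|$; $\mathcal P_1=\mathcal P_1(\mathbb R^n)$ is the set of Borel probability measures on $\mathbb R^n$ with finite first moment, with the distance $W_1(\mu,\nu)=\sup\{\int\varphi\,d\mu-\int\varphi\,d\nu:\ \varphi:\mathbb R^n\to\mathbb R\ \text{1-Lipschitz}\}$. Let $T,M>0$, $\vartheta\in\mathcal P_1$, and let $f_0,\dots,f_m,g:\mathbb R^n\to\mathbb R^n$ be such that for some $C,L>0$ and all $x,y$: $\sum_{i=0}^m|f_i(x)|+|g(x)|\le C$ and $\sum_{i=0}^m|f_i(x)-f_i(y)|+|g(x)-g(y)|\le L|x-y|$. Write $(g*\mu)(x)=\int g(x-y)\,d\mu(y)$. A solution on $[0,R]$ of $\partial_t\mu_t+\nabla\cdot(v_t\mu_t)=0$, $\mu_0=\vartheta$, is an absolutely continuous curve $\mu:[0,R]\to\mathcal P_1$ with $\mu_0=\vartheta$ and $\int_0^R\int(\partial_t\varphi+\langle v_t,\nabla_x\varphi\rangle)\,d\mu_t\,dt=0$ for all $\varphi\in C_c^\infty((0,R)\times\mathbb R^n)$. *System $(S)$.*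 A control process is a pair $(\mu,u)$, where $u:[0,T]\to\mathbb R^m$ is Borel measurable and essentially bounded with $\int_0^T\sum_i|u_i|\,dt=M$, and $\mu$ is a solution on $[0,T]$ for $v_t=f_0+\sum_iu_i(t)f_i+g*\mu_t$. *Reduced system $(\hat S)$.* Let $S=T+M$. A control process is a triple $(\nu,\alpha,\beta)$, where $(\alpha,\beta)\in L^\infty([0,S];\mathbb R^{1+m})$ satisfies $\alpha\ge0$ and $\alpha+\sum_j|\beta_j|\le1$ a.e. and $\int_0^S\alpha\,ds=T$, and $\nu$ is a solution on $[0,S]$ for $w_s=\alpha(s)(f_0+g*\nu_s)+\sum_i\beta_i(s)f_i$. *Association.* For a control $u$ of $(S)$ let $\xi_u:[0,S]\to[0,T]$ be the inverse of $\Xi_u(t)=t+\int_0^t\sum_i|u_i|$. The process $(\nu,\alpha,\beta)$ associated with $(\mu,u)$ is given by $\alpha=\frac1{1+\sum_j|u_j|}\circ\xi_u$, $\beta_i=\frac{u_i}{1+\sum_j|u_j|}\circ\xi_u$ a.e. on $[0,S]$, and $\nu$ is the corresponding solution of the reduced equation. *Convergence.* For a metric space $X$, $\mathbf{BV}_+([0,T];X)$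 is the set of functions $[0,T]\to X$ of bounded variation that are right continuous on $[0,T)$, and $F_k\rightharpoondown F$ means $F_k(t)\to F(t)$ at all continuity points $t\in[0,T]$ of $F$ and at $t\in\{0,T\}$. Put $F_u(t)=\int_0^tu(s)\,ds$. **Theorem.** Let $(\mu^k,u^k)$, $k\in\mathbb N$, be control processes of $(S)$, let $(\mu,\mathfrak U)\in\mathbf{BV}_+([0,T];\mathcal P_1)\times\mathbf{BV}_+([0,T];\mathbb R^m)$, and suppose $\mu^k\rightharpoondown\mu$ and $F_{u^k}\rightharpoondown\mathfrak U$. Let $(\nu^k,\alpha^k,\beta^k)$ be the control processes of $(\hat S)$ associated with $(\mu^k,u^k)$. Then: 1. the sequence $(\nu^k,\alpha^k,\beta^k)$ has at least one cluster point in $C^0([0,S];\mathcal P_1)\times L^\infty([0,S];\mathbb R^{1+m})$, where $C^0$ carries the topology of uniform convergence and $L^\infty$ the weak-* topology $\sigma(L^\infty,L^1)$; 2. each such cluster point $(\nu,\alpha,\beta)$ is a control process of $(\hat S)$; 3. each such cluster point satisfies, for every $t\in[0,T]$, $$\mu_t=\nu_{\xi^\leftarrow(t)},\qquad \mathfrak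 U(t)=\int_0^{\xi^\leftarrow(t)}\beta(s)\,ds,$$ where $\xi(s)=\int_0^s\alpha(\varsigma)\,d\varsigma$, $\xi^\leftarrow(t)=\inf\{s\in[0,S]:\xi(s)>t\}$ for $t\in[0,T)$, and $\xi^\leftarrow(T)=S$. -/

import Mathlib

open MeasureTheory Set Filter Topology
open scoped ENNReal NNReal

noncomputable section

namespace ImpulsiveTransport

/-! ### The space `𝒫₁(ℝⁿ)` with the Wasserstein distance -/

/-- `ℝⁿ` with the Manhattan norm `|x| = ∑ i, |x i|`. -/
abbrev E (n : ℕ) : Type := PiLp 1 (fun _ : Fin n => ℝ)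

/-- Borel probability measures on `ℝⁿ` with finite first moment. -/
@[ext] structure P1 (n : ℕ) where
  toMeasure : Measure (E n)
  isProb : IsProbabilityMeasure toMeasure
  firstMoment : Integrable (fun x : E n => ‖x‖) toMeasure

attribute [instance] P1.isProb

namespace P1

variable {n : ℕ}

/-- The Kantorovich distance
`W₁(μ, ν) = sup {∫ φ dμ - ∫ φ dν : φ : ℝⁿ → ℝ is 1-Lipschitz}`. -/
def W1 (μ ν : P1 n) : ℝ :=
  ⨆ φ : {φ : E n → ℝ // LipschitzWith 1 φ},
    ((∫ x, φ.1 x ∂μ.toMeasure) - ∫ x, φ.1 x ∂ν.toMeasure)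

theorem abs_sub_zero_le {φ : E n → ℝ} (hφ : LipschitzWith 1 φ) (x : E n) :
    |φ x - φ 0| ≤ ‖x‖ := by
  have h := hφ.dist_le_mul x 0
  simpa [Real.dist_eq] using h

theorem integrable_lip (μ : P1 n) {φ : E n → ℝ} (hφ : LipschitzWith 1 φ) :
    Integrable φ μ.toMeasure := by
  have h0 : Integrable (fun x => ‖x‖ + |φ 0|) μ.toMeasure :=
    μ.firstMoment.add (integrable_const _)
  refine h0.mono' hφ.continuous.aestronglyMeasurable (Eventually.of_forall fun x => ?_)
  have h1 := abs_sub_zero_le hφ x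
  have h2 : |φ x| ≤ |φ x - φ 0| + |φ 0| := by
    simpa using abs_add_le (φ x - φ 0) (φ 0)
  rw [Real.norm_eq_abs]
  linarith

theorem integral_sub_le (μ ν : P1 n) {φ : E n → ℝ} (hφ : LipschitzWith 1 φ) :
    (∫ x, φ x ∂μ.toMeasure) - ∫ x, φ x ∂ν.toMeasure
      ≤ (∫ x, ‖x‖ ∂μ.toMeasure) + ∫ x, ‖x‖ ∂ν.toMeasure := by
  have h1 : ∫ x, φ x ∂μ.toMeasure ≤ ∫ x, (‖x‖ + φ 0) ∂μ.toMeasure := by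
    refine integral_mono (integrable_lip μ hφ) (μ.firstMoment.add (integrable_const _)) ?_
    intro x
    have := (abs_le.1 (abs_sub_zero_le hφ x)).2
    show φ x ≤ ‖x‖ + φ 0
    linarith
  have h2 : ∫ x, (φ 0 - ‖x‖) ∂ν.toMeasure ≤ ∫ x, φ x ∂ν.toMeasure := by
    refine integral_mono ((integrable_const _).sub ν.firstMoment) (integrable_lip ν hφ) ?_
    intro x
    have := (abs_le.1 (abs_sub_zero_le hφ x)).1
    show φ 0 - ‖x‖ ≤ φ x
    linarith
  rw [integral_add μ.firstMoment (integrable_const _)] at h1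
  rw [integral_sub (integrable_const _) ν.firstMoment] at h2
  simp at h1 h2
  linarith

theorem bddAbove_W1 (μ ν : P1 n) :
    BddAbove (range fun φ : {φ : E n → ℝ // LipschitzWith 1 φ} =>
      ((∫ x, φ.1 x ∂μ.toMeasure) - ∫ x, φ.1 x ∂ν.toMeasure)) := by
  refine ⟨(∫ x, ‖x‖ ∂μ.toMeasure) + ∫ x, ‖x‖ ∂ν.toMeasure, ?_⟩
  rintro _ ⟨φ, rfl⟩
  exact integral_sub_le μ ν φ.2

instance : Nonempty {φ : E n → ℝ // LipschitzWith 1 φ} :=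
  ⟨⟨fun _ => 0, LipschitzWith.const' 0⟩⟩

theorem le_W1 (μ ν : P1 n) {φ : E n → ℝ} (hφ : LipschitzWith 1 φ) :
    (∫ x, φ x ∂μ.toMeasure) - ∫ x, φ x ∂ν.toMeasure ≤ W1 μ ν :=
  le_ciSup (bddAbove_W1 μ ν) ⟨φ, hφ⟩

theorem W1_comm_le (μ ν : P1 n) : W1 μ ν ≤ W1 ν μ := by
  refine ciSup_le fun φ => ?_
  have h := le_W1 ν μ (φ := fun x => -φ.1 x) φ.2.neg
  rw [integral_neg, integral_neg] at h
  linarith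

theorem W1_triangle (μ ν ρ : P1 n) : W1 μ ρ ≤ W1 μ ν + W1 ν ρ := by
  refine ciSup_le fun φ => ?_
  have h1 := le_W1 μ ν φ.2
  have h2 := le_W1 ν ρ φ.2
  linarith

theorem eq_of_W1_eq_zero {μ ν : P1 n} (h : W1 μ ν = 0) : μ = ν := by
  have h' : W1 ν μ = 0 := by
    have a := W1_comm_le ν μ
    have b := W1_comm_le μ ν
    linarith
  have key1 : ∀ φ : E n → ℝ, LipschitzWith 1 φ →
      ∫ x, φ x ∂μ.toMeasure = ∫ x, φ x ∂ν.toMeasure := by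
    intro φ hφ
    have a := le_W1 μ ν hφ
    have b := le_W1 ν μ hφ
    linarith
  have key : ∀ (K : ℝ≥0) (φ : E n → ℝ), LipschitzWith K φ →
      ∫ x, φ x ∂μ.toMeasure = ∫ x, φ x ∂ν.toMeasure := by
    intro K φ hφ
    have hc : (0 : ℝ) < K + 1 := by positivity
    have hl : LipschitzWith 1 (fun x => ((K : ℝ) + 1)⁻¹ * φ x) := by
      refine LipschitzWith.of_dist_le_mul fun x y => ?_
      have h1 := hφ.dist_le_mul x y
      rw [Real.dist_eq] at h1 ⊢
      rw [← mul_sub, abs_mul, abs_of_pos (inv_pos.2 hc), inv_mul_le_iff₀ hc]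
      have : (0 : ℝ) ≤ dist x y := dist_nonneg
      push_cast
      nlinarith
    have := key1 _ hl
    rw [integral_const_mul, integral_const_mul] at this
    exact mul_left_cancel₀ (inv_pos.2 hc).ne' this
  apply P1.ext
  refine MeasureTheory.ext_of_generate_finite {F : Set (E n) | IsClosed F} ?_ ?_ ?_ ?_
  · exact (BorelSpace.measurable_eq (α := E n)).trans borel_eq_generateFrom_isClosed
  · exact isPiSystem_isClosed
  · intro F hF
    have hF' : IsClosed F := hF
    have hpos : ∀ k : ℕ, (0 : ℝ) < 1 / ((k : ℝ) + 1) := fun k => by positivity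
    have l1 := tendsto_lintegral_thickenedIndicator_of_isClosed μ.toMeasure hF' hpos
      tendsto_one_div_add_atTop_nhds_zero_nat
    have l2 := tendsto_lintegral_thickenedIndicator_of_isClosed ν.toMeasure hF' hpos
      tendsto_one_div_add_atTop_nhds_zero_nat
    refine tendsto_nhds_unique l1 (l2.congr fun k => ?_)
    have e := key _ (fun x => ((thickenedIndicator (hpos k) F x : ℝ≥0) : ℝ))
      (lipschitzWith_thickenedIndicator (hpos k) F)
    have conv : ∀ ρ : P1 n, ENNReal.ofReal
        (∫ x, ((thickenedIndicator (hpos k) F x : ℝ≥0) : ℝ) ∂ρ.toMeasure)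
        = ∫⁻ x, (thickenedIndicator (hpos k) F x : ℝ≥0∞) ∂ρ.toMeasure := by
      intro ρ
      have hi : Integrable (fun x => ((thickenedIndicator (hpos k) F x : ℝ≥0) : ℝ))
          ρ.toMeasure := by
        refine Integrable.of_bound (C := 1) ?_ (Eventually.of_forall fun x => ?_)
        · exact (NNReal.continuous_coe.comp
            (thickenedIndicator (hpos k) F).continuous).aestronglyMeasurable
        · have := thickenedIndicator_le_one (hpos k) F x
          simpa using this
      rw [ofReal_integral_eq_lintegral_ofReal hi
        (Eventually.of_forall fun x => NNReal.coe_nonneg _)]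
      simp
    rw [← conv μ, ← conv ν, e]
  · simp

instance : MetricSpace (P1 n) where
  dist := W1
  dist_self μ := by
    show W1 μ μ = 0
    simp [W1]
  dist_comm μ ν := le_antisymm (W1_comm_le μ ν) (W1_comm_le ν μ)
  dist_triangle := W1_triangle
  eq_of_dist_eq_zero := eq_of_W1_eq_zero

end P1

/-! ### Functions of bounded variation and their convergence -/

section BV

variable {X : Type*} [PseudoMetricSpace X]

/-- `F ∈ BV₊([0,T]; X)`: bounded variation on `[0,T]`, right continuous on `[0,T)`. -/
def IsBVPlus (T : ℝ) (F : ℝ → X) : Prop :=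
  BoundedVariationOn F (Icc 0 T) ∧ ∀ t ∈ Ico 0 T, ContinuousWithinAt F (Icc t T) t

/-- The convergence `F k ⇁ F`: pointwise convergence at all points of continuity in `[0,T]`
of the limit function, and at both end points of `[0,T]`. -/
def BVTendsto (T : ℝ) (Fk : ℕ → ℝ → X) (F : ℝ → X) : Prop :=
  ∀ t ∈ Icc 0 T, (ContinuousWithinAt F (Icc 0 T) t ∨ t = 0 ∨ t = T) →
    Tendsto (fun k => Fk k t) atTop (𝓝 (F t))

end BV

/-! ### `L∞([0,S]; ℝ^{1+m})` with the weak-* topology -/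

/-- The space `L∞([0,S]; ℝ × ℝᵐ)` of classes `(α, β)`, to be equipped with its weak-* topology
(and not with the topology of the norm). -/
def WeakLinf (S : ℝ) (m : ℕ) : Type :=
  Lp (ℝ × E m) ∞ (volume.restrict (Icc (0 : ℝ) S))

namespace WeakLinf

variable {S : ℝ} {m : ℕ}

/-- A representative of the class `(α, β)`. -/
def rep (c : WeakLinf S m) : ℝ → ℝ × E m :=
  (show Lp (ℝ × E m) ∞ (volume.restrict (Icc (0 : ℝ) S)) from c : ℝ → ℝ × E m)

/-- The component `α`. -/
def α (c : WeakLinf S m) (s : ℝ) : ℝ := (c.rep s).1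

/-- The component `β = (β₁, …, β_m)`. -/
def β (c : WeakLinf S m) (s : ℝ) : E m := (c.rep s).2

/-- The duality pairing `∫₀^S (α h₀ + ∑ i, βᵢ hᵢ) ds` of `(α, β) ∈ L∞` with `h ∈ L¹`. -/
def pairing (c : WeakLinf S m)
    (h : Lp (ℝ × E m) 1 (volume.restrict (Icc (0 : ℝ) S))) : ℝ :=
  ∫ s in Icc 0 S, (c.α s * (h s).1 + ∑ i, c.β s i * (h s).2 i)

/-- The weak-* topology `σ(L∞, L¹)`. -/
instance : TopologicalSpace (WeakLinf S m) :=
  TopologicalSpace.induced (fun c => c.pairing) inferInstance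

end WeakLinf

/-! ### Continuity equations -/

/-- The convolution `(g * μ)(x) = ∫ g (x - y) dμ(y)`. -/
def conv {n : ℕ} (g : E n → E n) (μ : P1 n) (x : E n) : E n :=
  ∫ y, g (x - y) ∂μ.toMeasure

/-- `μ` is a weak solution on `[0,R]` of `∂ₜ μₜ + ∇ · (vₜ μₜ) = 0`, `μ₀ = ϑ`: an absolutely
continuous curve in `𝒫₁` that starts at `ϑ` and satisfies the equation in the sense of
distributions on `(0,R) × ℝⁿ`. Only the values of `μ` and `v` on `[0,R]` matter. -/
def IsWeakSolution {n : ℕ} (R : ℝ) (v : ℝ → E n → E n) (ϑ : P1 n) (μ : ℝ → P1 n) : Prop :=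
  AbsolutelyContinuousOnInterval μ 0 R ∧
  μ 0 = ϑ ∧
  ∀ φ : ℝ × E n → ℝ, ContDiff ℝ (⊤ : ℕ∞) φ → HasCompactSupport φ →
    tsupport φ ⊆ Ioo 0 R ×ˢ (univ : Set (E n)) →
    ∫ t in (0 : ℝ)..R, ∫ x, (fderiv ℝ φ (t, x) (1, 0) + fderiv ℝ φ (t, x) (0, v t x))
      ∂(μ t).toMeasure = 0

/-! ### The control system and the reduced control system -/

/-- The data of the control system: drift `f₀`, control fields `f₁, …, f_m`, interaction
kernel `g`, time horizon `T`, total resource `M` and initial distribution `ϑ`. -/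
structure Data (n m : ℕ) where
  f₀ : E n → E n
  f : Fin m → E n → E n
  g : E n → E n
  T : ℝ
  M : ℝ
  ϑ : P1 n
  T_pos : 0 < T
  M_pos : 0 < M

namespace Data

variable {n m : ℕ} (D : Data n m)

/-- The vector fields `f₀, …, f_m, g` are uniformly bounded and Lipschitz. -/
def BoundedLipschitz : Prop :=
  ∃ C L : ℝ, 0 < C ∧ 0 < L ∧
    (∀ x, (‖D.f₀ x‖ + ∑ i, ‖D.f i x‖) + ‖D.g x‖ ≤ C) ∧
    ∀ x y, (‖D.f₀ x - D.f₀ y‖ + ∑ i, ‖D.f i x - D.f i y‖) + ‖D.g x - D.g y‖ ≤ L * ‖x - y‖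

/-- The class `𝒰` of controls: Borel, essentially bounded on `[0,T]`, with
`∫₀ᵀ ∑ i, |uᵢ(t)| dt = M`. -/
def IsControl (u : ℝ → E m) : Prop :=
  Measurable u ∧
  (∃ B : ℝ, ∀ᵐ t ∂volume.restrict (Icc 0 D.T), ∑ i, |u t i| ≤ B) ∧
  ∫ t in (0 : ℝ)..D.T, ∑ i, |u t i| = D.M

/-- `vₜ(x) = f₀(x) + ∑ i, uᵢ(t) fᵢ(x) + (g * μₜ)(x)`. -/
def field (u : ℝ → E m) (μ : ℝ → P1 n) (t : ℝ) (x : E n) : E n :=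
  D.f₀ x + ∑ i, u t i • D.f i x + conv D.g (μ t) x

/-- `(μ, u)` is a control process of the original system `(S)`. -/
def IsControlPair (μ : ℝ → P1 n) (u : ℝ → E m) : Prop :=
  D.IsControl u ∧ IsWeakSolution D.T (D.field u μ) D.ϑ μ

/-- The extended time horizon `S = T + M`. -/
def S : ℝ := D.T + D.M

theorem S_nonneg : 0 ≤ D.S := (add_pos D.T_pos D.M_pos).le

/-- `C⁰([0,S]; 𝒫₁)` with the topology of uniform convergence. -/
abbrev Curve : Type := C(Icc (0 : ℝ) D.S, P1 n)

/-- A curve on `[0,S]` as a function of a real variable; only its values on `[0,S]`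
are relevant. -/
def ext (ν : D.Curve) : ℝ → P1 n := IccExtend D.S_nonneg ν

/-- The class of reduced controls: `(α, β)` takes values a.e. in
`A = {(a, b) : a ≥ 0, a + ∑ j, |bⱼ| ≤ 1}`, and `∫₀^S α ds = T`. -/
def IsReducedControl (c : WeakLinf D.S m) : Prop :=
  (∀ᵐ s ∂volume.restrict (Icc 0 D.S), 0 ≤ c.α s ∧ c.α s + ∑ j, |c.β s j| ≤ 1) ∧
  ∫ s in (0 : ℝ)..D.S, c.α s = D.T

/-- `wₛ(x) = α(s) (f₀(x) + (g * νₛ)(x)) + ∑ i, βᵢ(s) fᵢ(x)`. -/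
def reducedField (c : WeakLinf D.S m) (ν : ℝ → P1 n) (s : ℝ) (x : E n) : E n :=
  c.α s • (D.f₀ x + conv D.g (ν s) x) + ∑ i, c.β s i • D.f i x

/-- `ν` is a solution on `[0,S]` of the reduced continuity equation driven by `(α, β)`. -/
def IsReducedSolution (ν : D.Curve) (c : WeakLinf D.S m) : Prop :=
  IsWeakSolution D.S (D.reducedField c (D.ext ν)) D.ϑ (D.ext ν)

/-- `(ν, α, β)` is a control process of the reduced system `(Ŝ)`. -/
def IsReducedPair (ν : D.Curve) (c : WeakLinf D.S m) : Prop :=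
  D.IsReducedControl c ∧ D.IsReducedSolution ν c

/-- `F_u(t) = ∫₀ᵗ u(s) ds`. -/
def cumul (u : ℝ → E m) (t : ℝ) : E m := ∫ s in (0 : ℝ)..t, u s

/-- `Ξ(t) = t + ∫₀ᵗ ∑ i, |uᵢ(s)| ds`, an increasing bijection `[0,T] → [0,S]`
for a control `u`. -/
def Xi (u : ℝ → E m) (t : ℝ) : ℝ := t + ∫ s in (0 : ℝ)..t, ∑ i, |u s i|

/-- The inverse `[0,S] → [0,T]` of `Ξ : [0,T] → [0,S]`. -/
def XiInv (u : ℝ → E m) : ℝ → ℝ := Function.invFunOn (Xi u) (Icc 0 D.T)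

/-- `(ν, α, β)` is associated with the control `u`: with `ξ` the inverse of `Ξ`,
`α(s) = 1 / (1 + ∑ j, |uⱼ(ξ(s))|)` and `βᵢ(s) = uᵢ(ξ(s)) / (1 + ∑ j, |uⱼ(ξ(s))|)` a.e. on
`[0,S]`, and `ν` is the corresponding solution of the reduced equation. -/
def IsAssociated (u : ℝ → E m) (ν : D.Curve) (c : WeakLinf D.S m) : Prop :=
  (∀ᵐ s ∂volume.restrict (Icc 0 D.S),
    c.α s = 1 / (1 + ∑ j, |u (D.XiInv u s) j|) ∧
    ∀ i, c.β s i = u (D.XiInv u s) i / (1 + ∑ j, |u (D.XiInv u s) j|)) ∧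
  D.IsReducedSolution ν c

/-- `ξ(s) = ∫₀ˢ α`. -/
def xi (c : WeakLinf D.S m) (s : ℝ) : ℝ := ∫ σ in (0 : ℝ)..s, c.α σ

open Classical in
/-- The pseudo-inverse `ξ^←(t) = inf {s ∈ [0,S] : ξ(s) > t}` for `t < T`, and `ξ^←(T) = S`. -/
def xiPseudoInv (c : WeakLinf D.S m) (t : ℝ) : ℝ :=
  if t < D.T then sInf {s | s ∈ Icc 0 D.S ∧ t < D.xi c s} else D.S

end Data

end ImpulsiveTransport

end

open ImpulsiveTransport

noncomputable section

namespace ImpulsiveTransport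

/-! ### Mollification of Lipschitz functions -/

section Mollification

variable {V : Type*} [NormedAddCommGroup V] [NormedSpace ℝ V] [FiniteDimensional ℝ V]
  [MeasurableSpace V] [BorelSpace V]
  {F : Type*} [NormedAddCommGroup F] [NormedSpace ℝ F]

open scoped Convolution

/-! The controls `u^k` are bounded only in `L¹`, so the limits may jump. Running the clock by `Θ_k =
Ξ_{u^k}`, which adds to `t` the amount of control spent so far, turns the coefficients into `(α^k,
β^k)` with `α + ∑ |β_j| = 1` on the fixed interval `[0,S]`. In this clock `ν^k(Θ_k(t)) = μ^k(t)`,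
`ξ^k(Θ_k(t)) = t` and `∫₀^{Θ_k(t)} β^k = F_{u^k}(t)` (`Data.exists_reparametrization`).

An associated `ν^k` is only known to solve the reduced equation, so the first of these identities
needs uniqueness for the nonlocal continuity equation (`IsNormalizedEvolution.unique`): `ν^k` and
`μ^k ∘ Θ_k⁻¹` have the same coefficients and initial value. Uniqueness is proved by duality. Two
solutions are compared in the dual norm of test functions with `Lip ψ + δ Lip(Dψ) ≤ 1`; over a short
step the test function is pulled back by an Euler step of a mollified, time-averaged field
(`testDist_step`), and Gronwall's inequality followed by `ε → 0` concludes.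

Compactness (`Data.exists_tendsto_reducedPair`): the coefficients lie in the `ℓ¹` unit ball and the
fields are bounded by some `C`, so all `ν^k` are `C`-Lipschitz. They share the initial measure, so
their first moments outside large balls are uniformly small. Prokhorov's theorem, upgraded to `W₁`
by the tail bounds, and Arzelà–Ascoli give uniform limits; the controls have weak-* limits. In the
limit (`Data.isReducedPair_of_tendsto`) the weak formulation is affine in `(α, β)` with factors that
converge uniformly, and the constraints on `(α, β)` are linear inequalities, hence weak-* closed.
Limits are taken along ultrafilters, which describe cluster points without any countability
assumption on the topology.

Identification (`Data.limit_eq`): where both limits are continuous, and at `t = T`, a limit `s` of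
`Θ_k(t)` satisfies `ξ(s) = t`, `ν_s = μ_t` and `∫₀ˢ β = 𝔘(t)`. Since `ξ` may have flat pieces, `s`
is not determined by `t`. However, the points of continuity are dense, and the times selected for
such points `x` decreasing to `t` converge to `ξ^←(t)`, the right end of the level set `{ξ = t}`.
Right continuity of `μ` and `𝔘` then settles every `t < T`, while `Θ_k(T) = S` settles `t = T`. -/

theorem lipschitzWith_convolution {V : Type*} [NormedAddCommGroup V] [MeasurableSpace V]
    [BorelSpace V] [ProperSpace V] {A G : Type*} [NormedAddCommGroup A]
    [NormedSpace ℝ A] [NormedAddCommGroup G] [NormedSpace ℝ G] (B : A →L[ℝ] F →L[ℝ] G)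
    (hB : ∀ a b, ‖B a b‖ ≤ ‖a‖ * ‖b‖) {m : Measure V} [m.IsAddHaarMeasure]
    {f : V → A} (hf : Continuous f) (hfc : HasCompactSupport f) {g : V → F} {K : ℝ≥0}
    (hg : LipschitzWith K g) {c : ℝ≥0} (hc : ∫ x, ‖f x‖ ∂m ≤ c) :
    LipschitzWith (c * K) (f ⋆[B, m] g) := by
  have hex : ConvolutionExists f g B m :=
    hfc.convolutionExists_left B hf hg.continuous.locallyIntegrable
  refine LipschitzWith.of_dist_le_mul fun x y => ?_
  have hfi : Integrable (fun t => ‖f t‖) m := (hf.integrable_of_hasCompactSupport hfc).norm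
  rw [dist_eq_norm, convolution_def, convolution_def,
    ← integral_sub (hex x) (hex y)]
  calc ‖∫ t, (B (f t) (g (x - t)) - B (f t) (g (y - t))) ∂m‖
      ≤ ∫ t, ‖f t‖ * (K * dist x y) ∂m := by
        refine norm_integral_le_of_norm_le (hfi.mul_const _) (Eventually.of_forall fun t => ?_)
        rw [← map_sub]
        refine (hB _ _).trans ?_
        gcongr
        rw [← dist_eq_norm]
        simpa using hg.dist_le_mul (x - t) (y - t)
    _ = (∫ t, ‖f t‖ ∂m) * (K * dist x y) := integral_mul_const _ _
    _ ≤ c * (K * dist x y) := by gcongr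
    _ = _ := by push_cast; ring

/-- A smooth bump function supported in the ball of radius `ε`. -/
def bump (V : Type*) [NormedAddCommGroup V] (ε : ℝ) (hε : 0 < ε) : ContDiffBump (0 : V) :=
  ⟨ε / 2, ε, by positivity, by linarith⟩

/-- The standard mollification at scale `ε`. -/
def mollify (ε : ℝ) (hε : 0 < ε) (f : V → F) : V → F :=
  (bump V ε hε).normed (Measure.addHaar (G := V)) ⋆[ContinuousLinearMap.lsmul ℝ ℝ,
    Measure.addHaar (G := V)] f

/-- A bound for the `L¹` norm of the gradient of the mollifier. -/
def mollConst (V : Type*) [NormedAddCommGroup V] [NormedSpace ℝ V] [FiniteDimensional ℝ V]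
    [MeasurableSpace V] [BorelSpace V] (ε : ℝ) (hε : 0 < ε) : ℝ≥0 :=
  Real.toNNReal (∫ x : V, ‖fderiv ℝ ((bump V ε hε).normed (Measure.addHaar (G := V))) x‖
    ∂Measure.addHaar (G := V))

variable {ε : ℝ} (hε : 0 < ε) {f : V → F} {K : ℝ≥0}

theorem contDiff_mollify (hf : LipschitzWith K f) : ContDiff ℝ (⊤ : ℕ∞) (mollify ε hε f) :=
  (bump V ε hε).hasCompactSupport_normed.contDiff_convolution_left _
    (bump V ε hε).contDiff_normed hf.continuous.locallyIntegrable

theorem lipschitzWith_mollify (hf : LipschitzWith K f) : LipschitzWith K (mollify ε hε f) := by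
  have h := lipschitzWith_convolution (ContinuousLinearMap.lsmul ℝ ℝ : ℝ →L[ℝ] F →L[ℝ] F)
    (fun a b => by simp [norm_smul]) (m := Measure.addHaar (G := V))
    (bump V ε hε).continuous_normed (bump V ε hε).hasCompactSupport_normed hf (c := 1) (by
      have : (fun x => ‖(bump V ε hε).normed (Measure.addHaar (G := V)) x‖)
          = (bump V ε hε).normed (Measure.addHaar (G := V)) := by
        ext x
        exact Real.norm_of_nonneg ((bump V ε hε).nonneg_normed x)
      rw [this, ContDiffBump.integral_normed]
      simp)
  simpa [mollify] using h

theorem norm_mollify_sub_le [CompleteSpace F] (hf : LipschitzWith K f) (x : V) :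
    ‖mollify ε hε f x - f x‖ ≤ K * ε := by
  rw [← dist_eq_norm]
  refine ContDiffBump.dist_normed_convolution_le hf.continuous.aestronglyMeasurable fun y hy => ?_
  refine (hf.dist_le_mul y x).trans ?_
  gcongr
  exact (Metric.mem_ball.1 hy).le

/-- The derivative falls on the kernel, whose gradient has the `L¹` norm recorded by `mollConst`.
The factor does not depend on `f`, so the weight `δ` of the test class can be fixed in terms of `ε`
alone. -/
theorem lipschitzWith_fderiv_mollify (hf : LipschitzWith K f) :
    LipschitzWith (mollConst V ε hε * K) (fderiv ℝ (mollify ε hε f)) := by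
  have hs := (bump V ε hε).hasCompactSupport_normed (μ := Measure.addHaar (G := V))
  have hd : ContDiff ℝ 1 ((bump V ε hε).normed (Measure.addHaar (G := V))) :=
    (bump V ε hε).contDiff_normed
  have h := lipschitzWith_convolution
    ((ContinuousLinearMap.lsmul ℝ ℝ : ℝ →L[ℝ] F →L[ℝ] F).precompL V)
    (fun a b => by
      refine ContinuousLinearMap.opNorm_le_bound _ (by positivity) fun v => ?_
      rw [ContinuousLinearMap.precompL_apply]
      simp only [ContinuousLinearMap.lsmul_apply, norm_smul]
      have := a.le_opNorm v
      nlinarith [norm_nonneg b])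
    (m := Measure.addHaar (G := V)) (hd.continuous_fderiv one_ne_zero) (hs.fderiv ℝ) hf
    (c := mollConst V ε hε) (Real.le_coe_toNNReal _)
  have e : fderiv ℝ (mollify ε hε f) = (fderiv ℝ ((bump V ε hε).normed (Measure.addHaar (G := V))))
      ⋆[(ContinuousLinearMap.lsmul ℝ ℝ : ℝ →L[ℝ] F →L[ℝ] F).precompL V, Measure.addHaar] f := by
    ext1 x
    exact (hs.hasFDerivAt_convolution_left _ hd hf.continuous.locallyIntegrable x).fderiv
  rw [e]
  exact h

theorem mollify_eq_zero [CompleteSpace F] {x : V} (h : ∀ y ∈ Metric.ball x ε, f y = 0) :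
    mollify ε hε f x = 0 := by
  have hx : f x = 0 := h x (Metric.mem_ball_self hε)
  have := (bump V ε hε).normed_convolution_eq_right (μ := Measure.addHaar (G := V)) (g := f)
    (x₀ := x) (fun y hy => by rw [hx]; exact h y hy)
  rw [mollify, this, hx]

theorem hasCompactSupport_mollify (hfc : HasCompactSupport f) :
    HasCompactSupport (mollify ε hε f) :=
  (bump V ε hε).hasCompactSupport_normed.convolution _ hfc

end Mollification

/-! ### Smooth compactly supported test functions for the Kantorovich distance -/

namespace P1

variable {n : ℕ}

theorem integrable_lipschitz {F : Type*} [NormedAddCommGroup F] (μ : P1 n) {K : ℝ≥0}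
    {φ : E n → F} (hφ : LipschitzWith K φ) (hm : AEStronglyMeasurable φ μ.toMeasure) :
    Integrable φ μ.toMeasure := by
  refine ((μ.firstMoment.const_mul (K : ℝ)).add (integrable_const ‖φ 0‖)).mono' hm
    (Eventually.of_forall fun x => ?_)
  have h := hφ.norm_sub_le x 0
  have h2 := norm_le_norm_sub_add (φ x) (φ 0)
  simp only [sub_zero] at h
  simp only [Pi.add_apply]
  linarith

theorem integrable_lipschitz_real (μ : P1 n) {K : ℝ≥0} {φ : E n → ℝ} (hφ : LipschitzWith K φ) :
    Integrable φ μ.toMeasure :=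
  μ.integrable_lipschitz hφ hφ.continuous.aestronglyMeasurable

theorem integral_sub_le_dist (μ ν : P1 n) {K : ℝ≥0} {φ : E n → ℝ} (hφ : LipschitzWith K φ) :
    ∫ x, φ x ∂μ.toMeasure - ∫ x, φ x ∂ν.toMeasure ≤ K * dist μ ν := by
  rcases eq_or_ne K 0 with rfl | hK
  · have hc : ∀ x, φ x = φ 0 := fun x => by
      have := hφ.dist_le_mul x 0
      simpa using this
    have : φ = fun _ => φ 0 := funext hc
    rw [this]
    simp
  · have hK' : (0 : ℝ) < K := by positivity
    have hl : LipschitzWith 1 (fun x => (K : ℝ)⁻¹ * φ x) := by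
      refine LipschitzWith.of_dist_le_mul fun x y => ?_
      have h1 := hφ.dist_le_mul x y
      rw [Real.dist_eq] at h1 ⊢
      rw [← mul_sub, abs_mul, abs_of_pos (inv_pos.2 hK'), inv_mul_le_iff₀ hK']
      simpa using h1
    have h := le_W1 μ ν hl
    rw [integral_const_mul, integral_const_mul, ← mul_sub, inv_mul_le_iff₀ hK'] at h
    exact h

theorem abs_integral_sub_le_dist (μ ν : P1 n) {K : ℝ≥0} {φ : E n → ℝ} (hφ : LipschitzWith K φ) :
    |∫ x, φ x ∂μ.toMeasure - ∫ x, φ x ∂ν.toMeasure| ≤ K * dist μ ν := by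
  rw [abs_le]
  have h1 := integral_sub_le_dist μ ν hφ
  have h2 := integral_sub_le_dist ν μ hφ
  rw [dist_comm] at h2
  constructor <;> linarith

theorem dist_le_of_forall {μ ν : P1 n} {b : ℝ} (h : ∀ φ : E n → ℝ, LipschitzWith 1 φ →
    ∫ x, φ x ∂μ.toMeasure - ∫ x, φ x ∂ν.toMeasure ≤ b) : dist μ ν ≤ b :=
  ciSup_le fun φ => h φ.1 φ.2

/-- Truncation of `φ` to the cone `|y| ≤ (R - ‖x‖)₊`. -/
def clip (R : ℝ) (φ : E n → ℝ) (x : E n) : ℝ :=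
  max (-(max (R - ‖x‖) 0)) (min (φ x) (max (R - ‖x‖) 0))

/-- The cone `(R - ‖x‖)₊` is 1-Lipschitz and lattice operations preserve Lipschitz constants.
Truncation therefore costs nothing, unlike multiplication by a cutoff. -/
theorem lipschitzWith_clip (R : ℝ) {φ : E n → ℝ} (hφ : LipschitzWith 1 φ) :
    LipschitzWith 1 (clip R φ) := by
  have h1 : LipschitzWith 1 (fun x : E n => max (R - ‖x‖) 0) := by
    have : LipschitzWith 1 (fun x : E n => R - ‖x‖) := by
      simpa using (LipschitzWith.const (α := E n) R).sub (lipschitzWith_one_norm (E := E n))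
    exact this.max_const 0
  have h2 := h1.neg.max (hφ.min h1)
  rw [max_self, max_self] at h2
  exact h2

theorem abs_clip_le (R : ℝ) (φ : E n → ℝ) (x : E n) : |clip R φ x| ≤ |φ x| := by
  have h0 : 0 ≤ max (R - ‖x‖) 0 := le_max_right _ _
  unfold clip
  rcases abs_cases (φ x) with h | h <;> rw [abs_le] <;> constructor <;>
    simp only [le_max_iff, le_min_iff, max_le_iff, min_le_iff] <;> grind

theorem clip_eq_self {R : ℝ} {φ : E n → ℝ} {x : E n} (h : |φ x| + ‖x‖ ≤ R) :
    clip R φ x = φ x := by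
  have h1 : 0 ≤ R - ‖x‖ := by linarith [abs_nonneg (φ x)]
  have h2 := abs_le.1 (show |φ x| ≤ R - ‖x‖ by linarith)
  rw [clip, max_eq_left h1, min_eq_left h2.2, max_eq_right h2.1]

theorem clip_eq_zero_of_eq_zero (R : ℝ) {φ : E n → ℝ} {x : E n} (h : φ x = 0) :
    clip R φ x = 0 := by
  have := abs_clip_le R φ x
  rw [h, abs_zero] at this
  exact abs_nonpos_iff.1 this

theorem hasCompactSupport_clip (R : ℝ) (φ : E n → ℝ) : HasCompactSupport (clip R φ) := by
  refine HasCompactSupport.intro (isCompact_closedBall (0 : E n) R) fun x hx => ?_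
  have : R - ‖x‖ ≤ 0 := by
    simp only [Metric.mem_closedBall, dist_zero_right, not_le] at hx
    linarith
  simp [clip, max_eq_right this]

theorem tendsto_integral_clip (μ : P1 n) {φ : E n → ℝ} (hφ : LipschitzWith 1 φ) :
    Tendsto (fun N : ℕ => ∫ x, clip N φ x ∂μ.toMeasure) atTop (𝓝 (∫ x, φ x ∂μ.toMeasure)) := by
  refine tendsto_integral_of_dominated_convergence (fun x => |φ x|)
    (fun N => (lipschitzWith_clip _ hφ).continuous.aestronglyMeasurable)
    (μ.integrable_lipschitz_real hφ).abs
    (fun N => Eventually.of_forall fun x => abs_clip_le _ _ _)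
    (Eventually.of_forall fun x => ?_)
  refine tendsto_const_nhds.congr' ?_
  obtain ⟨N, hN⟩ := exists_nat_ge (|φ x| + ‖x‖)
  filter_upwards [eventually_ge_atTop N] with k hk
  exact (clip_eq_self (hN.trans (by exact_mod_cast hk))).symm

theorem abs_integral_mollify_sub_le (μ : P1 n) {φ : E n → ℝ} {K : ℝ≥0} (hφ : LipschitzWith K φ)
    {ε : ℝ} (hε : 0 < ε) :
    |∫ x, mollify ε hε φ x ∂μ.toMeasure - ∫ x, φ x ∂μ.toMeasure| ≤ K * ε := by
  rw [← integral_sub (μ.integrable_lipschitz_real (lipschitzWith_mollify hε hφ))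
    (μ.integrable_lipschitz_real hφ)]
  have := norm_integral_le_of_norm_le_const (μ := μ.toMeasure)
    (Eventually.of_forall fun x => norm_mollify_sub_le hε hφ x)
  simpa using this

/-- It suffices to test the Kantorovich distance against mollified functions of compact
support; the test functions vanish on a ball if the given one vanishes on a larger ball. -/
theorem integral_sub_le_of_smooth {μ ν : P1 n} {φ : E n → ℝ} (hφ : LipschitzWith 1 φ) {r r' b : ℝ}
    (hr : r' < r) (h0 : ∀ x ∈ Metric.ball (0 : E n) r, φ x = 0)
    (h : ∀ ψ : E n → ℝ, ContDiff ℝ (⊤ : ℕ∞) ψ → HasCompactSupport ψ → LipschitzWith 1 ψ →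
      (∀ x ∈ Metric.ball (0 : E n) r', ψ x = 0) →
      ∫ x, ψ x ∂μ.toMeasure - ∫ x, ψ x ∂ν.toMeasure ≤ b) :
    ∫ x, φ x ∂μ.toMeasure - ∫ x, φ x ∂ν.toMeasure ≤ b := by
  refine le_of_tendsto ((tendsto_integral_clip μ hφ).sub (tendsto_integral_clip ν hφ))
    (Eventually.of_forall fun N => ?_)
  have hc := lipschitzWith_clip N hφ
  refine le_of_forall_pos_le_add fun δ hδ => ?_
  -- `ε ≤ δ / 2` pays for the mollification under both measures; `ε ≤ r - r'` keeps the `ε`-ball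
  -- around a point of the smaller ball inside the larger one.
  obtain ⟨ε, hε, hε1, hε2⟩ : ∃ ε : ℝ, 0 < ε ∧ ε ≤ δ / 2 ∧ ε ≤ r - r' :=
    ⟨min (δ / 2) (r - r'), lt_min (by linarith) (by linarith), min_le_left _ _, min_le_right _ _⟩
  have key := h (mollify ε hε (clip N φ)) (contDiff_mollify hε hc)
    (hasCompactSupport_mollify hε (hasCompactSupport_clip _ _)) (lipschitzWith_mollify hε hc)
    (fun x hx => mollify_eq_zero hε fun y hy => clip_eq_zero_of_eq_zero _ (h0 y (by
      rw [mem_ball_zero_iff] at hx ⊢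
      rw [Metric.mem_ball, dist_eq_norm] at hy
      have := norm_le_norm_sub_add y x
      linarith)))
  have e1 := abs_le.1 (abs_integral_mollify_sub_le μ hc hε)
  have e2 := abs_le.1 (abs_integral_mollify_sub_le ν hc hε)
  simp only [NNReal.coe_one, one_mul] at e1 e2
  linarith [e1.1, e2.2]

theorem dist_le_of_smooth {μ ν : P1 n} {b : ℝ}
    (h : ∀ ψ : E n → ℝ, ContDiff ℝ (⊤ : ℕ∞) ψ → HasCompactSupport ψ → LipschitzWith 1 ψ →
      ∫ x, ψ x ∂μ.toMeasure - ∫ x, ψ x ∂ν.toMeasure ≤ b) : dist μ ν ≤ b :=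
  -- With the radii `-1 < 0` both balls are empty and the vanishing conditions are void.
  dist_le_of_forall fun φ hφ => integral_sub_le_of_smooth hφ (r := 0) (r' := -1) (by norm_num)
    (by simp) fun ψ h1 h2 h3 _ => h ψ h1 h2 h3

end P1

/-! ### Regular families of vector fields -/

/-- A family of vector fields `F μ i`, depending on a measure `μ`, that is uniformly bounded and
Lipschitz in the space variable and in the measure. -/
structure IsRegular {n : ℕ} {ι : Type*} (F : P1 n → ι → E n → E n) (C L : ℝ≥0) : Prop where
  bound : ∀ μ i x, ‖F μ i x‖ ≤ C
  lip : ∀ μ i, LipschitzWith L (F μ i)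
  dist_le : ∀ μ ν i x, ‖F μ i x - F ν i x‖ ≤ L * dist μ ν

/-- The action of the vector field `F μ i` on the test function `ψ`, averaged with respect
to `μ`. -/
def transport {n : ℕ} {ι : Type*} (F : P1 n → ι → E n → E n) (ψ : E n → ℝ) (i : ι)
    (μ : P1 n) : ℝ :=
  ∫ x, fderiv ℝ ψ x (F μ i x) ∂μ.toMeasure

section Transport

variable {n : ℕ} {ι : Type*} {F : P1 n → ι → E n → E n} {C L : ℝ≥0}

theorem lipschitzWith_fderiv_apply {ψ : E n → ℝ} {ℓ K : ℝ≥0} (hψ : ∀ x, ‖fderiv ℝ ψ x‖ ≤ ℓ)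
    (hψ' : LipschitzWith K (fderiv ℝ ψ)) {v : E n → E n} (hv : ∀ x, ‖v x‖ ≤ C)
    (hv' : LipschitzWith L v) : LipschitzWith (K * C + ℓ * L) (fun x => fderiv ℝ ψ x (v x)) := by
  refine LipschitzWith.of_dist_le_mul fun x y => ?_
  rw [Real.dist_eq]
  have e : fderiv ℝ ψ x (v x) - fderiv ℝ ψ y (v y)
      = (fderiv ℝ ψ x - fderiv ℝ ψ y) (v x) + fderiv ℝ ψ y (v x - v y) := by
    simp
  have h1 := (fderiv ℝ ψ x - fderiv ℝ ψ y).le_opNorm (v x)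
  have h2 := (fderiv ℝ ψ y).le_opNorm (v x - v y)
  have h3 := hψ'.norm_sub_le x y
  have h4 := hv'.norm_sub_le x y
  have h5 : ‖fderiv ℝ ψ x - fderiv ℝ ψ y‖ * ‖v x‖ ≤ (K * ‖x - y‖) * C := by
    gcongr
    exact hv x
  have h6 : ‖fderiv ℝ ψ y‖ * ‖v x - v y‖ ≤ ℓ * (L * ‖x - y‖) := by
    gcongr
    exact hψ y
  rw [e, dist_eq_norm]
  push_cast
  calc _ ≤ ‖(fderiv ℝ ψ x - fderiv ℝ ψ y) (v x)‖ + ‖fderiv ℝ ψ y (v x - v y)‖ := abs_add_le _ _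
    _ ≤ _ := by linarith

theorem IsRegular.integrable_fderiv (hF : IsRegular F C L) {ψ : E n → ℝ} {ℓ K : ℝ≥0}
    (hψ : ∀ x, ‖fderiv ℝ ψ x‖ ≤ ℓ) (hψ' : LipschitzWith K (fderiv ℝ ψ)) (μ ν : P1 n) (i : ι) :
    Integrable (fun x => fderiv ℝ ψ x (F μ i x)) ν.toMeasure :=
  ν.integrable_lipschitz_real (lipschitzWith_fderiv_apply hψ hψ' (hF.bound μ i) (hF.lip μ i))

theorem IsRegular.abs_transport_le (hF : IsRegular F C L) {ψ : E n → ℝ} {ℓ : ℝ≥0}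
    (hψ : ∀ x, ‖fderiv ℝ ψ x‖ ≤ ℓ) (i : ι) (μ : P1 n) : |transport F ψ i μ| ≤ ℓ * C := by
  have := norm_integral_le_of_norm_le_const (μ := μ.toMeasure) (f := fun x => fderiv ℝ ψ x (F μ i x))
    (C := ℓ * C) (Eventually.of_forall fun x => ((fderiv ℝ ψ x).le_opNorm _).trans (by
      gcongr
      · exact hψ x
      · exact hF.bound μ i x))
  simpa [transport] using this

/-- The measure enters twice: changing the averaging measure costs `K * C + ℓ * L`, changing the
field costs a further `ℓ * L`. -/
theorem IsRegular.abs_transport_sub_le (hF : IsRegular F C L) {ψ : E n → ℝ} {ℓ K : ℝ≥0}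
    (hψ : ∀ x, ‖fderiv ℝ ψ x‖ ≤ ℓ) (hψ' : LipschitzWith K (fderiv ℝ ψ)) (i : ι) (μ ν : P1 n) :
    |transport F ψ i μ - transport F ψ i ν| ≤ (K * C + 2 * ℓ * L) * dist μ ν := by
  have h1 := P1.abs_integral_sub_le_dist μ ν
    (lipschitzWith_fderiv_apply hψ hψ' (hF.bound μ i) (hF.lip μ i))
  have h2 : |∫ x, fderiv ℝ ψ x (F μ i x) ∂ν.toMeasure - ∫ x, fderiv ℝ ψ x (F ν i x) ∂ν.toMeasure|
      ≤ ℓ * (L * dist μ ν) := by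
    rw [← integral_sub (hF.integrable_fderiv hψ hψ' _ _ _) (hF.integrable_fderiv hψ hψ' _ _ _)]
    have := norm_integral_le_of_norm_le_const (μ := ν.toMeasure)
      (f := fun x => fderiv ℝ ψ x (F μ i x) - fderiv ℝ ψ x (F ν i x))
      (C := ℓ * (L * dist μ ν)) (Eventually.of_forall fun x => by
        rw [← map_sub]
        refine ((fderiv ℝ ψ x).le_opNorm _).trans ?_
        gcongr
        · exact hψ x
        · exact hF.dist_le μ ν i x)
    simpa using this
  have := abs_sub_le (transport F ψ i μ) (∫ x, fderiv ℝ ψ x (F μ i x) ∂ν.toMeasure)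
    (transport F ψ i ν)
  unfold transport at *
  push_cast at h1
  linarith

theorem exists_bounds_of_smooth {ψ : E n → ℝ} (hψ : ContDiff ℝ (⊤ : ℕ∞) ψ)
    (hc : HasCompactSupport ψ) : ∃ ℓ K : ℝ≥0, LipschitzWith ℓ ψ ∧ (∀ x, ‖fderiv ℝ ψ x‖ ≤ ℓ) ∧
      LipschitzWith K (fderiv ℝ ψ) := by
  obtain ⟨ℓ, hℓ⟩ := ContDiff.lipschitzWith_of_hasCompactSupport hc hψ (by simp)
  obtain ⟨K, hK⟩ := ContDiff.lipschitzWith_of_hasCompactSupport (hc.fderiv ℝ)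
    (hψ.fderiv_right (m := (⊤ : ℕ∞)) (by simp)) (by simp)
  exact ⟨ℓ, K, hℓ, fun x => norm_fderiv_le_of_lipschitz ℝ hℓ, hK⟩

end Transport

/-! ### The integrated form of the continuity equation -/

section Evolution

variable {n : ℕ} {ι : Type*} {F : P1 n → ι → E n → E n} {C L : ℝ≥0}

/-- The continuity equation driven by `∑ i, a t i • F (μ t) i`, integrated in time against
test functions of the space variable. -/
def IsEvolution [Fintype ι] (R : ℝ) (F : P1 n → ι → E n → E n) (a : ℝ → ι → ℝ) (μ : ℝ → P1 n) : Prop :=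
  ∀ ψ : E n → ℝ, ContDiff ℝ (⊤ : ℕ∞) ψ → HasCompactSupport ψ → ∀ t ∈ Icc 0 R,
    ∫ x, ψ x ∂(μ t).toMeasure - ∫ x, ψ x ∂(μ 0).toMeasure
      = ∫ s in (0 : ℝ)..t, ∑ i, a s i * transport F ψ i (μ s)

theorem IsRegular.continuous_transport (hF : IsRegular F C L) {ψ : E n → ℝ}
    (hψ : ContDiff ℝ (⊤ : ℕ∞) ψ) (hc : HasCompactSupport ψ) (i : ι) :
    Continuous (transport F ψ i) := by
  obtain ⟨ℓ, K, -, h2, h3⟩ := exists_bounds_of_smooth hψ hc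
  refine (LipschitzWith.of_dist_le_mul (K := K * C + 2 * ℓ * L) fun μ ν => ?_).continuous
  rw [Real.dist_eq]
  push_cast
  exact hF.abs_transport_sub_le h2 h3 i μ ν

theorem IsRegular.intervalIntegrable [Fintype ι] (hF : IsRegular F C L) {ψ : E n → ℝ}
    (hψ : ContDiff ℝ (⊤ : ℕ∞) ψ) (hc : HasCompactSupport ψ) {a : ℝ → ι → ℝ} {μ : ℝ → P1 n}
    {s t : ℝ} (ha : ∀ i, IntervalIntegrable (fun s => a s i) volume s t)
    (hμ : ContinuousOn μ (uIcc s t)) :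
    IntervalIntegrable (fun s => ∑ i, a s i * transport F ψ i (μ s)) volume s t := by
  have := IntervalIntegrable.sum (μ := volume) (a := s) (b := t) Finset.univ
    (f := fun i s => a s i * transport F ψ i (μ s)) fun i _ =>
      (ha i).mul_continuousOn ((hF.continuous_transport hψ hc i).comp_continuousOn hμ)
  have e : (fun s => ∑ i, a s i * transport F ψ i (μ s))
      = ∑ i, fun s => a s i * transport F ψ i (μ s) := by
    ext s
    simp
  rwa [e]

theorem absolutelyContinuousOnInterval_of_dist_le {X Y : Type*} [PseudoMetricSpace X]
    [PseudoMetricSpace Y] {f : ℝ → X} {g : ℝ → Y} {a b K : ℝ}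
    (hf : AbsolutelyContinuousOnInterval f a b)
    (h : ∀ s t, dist (g s) (g t) ≤ K * dist (f s) (f t)) :
    AbsolutelyContinuousOnInterval g a b := by
  have h1 := Tendsto.const_mul K hf
  rw [mul_zero] at h1
  refine squeeze_zero (fun _ => Finset.sum_nonneg fun _ _ => dist_nonneg) (fun e => ?_) h1
  rw [Finset.mul_sum]
  exact Finset.sum_le_sum fun i _ => h _ _

theorem continuousOn_of_absolutelyContinuousOnInterval {X : Type*} [PseudoMetricSpace X]
    {f : ℝ → X} {a b : ℝ} (hf : AbsolutelyContinuousOnInterval f a b) :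
    ContinuousOn f (uIcc a b) := by
  rw [Metric.continuousOn_iff]
  intro t ht ε hε
  obtain ⟨δ, hδ, h⟩ := (absolutelyContinuousOnInterval_iff f a b).1 hf ε hε
  refine ⟨δ, hδ, fun s hs hst => ?_⟩
  have := h (1, fun _ => (s, t)) ⟨fun i _ => ⟨hs, ht⟩, by
    intro i hi j hj hij
    simp only [Finset.range_one, Finset.coe_singleton, mem_singleton_iff] at hi hj
    exact absurd (hi.trans hj.symm) hij⟩ (by simpa using hst)
  simpa using this

theorem fderiv_mul_prod {V : Type*} [NormedAddCommGroup V] [NormedSpace ℝ V] {η : ℝ → ℝ}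
    {ψ : V → ℝ} (hη : Differentiable ℝ η) (hψ : Differentiable ℝ ψ) (t : ℝ) (x : V) (τ : ℝ)
    (v : V) : fderiv ℝ (fun p : ℝ × V => η p.1 * ψ p.2) (t, x) (τ, v)
      = τ * deriv η t * ψ x + η t * fderiv ℝ ψ x v := by
  have h1 : HasFDerivAt (fun p : ℝ × V => η p.1) ((fderiv ℝ η t).comp
      (ContinuousLinearMap.fst ℝ ℝ V)) (t, x) :=
    (hη t).hasFDerivAt.comp (t, x) hasFDerivAt_fst
  have h2 : HasFDerivAt (fun p : ℝ × V => ψ p.2) ((fderiv ℝ ψ x).comp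
      (ContinuousLinearMap.snd ℝ ℝ V)) (t, x) :=
    (hψ x).hasFDerivAt.comp (t, x) hasFDerivAt_snd
  rw [(h1.fun_mul h2).fderiv]
  have : fderiv ℝ η t τ = τ * deriv η t := by
    rw [← fderiv_apply_one_eq_deriv, ← smul_eq_mul, ← map_smul, smul_eq_mul, mul_one]
  simp [this]
  ring

theorem IsRegular.integral_fderiv_mul [Fintype ι] (hF : IsRegular F C L) {ψ : E n → ℝ}
    (hψ : ContDiff ℝ (⊤ : ℕ∞) ψ) (hc : HasCompactSupport ψ) {v : ℝ → E n → E n}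
    {μ : ℝ → P1 n} {a : ℝ → ι → ℝ} (hv : ∀ t x, v t x = ∑ i, a t i • F (μ t) i x)
    {η : ℝ → ℝ} (hη : ContDiff ℝ (⊤ : ℕ∞) η) (t : ℝ) :
    ∫ x, (fderiv ℝ (fun p : ℝ × E n => η p.1 * ψ p.2) (t, x) (1, 0)
        + fderiv ℝ (fun p : ℝ × E n => η p.1 * ψ p.2) (t, x) (0, v t x)) ∂(μ t).toMeasure
      = deriv η t * (∫ x, ψ x ∂(μ t).toMeasure)
        + η t * ∑ i, a t i * transport F ψ i (μ t) := by
  obtain ⟨ℓ, K, h1, h2, h3⟩ := exists_bounds_of_smooth hψ hc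
  have hηd := hη.differentiable (by simp)
  have hψd := hψ.differentiable (by simp)
  have e : ∀ x, fderiv ℝ (fun p : ℝ × E n => η p.1 * ψ p.2) (t, x) (1, 0)
      + fderiv ℝ (fun p : ℝ × E n => η p.1 * ψ p.2) (t, x) (0, v t x)
      = deriv η t * ψ x + η t * ∑ i, a t i * fderiv ℝ ψ x (F (μ t) i x) := by
    intro x
    rw [fderiv_mul_prod hηd hψd, fderiv_mul_prod hηd hψd, hv, map_sum]
    simp
  have hi : ∀ i, Integrable (fun x => a t i * fderiv ℝ ψ x (F (μ t) i x)) (μ t).toMeasure :=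
    fun i => (hF.integrable_fderiv h2 h3 _ _ i).const_mul _
  simp_rw [e]
  rw [integral_add ((P1.integrable_lipschitz_real _ h1).const_mul _)
    ((integrable_finsetSum _ fun i _ => hi i).const_mul _), integral_const_mul,
    integral_const_mul, integral_finsetSum _ fun i _ => hi i]
  simp only [transport, integral_const_mul]

/-- Tested against products `η(t) ψ(x)`, the weak equation says that the absolutely continuous
function `t ↦ ∫ ψ dμ_t` has the expected distributional derivative on `(0,R)`. This is then its
derivative a.e., and integrating recovers the function. -/
theorem IsWeakSolution.isEvolution [Fintype ι] (hF : IsRegular F C L) {R : ℝ} (hR : 0 < R)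
    {v : ℝ → E n → E n} {ϑ : P1 n} {μ : ℝ → P1 n} {a : ℝ → ι → ℝ}
    (hμ : IsWeakSolution R v ϑ μ) (hv : ∀ t x, v t x = ∑ i, a t i • F (μ t) i x)
    (ha : ∀ i, IntervalIntegrable (fun s => a s i) volume 0 R) :
    IsEvolution R F a μ := by
  obtain ⟨hac, -, hw⟩ := hμ
  intro ψ hψ hc
  obtain ⟨ℓ, K, h1, h2, h3⟩ := exists_bounds_of_smooth hψ hc
  set m : ℝ → ℝ := fun t => ∫ x, ψ x ∂(μ t).toMeasure with hm
  set h : ℝ → ℝ := fun s => ∑ i, a s i * transport F ψ i (μ s) with hh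
  have hmac : AbsolutelyContinuousOnInterval m 0 R :=
    absolutelyContinuousOnInterval_of_dist_le hac (K := ℓ) fun s t => by
      rw [Real.dist_eq]
      exact P1.abs_integral_sub_le_dist _ _ h1
  have hhi : IntervalIntegrable h volume 0 R :=
    hF.intervalIntegrable hψ hc ha (continuousOn_of_absolutelyContinuousOnInterval hac)
  have hmi := hmac.intervalIntegrable_deriv
  have inner := fun (η : ℝ → ℝ) (hη : ContDiff ℝ (⊤ : ℕ∞) η) t =>
    hF.integral_fderiv_mul hψ hc hv hη t
  have hae : ∀ᵐ t, t ∈ Ioo 0 R → h t - deriv m t = 0 := by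
    refine IsOpen.ae_eq_zero_of_integral_contDiff_smul_eq_zero (E := ℝ) (F := ℝ) (μ := volume)
      (f := fun t => h t - deriv m t) (U := Ioo 0 R) isOpen_Ioo ?_ ?_
    · have hio : IntegrableOn (fun t => h t - deriv m t) (Ioo 0 R) volume := by
        rw [← integrableOn_Ioc_iff_integrableOn_Ioo]
        exact ((intervalIntegrable_iff_integrableOn_Ioc_of_le hR.le).1 (hhi.sub hmi))
      exact hio.locallyIntegrableOn
    · intro η hη hηc hηs
      have hη0 : ∀ t ∉ Ioo 0 R, η t = 0 := fun t ht =>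
        image_eq_zero_of_notMem_tsupport fun h' => ht (hηs h')
      have hsub : Function.support (fun p : ℝ × E n => η p.1 * ψ p.2)
          ⊆ tsupport η ×ˢ tsupport ψ := by
        intro p hp
        have hp' : η p.1 * ψ p.2 ≠ 0 := hp
        exact ⟨subset_tsupport _ (left_ne_zero_of_mul hp'),
          subset_tsupport _ (right_ne_zero_of_mul hp')⟩
      have hcomp : IsCompact (tsupport η ×ˢ tsupport ψ) := IsCompact.prod hηc hc
      have w := hw (fun p => η p.1 * ψ p.2)
        ((hη.comp contDiff_fst).mul (hψ.comp contDiff_snd))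
        (HasCompactSupport.of_support_subset_isCompact hcomp hsub)
        ((closure_minimal hsub hcomp.isClosed).trans
          (prod_mono hηs (subset_univ _)))
      simp_rw [inner η hη] at w
      have hηac : AbsolutelyContinuousOnInterval η 0 R :=
        (hη.of_le (by exact_mod_cast le_top) : ContDiff ℝ 1 η).contDiffOn.absolutelyContinuousOnInterval
      have ibp := hηac.integral_mul_deriv_eq_deriv_mul hmac
      rw [hη0 0 (by simp), hη0 R (by simp)] at ibp
      have hc1 : Continuous (deriv η) := hη.continuous_deriv (by exact_mod_cast le_top)
      have i1 : IntervalIntegrable (fun t => deriv η t * m t) volume 0 R :=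
        (hc1.continuousOn.mul hmac.continuousOn).intervalIntegrable
      have i2 : IntervalIntegrable (fun t => η t * h t) volume 0 R :=
        hhi.continuousOn_mul hη.continuous.continuousOn
      have i3 : IntervalIntegrable (fun t => η t * deriv m t) volume 0 R :=
        hmi.continuousOn_mul hη.continuous.continuousOn
      rw [intervalIntegral.integral_add i1 i2] at w
      rw [← intervalIntegral.integral_eq_integral_of_support_subset (a := 0) (b := R)]
      · simp only [smul_eq_mul, mul_sub]
        rw [intervalIntegral.integral_sub i2 i3]
        linarith
      · intro t ht
        by_contra hn
        refine Function.mem_support.1 ht ?_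
        have : η t = 0 := hη0 t fun h' => hn (Ioo_subset_Ioc_self h')
        simp [this]
  intro t ht
  have hsubt : uIcc 0 t ⊆ uIcc 0 R := by
    rw [uIcc_of_le ht.1, uIcc_of_le hR.le]
    exact Icc_subset_Icc_right ht.2
  rw [← (hmac.mono hsubt).integral_deriv_eq_sub]
  refine intervalIntegral.integral_congr_ae ?_
  have hne : ∀ᵐ s : ℝ, s ≠ R := by simp [ae_iff, measure_singleton]
  filter_upwards [hae, hne] with s hs hsR hst
  rw [uIoc_of_le ht.1] at hst
  have := hs ⟨hst.1, lt_of_le_of_ne (hst.2.trans ht.2) hsR⟩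
  linarith

end Evolution

/-! ### Curves driven by normalized coefficients -/

/-- A continuous curve that solves the integrated continuity equation with coefficients
in the `ℓ¹` unit ball. -/
structure IsNormalizedEvolution {n : ℕ} {ι : Type*} [Fintype ι] (R : ℝ)
    (F : P1 n → ι → E n → E n) (a : ℝ → ι → ℝ) (μ : ℝ → P1 n) : Prop where
  integrable : ∀ i, IntervalIntegrable (fun s => a s i) volume 0 R
  le_one : ∀ᵐ s, s ∈ Icc 0 R → ∑ i, |a s i| ≤ 1
  continuousOn : ContinuousOn μ (Icc 0 R)
  evolution : IsEvolution R F a μ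

section Normalized

variable {n : ℕ} {ι : Type*} [Fintype ι] {F : P1 n → ι → E n → E n} {C L : ℝ≥0} {R : ℝ}
  {a : ℝ → ι → ℝ} {μ : ℝ → P1 n}

theorem abs_sum_mul_le {b T : ι → ℝ} {B : ℝ} (h : ∀ i, |T i| ≤ B) :
    |∑ i, b i * T i| ≤ (∑ i, |b i|) * B := by
  refine (Finset.abs_sum_le_sum_abs _ _).trans ?_
  rw [Finset.sum_mul]
  refine Finset.sum_le_sum fun i _ => ?_
  rw [abs_mul]
  exact mul_le_mul_of_nonneg_left (h i) (abs_nonneg _)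

namespace IsNormalizedEvolution

theorem intervalIntegrable (h : IsNormalizedEvolution R F a μ) {s t : ℝ} (hs : s ∈ Icc 0 R)
    (ht : t ∈ Icc 0 R) (i : ι) : IntervalIntegrable (fun s => a s i) volume s t :=
  (h.integrable i).mono_set (by
    rw [uIcc_of_le (hs.1.trans hs.2)]
    exact uIcc_subset_Icc hs ht)

theorem increment (h : IsNormalizedEvolution R F a μ) (hF : IsRegular F C L) {ψ : E n → ℝ}
    (hψ : ContDiff ℝ (⊤ : ℕ∞) ψ) (hc : HasCompactSupport ψ) {s t : ℝ} (hs : s ∈ Icc 0 R)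
    (ht : t ∈ Icc 0 R) :
    ∫ x, ψ x ∂(μ t).toMeasure - ∫ x, ψ x ∂(μ s).toMeasure
      = ∫ σ in s..t, ∑ i, a σ i * transport F ψ i (μ σ) := by
  have h0 : (0 : ℝ) ∈ Icc 0 R := ⟨le_rfl, hs.1.trans hs.2⟩
  have int : ∀ r ∈ Icc 0 R, IntervalIntegrable
      (fun σ => ∑ i, a σ i * transport F ψ i (μ σ)) volume 0 r := fun r hr =>
    hF.intervalIntegrable hψ hc (h.intervalIntegrable h0 hr)
      (h.continuousOn.mono (uIcc_subset_Icc h0 hr))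
  rw [← intervalIntegral.integral_interval_sub_left (int t ht) (int s hs),
    ← h.evolution ψ hψ hc t ht, ← h.evolution ψ hψ hc s hs]
  ring

theorem abs_increment_le (h : IsNormalizedEvolution R F a μ) (hF : IsRegular F C L) {ψ : E n → ℝ}
    (hψ : ContDiff ℝ (⊤ : ℕ∞) ψ) (hc : HasCompactSupport ψ) {s t : ℝ} (hs : s ∈ Icc 0 R)
    (ht : t ∈ Icc 0 R) {B : ℝ} (hB0 : 0 ≤ B)
    (hB : ∀ σ ∈ Icc 0 R, ∀ i, |transport F ψ i (μ σ)| ≤ B) :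
    |∫ x, ψ x ∂(μ t).toMeasure - ∫ x, ψ x ∂(μ s).toMeasure| ≤ B * |t - s| := by
  rw [h.increment hF hψ hc hs ht, ← Real.norm_eq_abs]
  refine intervalIntegral.norm_integral_le_of_norm_le_const_ae ?_
  filter_upwards [h.le_one] with σ hσ hst
  have hσ' : σ ∈ Icc 0 R := uIcc_subset_Icc hs ht (uIoc_subset_uIcc hst)
  rw [Real.norm_eq_abs]
  refine (abs_sum_mul_le (hB σ hσ')).trans ?_
  exact mul_le_of_le_one_left hB0 (hσ hσ')

/-- The average of a 1-Lipschitz test function changes at rate at most `C`, because the coefficients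
have `ℓ¹` norm at most 1. -/
theorem dist_le (h : IsNormalizedEvolution R F a μ) (hF : IsRegular F C L) {s t : ℝ}
    (hs : s ∈ Icc 0 R) (ht : t ∈ Icc 0 R) : dist (μ s) (μ t) ≤ C * |s - t| := by
  refine P1.dist_le_of_smooth fun ψ h1 h2 h3 => ?_
  have := h.abs_increment_le hF h1 h2 ht hs (B := C) C.2 fun σ _ i => by
    simpa using hF.abs_transport_le (ℓ := 1) (fun x => norm_fderiv_le_of_lipschitz ℝ h3) i (μ σ)
  exact (le_abs_self _).trans this

end IsNormalizedEvolution

/-! ### First moments and tails along normalized evolutions -/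

namespace P1

/-- The part of the first moment outside the ball of radius `r`. -/
def tail (μ : P1 n) (r : ℝ) : ℝ := ∫ x, max (‖x‖ - r) 0 ∂μ.toMeasure

theorem lipschitzWith_tail (r : ℝ) : LipschitzWith 1 (fun x : E n => max (‖x‖ - r) 0) := by
  have : LipschitzWith 1 (fun x : E n => ‖x‖ - r) := by
    simpa using (lipschitzWith_one_norm (E := E n)).sub (LipschitzWith.const (α := E n) r)
  exact this.max_const 0

theorem tendsto_tail (μ : P1 n) : Tendsto μ.tail atTop (𝓝 0) := by
  have := tendsto_integral_filter_of_dominated_convergence (μ := μ.toMeasure) (l := atTop)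
    (F := fun (r : ℝ) (x : E n) => max (‖x‖ - r) 0) (f := fun _ => 0) (fun x => ‖x‖)
    (Eventually.of_forall fun r =>
      (lipschitzWith_tail r).continuous.aestronglyMeasurable)
    (by
      filter_upwards [eventually_ge_atTop 0] with r hr
      refine Eventually.of_forall fun x => ?_
      rw [Real.norm_of_nonneg (le_max_right _ _)]
      exact max_le (by linarith) (norm_nonneg _))
    μ.firstMoment (Eventually.of_forall fun x => by
      refine tendsto_const_nhds.congr' ?_
      filter_upwards [eventually_ge_atTop ‖x‖] with r hr
      exact (max_eq_right (by linarith)).symm)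
  rw [integral_zero] at this
  exact this

/-- The first moment. -/
def moment (μ : P1 n) : ℝ := ∫ x, ‖x‖ ∂μ.toMeasure

theorem moment_nonneg (μ : P1 n) : 0 ≤ μ.moment := integral_nonneg fun _ => norm_nonneg _

end P1

/-- The gradient of `ψ` vanishes inside the ball, and outside it `1 ≤ ‖x‖ / r`, so the first moment
controls the mass that contributes. -/
theorem IsRegular.abs_transport_le_moment {ι : Type*} {F : P1 n → ι → E n → E n}
    (hF : IsRegular F C L) {ψ : E n → ℝ}
    (hψ : LipschitzWith 1 ψ) {r : ℝ} (hr : 0 < r) (h0 : ∀ x ∈ Metric.ball (0 : E n) r, ψ x = 0)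
    (i : ι) (μ : P1 n) : |transport F ψ i μ| ≤ C / r * μ.moment := by
  rw [transport, ← Real.norm_eq_abs, P1.moment, ← integral_const_mul]
  refine norm_integral_le_of_norm_le (μ.firstMoment.const_mul _) (Eventually.of_forall fun x => ?_)
  rcases lt_or_ge ‖x‖ r with hx | hx
  · have : fderiv ℝ ψ x = 0 := by
      have he : ψ =ᶠ[𝓝 x] fun _ => 0 := by
        filter_upwards [Metric.isOpen_ball.mem_nhds (mem_ball_zero_iff.2 hx)] with y hy
        exact h0 y hy
      rw [he.fderiv_eq]
      simp
    rw [this]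
    simp only [_root_.zero_apply, norm_zero]
    positivity
  · refine ((fderiv ℝ ψ x).le_opNorm _).trans ?_
    have h1 : ‖fderiv ℝ ψ x‖ ≤ 1 := by simpa using norm_fderiv_le_of_lipschitz ℝ hψ (x₀ := x)
    calc ‖fderiv ℝ ψ x‖ * ‖F μ i x‖ ≤ 1 * C := by
          gcongr
          exact hF.bound μ i x
      _ ≤ C / r * ‖x‖ := by
          rw [one_mul, div_mul_eq_mul_div, le_div_iff₀ hr]
          gcongr

namespace IsNormalizedEvolution

theorem moment_le (h : IsNormalizedEvolution R F a μ) (hF : IsRegular F C L) {t : ℝ}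
    (ht : t ∈ Icc 0 R) : (μ t).moment ≤ (μ 0).moment + C * R := by
  have h0 : (0 : ℝ) ∈ Icc 0 R := ⟨le_rfl, ht.1.trans ht.2⟩
  have h1 := P1.integral_sub_le_dist (μ t) (μ 0) (lipschitzWith_one_norm (E := E n))
  have h2 := h.dist_le hF ht h0
  rw [sub_zero, abs_of_nonneg ht.1] at h2
  have h3 : C * t ≤ C * R := mul_le_mul_of_nonneg_left ht.2 C.2
  simp only [NNReal.coe_one, one_mul] at h1
  unfold P1.moment
  linarith

/-- The function integrated in `tail` vanishes on the ball of radius `r`, and its smooth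
approximations still vanish on the ball of radius `r / 2`. The bound depends on the curve only
through its initial measure and tends to 0 as `r → ∞`, which is what compactness requires. -/
theorem tail_le (h : IsNormalizedEvolution R F a μ) (hF : IsRegular F C L) {t : ℝ}
    (ht : t ∈ Icc 0 R) {r : ℝ} (hr : 0 < r) :
    (μ t).tail r ≤ (μ 0).tail r + C / (r / 2) * ((μ 0).moment + C * R) * R := by
  have h0 : (0 : ℝ) ∈ Icc 0 R := ⟨le_rfl, ht.1.trans ht.2⟩
  have hR : 0 ≤ R := h0.2
  rw [← sub_le_iff_le_add']
  have hm : 0 ≤ (μ 0).moment + C * R := add_nonneg (P1.moment_nonneg _) (by positivity)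
  refine P1.integral_sub_le_of_smooth (P1.lipschitzWith_tail r) (half_lt_self hr) (fun x hx => ?_)
    fun ψ h1 h2 h3 h4 => ?_
  · rw [mem_ball_zero_iff] at hx
    exact max_eq_right (by linarith)
  · have := h.abs_increment_le hF h1 h2 h0 ht
      (B := C / (r / 2) * ((μ 0).moment + C * R)) (by positivity) fun σ hσ i =>
      (hF.abs_transport_le_moment h3 (half_pos hr) h4 i (μ σ)).trans (by
        gcongr
        exact h.moment_le hF hσ)
    refine (le_abs_self _).trans (this.trans ?_)
    rw [sub_zero, abs_of_nonneg ht.1]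
    gcongr
    exact ht.2

end IsNormalizedEvolution

end Normalized

/-! ### Uniqueness of normalized evolutions -/

section TestFunctions

variable {n : ℕ}

/-- Test functions with Lipschitz constant `ℓ` whose derivative has Lipschitz constant `K`. -/
structure IsTest (ψ : E n → ℝ) (ℓ K : ℝ≥0) : Prop where
  smooth : ContDiff ℝ (⊤ : ℕ∞) ψ
  supp : HasCompactSupport ψ
  lip : LipschitzWith ℓ ψ
  lip' : LipschitzWith K (fderiv ℝ ψ)

theorem IsTest.norm_fderiv_le {ψ : E n → ℝ} {ℓ K : ℝ≥0} (h : IsTest ψ ℓ K) (x : E n) :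
    ‖fderiv ℝ ψ x‖ ≤ ℓ :=
  norm_fderiv_le_of_lipschitz ℝ h.lip

theorem IsTest.const_mul {ψ : E n → ℝ} {ℓ K : ℝ≥0} (h : IsTest ψ ℓ K) (q : ℝ≥0) :
    IsTest (fun x => q * ψ x) (q * ℓ) (q * K) where
  smooth := contDiff_const.mul h.smooth
  supp := h.supp.mul_left (f := fun _ => (q : ℝ))
  lip := by
    refine LipschitzWith.of_dist_le_mul fun x y => ?_
    have := h.lip.dist_le_mul x y
    rw [Real.dist_eq] at this ⊢
    rw [← mul_sub, abs_mul, NNReal.abs_eq]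
    push_cast
    rw [mul_assoc]
    exact mul_le_mul_of_nonneg_left this q.2
  lip' := by
    have e : fderiv ℝ (fun x => (q : ℝ) * ψ x) = fun x => (q : ℝ) • fderiv ℝ ψ x := by
      ext1 x
      exact fderiv_const_mul (h.smooth.differentiable (by simp) x) _
    rw [e]
    refine LipschitzWith.of_dist_le_mul fun x y => ?_
    have := h.lip'.dist_le_mul x y
    rw [dist_eq_norm] at this ⊢
    rw [← smul_sub, norm_smul, Real.norm_of_nonneg q.coe_nonneg]
    push_cast
    rw [mul_assoc]
    exact mul_le_mul_of_nonneg_left this q.2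

/-- The second constant comes from the chain rule for the derivative: `K * P * P` from moving the
base point, `ℓ * Q` from the variation of `DΦ`. Bounded displacement keeps the support compact. -/
theorem IsTest.comp {ψ : E n → ℝ} {ℓ K P Q : ℝ≥0} (h : IsTest ψ ℓ K) {Φ : E n → E n}
    (hΦ : ContDiff ℝ (⊤ : ℕ∞) Φ) (hP : LipschitzWith P Φ) (hQ : LipschitzWith Q (fderiv ℝ Φ))
    {B : ℝ} (hB : ∀ x, ‖Φ x - x‖ ≤ B) : IsTest (ψ ∘ Φ) (ℓ * P) (K * P * P + ℓ * Q) where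
  smooth := h.smooth.comp hΦ
  supp := by
    obtain ⟨ρ, hρ⟩ := h.supp.isCompact.isBounded.subset_closedBall (0 : E n)
    refine HasCompactSupport.intro (isCompact_closedBall (0 : E n) (ρ + B)) fun x hx => ?_
    refine image_eq_zero_of_notMem_tsupport (f := ψ) (x := Φ x) fun hmem => hx ?_
    have h1 := mem_closedBall_zero_iff.1 (hρ hmem)
    rw [mem_closedBall_zero_iff]
    have h2 := norm_le_norm_add_norm_sub (Φ x) x
    linarith [hB x]
  lip := h.lip.comp hP
  lip' := by
    have hψd := h.smooth.differentiable (by simp)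
    have hΦd := hΦ.differentiable (by simp)
    have e : fderiv ℝ (ψ ∘ Φ) = fun x => (fderiv ℝ ψ (Φ x)).comp (fderiv ℝ Φ x) := by
      ext1 x
      exact fderiv_comp x (hψd _) (hΦd _)
    rw [e]
    refine LipschitzWith.of_dist_le_mul fun x y => ?_
    rw [dist_eq_norm]
    have e2 : (fderiv ℝ ψ (Φ x)).comp (fderiv ℝ Φ x) - (fderiv ℝ ψ (Φ y)).comp (fderiv ℝ Φ y)
        = (fderiv ℝ ψ (Φ x) - fderiv ℝ ψ (Φ y)).comp (fderiv ℝ Φ x)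
          + (fderiv ℝ ψ (Φ y)).comp (fderiv ℝ Φ x - fderiv ℝ Φ y) := by
      ext v
      simp
    have h1 : ‖fderiv ℝ ψ (Φ x) - fderiv ℝ ψ (Φ y)‖ ≤ K * (P * dist x y) := by
      rw [← dist_eq_norm]
      refine (h.lip'.dist_le_mul _ _).trans ?_
      gcongr
      exact hP.dist_le_mul x y
    have h2 : ‖fderiv ℝ Φ x - fderiv ℝ Φ y‖ ≤ Q * dist x y := by
      rw [← dist_eq_norm]
      exact hQ.dist_le_mul x y
    rw [e2]
    calc _ ≤ ‖(fderiv ℝ ψ (Φ x) - fderiv ℝ ψ (Φ y)).comp (fderiv ℝ Φ x)‖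
          + ‖(fderiv ℝ ψ (Φ y)).comp (fderiv ℝ Φ x - fderiv ℝ Φ y)‖ := norm_add_le _ _
      _ ≤ (K * (P * dist x y)) * P + ℓ * (Q * dist x y) := by
          gcongr
          · refine (ContinuousLinearMap.opNorm_comp_le _ _).trans ?_
            gcongr
            exact norm_fderiv_le_of_lipschitz ℝ hP
          · refine (ContinuousLinearMap.opNorm_comp_le _ _).trans ?_
            gcongr
            exact h.norm_fderiv_le _
      _ = _ := by push_cast; ring

/-- The mean value inequality on the segment suffices, since `Dψ` varies there by at most `K * ‖v‖`;
the sharper factor `1/2` is not needed. -/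
theorem IsTest.abs_taylor_le {ψ : E n → ℝ} {ℓ K : ℝ≥0} (h : IsTest ψ ℓ K) (x v : E n) :
    |ψ (x + v) - ψ x - fderiv ℝ ψ x v| ≤ K * ‖v‖ ^ 2 := by
  have hψd := h.smooth.differentiable (by simp)
  have := (convex_segment x (x + v)).norm_image_sub_le_of_norm_fderiv_le' (𝕜 := ℝ) (f := ψ)
    (φ := fderiv ℝ ψ x) (C := K * ‖v‖) (fun y _ => hψd y) (fun y hy => ?_)
    (left_mem_segment ℝ _ _) (right_mem_segment ℝ _ _)
  · simp only [add_sub_cancel_left, Real.norm_eq_abs] at this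
    linarith
  · rw [← dist_eq_norm]
    refine (h.lip'.dist_le_mul y x).trans ?_
    gcongr
    obtain ⟨θ, hθ, rfl⟩ := (segment_eq_image' ℝ x (x + v)) ▸ hy
    simp only [add_sub_cancel_left, dist_eq_norm, norm_smul, Real.norm_of_nonneg hθ.1]
    exact mul_le_of_le_one_left (norm_nonneg _) hθ.2

/-- The class of normalized test functions for the weight `δ`. -/
def TestClass (n : ℕ) (δ : ℝ) : Type :=
  {ψ : E n → ℝ // ∃ ℓ K : ℝ≥0, IsTest ψ ℓ K ∧ (ℓ : ℝ) + δ * K ≤ 1}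

instance (δ : ℝ) : Nonempty (TestClass n δ) :=
  ⟨⟨fun _ => 0, 0, 0, ⟨contDiff_const, HasCompactSupport.zero, LipschitzWith.const' 0, by
    simp⟩, by simp⟩⟩

/-- The dual distance with respect to the normalized test functions. -/
def testDist (δ : ℝ) (μ ν : P1 n) : ℝ :=
  ⨆ ψ : TestClass n δ, (∫ x, ψ.1 x ∂μ.toMeasure - ∫ x, ψ.1 x ∂ν.toMeasure)

variable {δ : ℝ}

theorem integral_sub_le_dist_of_test (hδ : 0 < δ) (μ ν : P1 n) (ψ : TestClass n δ) :
    ∫ x, ψ.1 x ∂μ.toMeasure - ∫ x, ψ.1 x ∂ν.toMeasure ≤ dist μ ν := by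
  obtain ⟨ψ, ℓ, K, h, h1⟩ := ψ
  refine (P1.integral_sub_le_dist μ ν h.lip).trans (mul_le_of_le_one_left dist_nonneg ?_)
  have : 0 ≤ δ * K := by positivity
  linarith

theorem le_testDist (hδ : 0 < δ) (μ ν : P1 n) (ψ : TestClass n δ) :
    ∫ x, ψ.1 x ∂μ.toMeasure - ∫ x, ψ.1 x ∂ν.toMeasure ≤ testDist δ μ ν :=
  le_ciSup (f := fun ψ : TestClass n δ => ∫ x, ψ.1 x ∂μ.toMeasure - ∫ x, ψ.1 x ∂ν.toMeasure)
    ⟨dist μ ν, by rintro _ ⟨ψ, rfl⟩; exact integral_sub_le_dist_of_test hδ μ ν ψ⟩ ψ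

theorem testDist_self (μ : P1 n) : testDist δ μ μ = 0 := by
  simp [testDist]

theorem testDist_le_add (hδ : 0 < δ) (μ ν μ' ν' : P1 n) :
    testDist δ μ ν ≤ testDist δ μ' ν' + (dist μ μ' + dist ν ν') := by
  refine ciSup_le fun ψ => ?_
  have h1 := le_testDist hδ μ' ν' ψ
  have h2 := integral_sub_le_dist_of_test hδ μ μ' ψ
  have h3 := integral_sub_le_dist_of_test hδ ν' ν ψ
  rw [dist_comm] at h3
  linarith

theorem continuousOn_testDist (hδ : 0 < δ) {s : Set ℝ} {μ ν : ℝ → P1 n} (hμ : ContinuousOn μ s)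
    (hν : ContinuousOn ν s) : ContinuousOn (fun t => testDist δ (μ t) (ν t)) s := by
  intro t ht
  have h1 := (tendsto_iff_dist_tendsto_zero.1 (hμ t ht)).add
    (tendsto_iff_dist_tendsto_zero.1 (hν t ht))
  rw [add_zero] at h1
  refine tendsto_iff_dist_tendsto_zero.2 (squeeze_zero (fun _ => dist_nonneg) (fun u => ?_) h1)
  rw [Real.dist_eq, abs_le]
  have h2 := testDist_le_add hδ (μ u) (ν u) (μ t) (ν t)
  have h3 := testDist_le_add hδ (μ t) (ν t) (μ u) (ν u)
  rw [dist_comm (μ t), dist_comm (ν t)] at h3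
  constructor <;> linarith

theorem IsTest.integral_sub_le (hδ : 0 < δ) {ψ : E n → ℝ} {ℓ K : ℝ≥0} (h : IsTest ψ ℓ K) {q : ℝ}
    (hq : 0 < q) (hle : (ℓ : ℝ) + δ * K ≤ q) (μ ν : P1 n) :
    ∫ x, ψ x ∂μ.toMeasure - ∫ x, ψ x ∂ν.toMeasure ≤ q * testDist δ μ ν := by
  lift q to ℝ≥0 using hq.le
  have h1 := le_testDist hδ μ ν ⟨_, _, _, h.const_mul q⁻¹, by
    push_cast
    rw [mul_left_comm, ← mul_add, inv_mul_le_iff₀ hq, mul_one]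
    exact hle⟩
  simp only [integral_const_mul] at h1
  rw [← mul_sub] at h1
  push_cast at h1
  rwa [inv_mul_le_iff₀ hq] at h1

theorem IsTest.mollify {ψ : E n → ℝ} (hc : HasCompactSupport ψ) {ℓ : ℝ≥0}
    (h : LipschitzWith ℓ ψ) {ε : ℝ} (hε : 0 < ε) :
    IsTest (mollify ε hε ψ) ℓ (mollConst (E n) ε hε * ℓ) :=
  ⟨contDiff_mollify hε h, hasCompactSupport_mollify hε hc, lipschitzWith_mollify hε h,
    lipschitzWith_fderiv_mollify hε h⟩

/-- A mollified 1-Lipschitz function has `Lip ψ ≤ 1` and `δ Lip(Dψ) ≤ 1`, hence lies in twice the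
normalized class. Mollifying under each of the two measures costs `ε`. -/
theorem dist_le_testDist {ε : ℝ} (hε : 0 < ε) (hδ : 0 < δ) (hδ' : δ * mollConst (E n) ε hε ≤ 1)
    (μ ν : P1 n) : dist μ ν ≤ 2 * testDist δ μ ν + 2 * ε := by
  refine P1.dist_le_of_smooth fun ψ h1 h2 h3 => ?_
  have key := (IsTest.mollify h2 h3 hε).integral_sub_le hδ (q := 2) two_pos (by
    push_cast
    linarith) μ ν
  have e1 := abs_le.1 (P1.abs_integral_mollify_sub_le μ h3 hε)
  have e2 := abs_le.1 (P1.abs_integral_mollify_sub_le ν h3 hε)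
  simp only [NNReal.coe_one, one_mul] at e1 e2
  linarith [e1.1, e2.2]

end TestFunctions

/-! ### The dual Gronwall estimate -/

section Uniqueness

variable {n : ℕ} {ι : Type*} [Fintype ι] {F : P1 n → ι → E n → E n} {C L : ℝ≥0} {R : ℝ}
  {a : ℝ → ι → ℝ} {μ ν : ℝ → P1 n}

theorem sum_abs_integral_le (h : IsNormalizedEvolution R F a μ) {s t : ℝ} (hs : s ∈ Icc 0 R)
    (ht : t ∈ Icc 0 R) (hst : s ≤ t) : ∑ i, |∫ σ in s..t, a σ i| ≤ t - s := by
  have hi := fun i => h.intervalIntegrable hs ht i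
  calc ∑ i, |∫ σ in s..t, a σ i| ≤ ∑ i, ∫ σ in s..t, |a σ i| :=
        Finset.sum_le_sum fun i _ => intervalIntegral.abs_integral_le_integral_abs hst
    _ = ∫ σ in s..t, ∑ i, |a σ i| := by
        rw [intervalIntegral.integral_finsetSum fun i _ => (hi i).abs]
    _ ≤ ∫ σ in s..t, (1 : ℝ) := by
        refine intervalIntegral.integral_mono_ae_restrict hst ?_ (by simp) ?_
        · have := IntervalIntegrable.sum (μ := volume) (a := s) (b := t) Finset.univ
            (f := fun i σ => |a σ i|) fun i _ => (hi i).abs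
          have e : (fun σ => ∑ i, |a σ i|) = ∑ i, fun σ => |a σ i| := by
            ext σ
            simp
          rwa [e]
        · filter_upwards [ae_restrict_of_ae h.le_one, ae_restrict_mem measurableSet_Icc]
            with σ h1 h2
          exact h1 ⟨hs.1.trans h2.1, h2.2.trans ht.2⟩
    _ = t - s := by simp

/-- Over a short time step, the coefficients of the equation can be averaged and the measure
can be frozen, up to a quadratic error. -/
theorem IsNormalizedEvolution.abs_increment_sub_le (h : IsNormalizedEvolution R F a μ)
    (hF : IsRegular F C L) {ψ : E n → ℝ} {ℓ K : ℝ≥0} (hψ : IsTest ψ ℓ K) {s t : ℝ}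
    (hs : s ∈ Icc 0 R) (ht : t ∈ Icc 0 R) (hst : s ≤ t) :
    |∫ x, ψ x ∂(μ t).toMeasure - ∫ x, ψ x ∂(μ s).toMeasure
      - ∫ x, fderiv ℝ ψ x (∑ i, (∫ σ in s..t, a σ i) • F (μ s) i x) ∂(μ s).toMeasure|
      ≤ (K * C + 2 * ℓ * L) * C * (t - s) ^ 2 := by
  have hi := fun i => h.intervalIntegrable hs ht i
  have e1 : ∫ x, fderiv ℝ ψ x (∑ i, (∫ σ in s..t, a σ i) • F (μ s) i x) ∂(μ s).toMeasure
      = ∫ σ in s..t, ∑ i, a σ i * transport F ψ i (μ s) := by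
    rw [intervalIntegral.integral_finsetSum fun i _ => (hi i).mul_const _]
    simp only [map_sum, map_smul, smul_eq_mul]
    rw [integral_finsetSum _ fun i _ =>
      (hF.integrable_fderiv hψ.norm_fderiv_le hψ.lip' _ _ i).const_mul _]
    simp only [integral_const_mul, intervalIntegral.integral_mul_const, transport]
  have i2 : IntervalIntegrable (fun σ => ∑ i, a σ i * transport F ψ i (μ s)) volume s t :=
    hF.intervalIntegrable hψ.smooth hψ.supp (μ := fun _ => μ s) hi continuousOn_const
  have i1 : IntervalIntegrable (fun σ => ∑ i, a σ i * transport F ψ i (μ σ)) volume s t :=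
    hF.intervalIntegrable hψ.smooth hψ.supp hi (h.continuousOn.mono (uIcc_subset_Icc hs ht))
  rw [h.increment hF hψ.smooth hψ.supp hs ht, e1, ← intervalIntegral.integral_sub i1 i2]
  -- The constant is the Lipschitz constant of `transport` times `C * (t - s)`, the distance the
  -- curve can travel in the step.
  have key := intervalIntegral.norm_integral_le_of_norm_le_const_ae (a := s) (b := t)
    (f := fun σ => ∑ i, a σ i * transport F ψ i (μ σ) - ∑ i, a σ i * transport F ψ i (μ s))
    (C := (K * C + 2 * ℓ * L) * (C * (t - s))) (by
      filter_upwards [h.le_one] with σ hσ hσt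
      have hσ' : σ ∈ Icc 0 R := uIcc_subset_Icc hs ht (uIoc_subset_uIcc hσt)
      rw [uIoc_of_le hst] at hσt
      rw [Real.norm_eq_abs, ← Finset.sum_sub_distrib]
      simp only [← mul_sub]
      have hts : 0 ≤ t - s := sub_nonneg.2 hst
      refine (abs_sum_mul_le (B := (K * C + 2 * ℓ * L) * (C * (t - s))) fun i => ?_).trans
        (mul_le_of_le_one_left (by positivity) (hσ hσ'))
      refine (hF.abs_transport_sub_le hψ.norm_fderiv_le hψ.lip' i _ _).trans ?_
      gcongr
      refine (h.dist_le hF hσ' hs).trans ?_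
      gcongr
      rw [abs_of_nonneg (by linarith [hσt.1])]
      linarith [hσt.2])
  rw [Real.norm_eq_abs, abs_of_nonneg (sub_nonneg.2 hst)] at key
  linarith

theorem lipschitzWith_sum_smul (hF : IsRegular F C L) (μ : P1 n) {b : ι → ℝ} {h : ℝ≥0}
    (hb : ∑ i, |b i| ≤ h) : LipschitzWith (h * L) (fun x => ∑ i, b i • F μ i x) := by
  refine LipschitzWith.of_dist_le_mul fun x y => ?_
  rw [dist_eq_norm, ← Finset.sum_sub_distrib]
  push_cast
  calc ‖∑ i, (b i • F μ i x - b i • F μ i y)‖ ≤ ∑ i, |b i| * (L * dist x y) := by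
        refine norm_sum_le_of_le _ fun i _ => ?_
        rw [← smul_sub, norm_smul, Real.norm_eq_abs, ← dist_eq_norm]
        gcongr
        exact (hF.lip μ i).dist_le_mul x y
    _ ≤ h * L * dist x y := by
        rw [← Finset.sum_mul, mul_assoc]
        gcongr

theorem norm_sum_smul_le {V : Type*} [NormedAddCommGroup V] [NormedSpace ℝ V] {b : ι → ℝ}
    {v : ι → V} {h B : ℝ} (hB : 0 ≤ B) (hb : ∑ i, |b i| ≤ h) (hv : ∀ i, ‖v i‖ ≤ B) :
    ‖∑ i, b i • v i‖ ≤ h * B := by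
  calc ‖∑ i, b i • v i‖ ≤ ∑ i, |b i| * B := by
        refine norm_sum_le_of_le _ fun i _ => ?_
        rw [norm_smul, Real.norm_eq_abs]
        exact mul_le_mul_of_nonneg_left (hv i) (abs_nonneg _)
    _ ≤ h * B := by
        rw [← Finset.sum_mul]
        gcongr

/-- Transport along a vector field and composition with the flow of a nearby field over a unit
of time differ by a quadratic term. -/
theorem IsTest.abs_integral_comp_sub_le {ψ : E n → ℝ} {ℓ K : ℝ≥0} (hψ : IsTest ψ ℓ K)
    {V W : E n → E n} {B δ : ℝ} {Q : ℝ≥0} (hV : LipschitzWith Q V) (hW : Continuous W)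
    (hVB : ∀ x, ‖V x‖ ≤ B)
    (hVW : ∀ x, ‖V x - W x‖ ≤ δ) (ρ : P1 n) :
    |∫ x, ψ (x + V x) ∂ρ.toMeasure - ∫ x, ψ x ∂ρ.toMeasure
      - ∫ x, fderiv ℝ ψ x (W x) ∂ρ.toMeasure| ≤ K * B ^ 2 + ℓ * δ := by
  have hWB : ∀ x, ‖W x‖ ≤ B + δ := fun x => by
    have := norm_le_norm_add_norm_sub (V x) (W x)
    linarith [hVB x, hVW x]
  have i1 : Integrable (fun x => ψ (x + V x)) ρ.toMeasure :=
    ρ.integrable_lipschitz_real (hψ.lip.comp (LipschitzWith.id.add hV))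
  have i2 : Integrable ψ ρ.toMeasure := ρ.integrable_lipschitz_real hψ.lip
  have hc : Continuous (fun x => fderiv ℝ ψ x (W x)) :=
    hψ.lip'.continuous.clm_apply hW
  have i3 : Integrable (fun x => fderiv ℝ ψ x (W x)) ρ.toMeasure := by
    refine Integrable.of_bound hc.aestronglyMeasurable (ℓ * (B + δ))
      (Eventually.of_forall fun x => ((fderiv ℝ ψ x).le_opNorm _).trans ?_)
    gcongr
    · exact hψ.norm_fderiv_le x
    · exact hWB x
  have i12 : Integrable (fun x => ψ (x + V x) - ψ x) ρ.toMeasure := i1.sub i2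
  rw [← integral_sub i1 i2, ← integral_sub i12 i3]
  have := norm_integral_le_of_norm_le_const (μ := ρ.toMeasure)
    (f := fun x => ψ (x + V x) - ψ x - fderiv ℝ ψ x (W x)) (C := K * B ^ 2 + ℓ * δ)
    (Eventually.of_forall fun x => by
      have h1 := hψ.abs_taylor_le x (V x)
      have h2 := (fderiv ℝ ψ x).le_opNorm (V x - W x)
      have h3 : ‖fderiv ℝ ψ x‖ * ‖V x - W x‖ ≤ ℓ * δ := by
        gcongr
        · exact hψ.norm_fderiv_le x
        · exact hVW x
      have h4 : K * ‖V x‖ ^ 2 ≤ K * B ^ 2 := by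
        gcongr
        exact hVB x
      have e : ψ (x + V x) - ψ x - fderiv ℝ ψ x (W x)
          = (ψ (x + V x) - ψ x - fderiv ℝ ψ x (V x)) + fderiv ℝ ψ x (V x - W x) := by
        rw [map_sub]
        ring
      rw [e]
      refine (norm_add_le _ _).trans ?_
      rw [Real.norm_eq_abs]
      linarith)
  simpa using this

/-- Put `h = t - s`. The map `x ↦ x + U x` is an Euler step for the field frozen at `μ s`, with
time-averaged coefficients and mollified so that the pullback of a test function is again a test
function. The pullback multiplies the weighted norm by at most `(1 + h L)² + h L`, where `δ *
mollConst ≤ 1` absorbs the variation of `DU`. The term with `dist (μ s) (ν s)` is the difference of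
the two frozen fields, the term with `ε` the cost of mollification. Freezing and Taylor errors are
of order `h²`; their factor `δ⁻¹` is harmless because `h → 0` before `ε → 0`. -/
theorem testDist_step (hF : IsRegular F C L) (hμ : IsNormalizedEvolution R F a μ)
    (hν : IsNormalizedEvolution R F a ν) {ε δ : ℝ} (hε : 0 < ε) (hδ : 0 < δ)
    (hδ' : δ * mollConst (E n) ε hε ≤ 1) {s t : ℝ} (hs : s ∈ Icc 0 R) (ht : t ∈ Icc 0 R)
    (hst : s ≤ t) :
    testDist δ (μ t) (ν t) ≤ ((1 + (t - s) * L) ^ 2 + (t - s) * L) * testDist δ (μ s) (ν s)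
      + (t - s) * L * dist (μ s) (ν s) + 2 * (t - s) * L * ε
      + 2 * (δ⁻¹ * (C + L * ε) ^ 2 + (δ⁻¹ * C + 2 * L) * C) * (t - s) ^ 2 := by
  obtain ⟨h, hh⟩ : ∃ h : ℝ≥0, (h : ℝ) = t - s := ⟨⟨t - s, sub_nonneg.2 hst⟩, rfl⟩
  rw [← hh]
  refine ciSup_le fun ⟨ψ, ℓ, K, hψ, hle⟩ => ?_
  have hℓ1 : (ℓ : ℝ) ≤ 1 := by
    have : 0 ≤ δ * K := by positivity
    linarith
  have hK1 : (K : ℝ) ≤ δ⁻¹ := by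
    rw [← one_div, le_div_iff₀ hδ]
    linarith [ℓ.coe_nonneg]
  set b : ι → ℝ := fun i => ∫ σ in s..t, a σ i with hb
  have hbh : ∑ i, |b i| ≤ h := hh ▸ sum_abs_integral_le hμ hs ht hst
  have hVl := lipschitzWith_sum_smul hF (μ s) hbh
  have hWl := lipschitzWith_sum_smul hF (ν s) hbh
  set V : E n → E n := fun x => ∑ i, b i • F (μ s) i x with hV
  set W : E n → E n := fun x => ∑ i, b i • F (ν s) i x with hW
  set U : E n → E n := mollify ε hε V with hU
  have hUl := lipschitzWith_mollify hε hVl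
  have hUV : ∀ x, ‖U x - V x‖ ≤ h * L * ε := fun x => by
    simpa using norm_mollify_sub_le hε hVl x
  have hVW : ∀ x, ‖V x - W x‖ ≤ h * (L * dist (μ s) (ν s)) := fun x => by
    simp only [hV, hW, ← Finset.sum_sub_distrib, ← smul_sub]
    exact norm_sum_smul_le (by positivity) hbh fun i => hF.dist_le _ _ i x
  have hUW : ∀ x, ‖U x - W x‖ ≤ h * L * ε + h * (L * dist (μ s) (ν s)) := fun x =>
    (norm_sub_le_norm_sub_add_norm_sub _ (V x) _).trans (add_le_add (hUV x) (hVW x))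
  have hUB : ∀ x, ‖U x‖ ≤ h * (C + L * ε) := fun x => by
    have h1 : ‖V x‖ ≤ h * C := norm_sum_smul_le C.2 hbh fun i => hF.bound _ i x
    have := norm_le_norm_sub_add (U x) (V x)
    linarith [hUV x]
  have hΦ := hψ.comp (Φ := fun x => x + U x) (P := 1 + h * L)
    (Q := mollConst (E n) ε hε * (h * L)) (contDiff_id.add (contDiff_mollify hε hVl))
    (LipschitzWith.id.add hUl) (by
      have hUd := (contDiff_mollify hε hVl).differentiable (by simp)
      have e : fderiv ℝ (fun x => x + U x)
          = fun x => ContinuousLinearMap.id ℝ (E n) + fderiv ℝ U x := by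
        ext1 x
        exact ((hasFDerivAt_id x).add (hUd x).hasFDerivAt).fderiv
      rw [e]
      have := (LipschitzWith.const (α := E n) (ContinuousLinearMap.id ℝ (E n))).add
        (lipschitzWith_fderiv_mollify hε hVl)
      simpa using this)
    (fun x => by simpa using hUB x)
  have hdist := hΦ.integral_sub_le hδ (q := (1 + h * L) ^ 2 + h * L) (by positivity) (by
    push_cast
    have h1 : (ℓ : ℝ) * (1 + h * L) ≤ ℓ * (1 + h * L) ^ 2 := by
      gcongr
      nlinarith [show (0 : ℝ) ≤ h * L by positivity]
    have h2 : (ℓ : ℝ) * (δ * mollConst (E n) ε hε) * (h * L) ≤ 1 * 1 * (h * L) := by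
      gcongr
    have h3 : ((ℓ : ℝ) + δ * K) * (1 + h * L) ^ 2 ≤ 1 * (1 + h * L) ^ 2 := by
      gcongr
    nlinarith) (μ s) (ν s)
  have m1 := abs_le.1 (hμ.abs_increment_sub_le hF hψ hs ht hst)
  have m2 := abs_le.1 (hν.abs_increment_sub_le hF hψ hs ht hst)
  have m3 := abs_le.1 (hψ.abs_integral_comp_sub_le hUl hVl.continuous hUB hUV (μ s))
  have m4 := abs_le.1 (hψ.abs_integral_comp_sub_le hUl hWl.continuous hUB hUW (ν s))
  rw [← hh] at m1 m2
  have b1 : (K : ℝ) * (h * (C + L * ε)) ^ 2 ≤ δ⁻¹ * (h * (C + L * ε)) ^ 2 := by gcongr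
  have b2 : (K * C + 2 * ℓ * L) * C * (h : ℝ) ^ 2 ≤ (δ⁻¹ * C + 2 * 1 * L) * C * (h : ℝ) ^ 2 := by
    gcongr
  have b3 : (ℓ : ℝ) * (h * L * ε) ≤ 1 * (h * L * ε) := by gcongr
  have b4 : (ℓ : ℝ) * (h * L * ε + h * (L * dist (μ s) (ν s)))
      ≤ 1 * (h * L * ε + h * (L * dist (μ s) (ν s))) := by
    gcongr
  simp only [Function.comp_apply] at hdist
  show ∫ x, ψ x ∂(μ t).toMeasure - ∫ x, ψ x ∂(ν t).toMeasure ≤ _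
  linarith [m1.2, m2.1, m3.1, m4.2]

/-- Normalized evolutions are determined by their initial values. -/
theorem IsNormalizedEvolution.unique (hF : IsRegular F C L) (hμ : IsNormalizedEvolution R F a μ)
    (hν : IsNormalizedEvolution R F a ν) (h0 : μ 0 = ν 0) {t : ℝ} (ht : t ∈ Icc 0 R) :
    μ t = ν t := by
  have key : ∀ ε : ℝ, 0 < ε →
      dist (μ t) (ν t) ≤ 2 * gronwallBound 0 (5 * L) (4 * L * ε) (t - 0) + 2 * ε := by
    intro ε hε
    set c : ℝ := ((mollConst (E n) ε hε : ℝ≥0) : ℝ) with hc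
    have hc0 : 0 ≤ c := NNReal.coe_nonneg _
    set δ : ℝ := (c + 1)⁻¹ with hδd
    have hδ : 0 < δ := by positivity
    have hδ' : δ * mollConst (E n) ε hε ≤ 1 := by
      rw [← hc, hδd, inv_mul_le_iff₀ (by positivity)]
      linarith
    have hD := fun s => dist_le_testDist hε hδ hδ' (μ s) (ν s)
    set A : ℝ := 2 * (δ⁻¹ * (C + L * ε) ^ 2 + (δ⁻¹ * C + 2 * L) * C) with hA
    set D : ℝ → ℝ := fun s => testDist δ (μ s) (ν s) with hDd
    -- To first order `(1 + h L)² + h L` gives `3L`. Replacing `dist` by `2 D + 2ε` adds `2L` to the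
    -- rate and `2Lε` to the error, which already contains `2Lε` from the mollification.
    have gr := le_gronwallBound_of_liminf_deriv_right_le (f := D)
      (f' := fun s => 5 * L * D s + 4 * L * ε) (δ := 0) (K := 5 * L) (ε := 4 * L * ε)
      (a := 0) (b := R) (continuousOn_testDist hδ hμ.continuousOn hν.continuousOn)
      (fun s hs r hr => ?_) (by simp [hDd, h0, testDist_self]) (fun s hs => le_rfl) t ht
    · have := hD t
      simp only [hDd] at gr
      linarith
    · refine Eventually.frequently ?_
      have hlim : Tendsto (fun z : ℝ => 5 * L * D s + 4 * L * ε + (L ^ 2 * D s + A) * (z - s))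
          (𝓝[>] s) (𝓝 (5 * L * D s + 4 * L * ε)) := by
        have : Continuous (fun z : ℝ => 5 * L * D s + 4 * L * ε + (L ^ 2 * D s + A) * (z - s)) := by
          fun_prop
        have h2 := this.tendsto s
        simp only [sub_self, mul_zero, add_zero] at h2
        exact h2.mono_left nhdsWithin_le_nhds
      filter_upwards [hlim.eventually_lt_const hr, Ioo_mem_nhdsGT hs.2] with z hz hzs
      refine lt_of_le_of_lt ?_ hz
      have hz0 : 0 < z - s := sub_pos.2 hzs.1
      rw [inv_mul_le_iff₀ hz0]
      have st := testDist_step hF hμ hν hε hδ hδ' (s := s) (t := z) ⟨hs.1, hs.2.le⟩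
        ⟨hs.1.trans hzs.1.le, hzs.2.le⟩ hzs.1.le
      have hd : (z - s) * L * dist (μ s) (ν s) ≤ (z - s) * L * (2 * D s + 2 * ε) := by
        gcongr
        exact hD s
      simp only [hDd] at hd ⊢
      nlinarith
  -- The weight `δ` depends on `ε` but no longer appears in the bound, so `ε → 0` is allowed.
  refine dist_le_zero.1 (ge_of_tendsto (x := 𝓝[>] (0 : ℝ))
    (f := fun ε => 2 * gronwallBound 0 (5 * L) (4 * L * ε) (t - 0) + 2 * ε) ?_ ?_)
  · have hcont : Continuous (fun ε : ℝ =>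
        2 * gronwallBound 0 (5 * L) (4 * L * ε) (t - 0) + 2 * ε) := by
      have := (gronwallBound_continuous_ε 0 (5 * (L : ℝ)) (t - 0)).comp
        (continuous_const.mul continuous_id : Continuous fun ε : ℝ => 4 * (L : ℝ) * ε)
      exact (continuous_const.mul this).add (continuous_const.mul continuous_id)
    have h2 := hcont.tendsto 0
    simp only [mul_zero, gronwallBound_ε0_δ0, add_zero] at h2
    exact h2.mono_left nhdsWithin_le_nhds
  · filter_upwards [self_mem_nhdsWithin] with ε hε
    exact key ε hε

end Uniqueness

/-! ### Compactness in `𝒫₁` -/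

section Compactness

open scoped BoundedContinuousFunction

/-- In the layer-cake formula the superlevel sets `{t ≤ f}` get thickened by `ε`. Since `f` is
1-Lipschitz, the thickened set lies in `{t ≤ f + ε}`. -/
theorem integral_le_of_levyProkhorov {Ω : Type*} [PseudoMetricSpace Ω] [MeasurableSpace Ω]
    [OpensMeasurableSpace Ω] {μ ν : Measure Ω} [IsProbabilityMeasure μ] [IsProbabilityMeasure ν]
    {ε : ℝ} (hε : 0 < ε) (hμν : levyProkhorovEDist μ ν < ENNReal.ofReal ε) {f : Ω →ᵇ ℝ}
    (hf : LipschitzWith 1 f) (h0 : ∀ x, 0 ≤ f x) :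
    ∫ x, f x ∂μ ≤ ∫ x, f x ∂ν + ε + ε * ‖f‖ := by
  refine (BoundedContinuousFunction.integral_le_of_levyProkhorovEDist_lt μ ν hε hμν f
    (Eventually.of_forall h0)).trans ?_
  gcongr
  set g : Ω →ᵇ ℝ := f + BoundedContinuousFunction.const Ω ε with hg
  have hgx : ∀ x, g x = f x + ε := fun x => rfl
  have e : ∫ x, f x ∂ν + ε = ∫ x, g x ∂ν := by
    simp only [hgx]
    rw [integral_add (f.integrable ν) (integrable_const _)]
    simp
  rw [e, BoundedContinuousFunction.integral_eq_integral_meas_le g ν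
    (Eventually.of_forall fun x => by rw [hgx]; exact add_nonneg (h0 x) hε.le)]
  have hanti : ∀ h : Ω →ᵇ ℝ, Antitone fun t => ν.real {a | t ≤ h a} := fun h s t hst =>
    measureReal_mono fun a (ha : t ≤ h a) => hst.trans ha
  have hint : ∀ (h : Ω →ᵇ ℝ) (b : ℝ), IntegrableOn (fun t => ν.real {a | t ≤ h a}) (Ioc 0 b) :=
    fun h b => ((hanti h).antitoneOn _).integrableOn_isCompact isCompact_Icc |>.mono_set
      Ioc_subset_Icc_self
  have hnorm : ‖f‖ ≤ ‖g‖ := by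
    refine f.norm_le (norm_nonneg _) |>.2 fun x => ?_
    rw [Real.norm_of_nonneg (h0 x)]
    have := (le_abs_self _).trans (g.norm_coe_le_norm x)
    rw [hgx] at this
    linarith
  calc ∫ t in Ioc 0 ‖f‖, ν.real (Metric.thickening ε {a | t ≤ f a})
      ≤ ∫ t in Ioc 0 ‖f‖, ν.real {a | t ≤ g a} := by
        refine integral_mono_of_nonneg (Eventually.of_forall fun t => measureReal_nonneg)
          (hint g _) (Eventually.of_forall fun t => measureReal_mono fun a ha => ?_)
        obtain ⟨b, hb, hab⟩ := Metric.mem_thickening_iff.1 ha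
        have h1 := (abs_le.1 (hf.dist_le_mul a b)).1
        simp only [NNReal.coe_one, one_mul, mem_ofPred_eq] at h1 hb ⊢
        rw [hgx]
        linarith
    _ ≤ ∫ t in Ioc 0 ‖g‖, ν.real {a | t ≤ g a} := by
        refine setIntegral_mono_set (hint g _) (Eventually.of_forall fun t => measureReal_nonneg) ?_
        exact (Ioc_subset_Ioc_right hnorm).eventuallyLE

variable {n : ℕ}

namespace P1

/-- The underlying probability measure. -/
def toProb (μ : P1 n) : ProbabilityMeasure (E n) := ⟨μ.toMeasure, μ.isProb⟩

theorem tail_nonneg (μ : P1 n) (r : ℝ) : 0 ≤ μ.tail r :=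
  integral_nonneg fun _ => le_max_right _ _

/-- Truncating `φ - φ 0` at height `r` and adding `r` gives a 1-Lipschitz function with values in
`[0, 2r]`, to which the Lévy–Prokhorov bound applies. As `|φ x - φ 0| ≤ ‖x‖`, the truncation error
is at most `(‖x‖ - r)₊`, whose integrals are the tails. -/
theorem dist_le_of_levyProkhorov {μ ν : P1 n} {ε r : ℝ} (hε : 0 < ε) (hr : 0 ≤ r)
    (h : levyProkhorovEDist μ.toMeasure ν.toMeasure < ENNReal.ofReal ε) :
    dist μ ν ≤ ε + ε * (2 * r) + (μ.tail r + ν.tail r) := by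
  refine dist_le_of_forall fun φ hφ => ?_
  set g : E n → ℝ := fun x => max (-r) (min (φ x - φ 0) r) + r with hg
  have hgl : LipschitzWith 1 g := by
    have h1 : LipschitzWith 1 (fun x => φ x - φ 0) := by
      simpa using hφ.sub (LipschitzWith.const (α := E n) (φ 0))
    have h2 := ((h1.min_const r).const_max (-r)).add (LipschitzWith.const (α := E n) r)
    rw [add_zero] at h2
    exact h2
  have hg0 : ∀ x, 0 ≤ g x := fun x => by
    have := le_max_left (-r) (min (φ x - φ 0) r)
    simp only [hg]
    linarith
  have hg2 : ∀ x, g x ≤ 2 * r := fun x => by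
    have := max_le (show -r ≤ r by linarith) (min_le_right (φ x - φ 0) r)
    simp only [hg]
    linarith
  have hgφ : ∀ x, |φ x - φ 0 + r - g x| ≤ max (‖x‖ - r) 0 := fun x => by
    have key : ∀ d N : ℝ, |d| ≤ N → |d + r - (max (-r) (min d r) + r)| ≤ max (N - r) 0 := by
      intro d N hd
      have h1 := abs_le.1 hd
      rw [abs_le]
      constructor <;> grind
    exact key _ _ (abs_sub_zero_le hφ x)
  let gb : E n →ᵇ ℝ := BoundedContinuousFunction.ofNormedAddCommGroup g hgl.continuous (2 * r)
    fun x => by rw [Real.norm_of_nonneg (hg0 x)]; exact hg2 x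
  have hgn : ‖gb‖ ≤ 2 * r :=
    BoundedContinuousFunction.norm_ofNormedAddCommGroup_le hgl.continuous (by positivity) _
  have key := integral_le_of_levyProkhorov hε h (f := gb) hgl hg0
  have hgbx : ∀ ρ : P1 n, ∫ x, gb x ∂ρ.toMeasure = ∫ x, g x ∂ρ.toMeasure := fun ρ => rfl
  rw [hgbx, hgbx] at key
  have diff : ∀ ρ : P1 n, |∫ x, φ x ∂ρ.toMeasure - φ 0 + r - ∫ x, g x ∂ρ.toMeasure| ≤ ρ.tail r := by
    intro ρ
    have i1 := ρ.integrable_lipschitz_real hφ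
    have i2 := ρ.integrable_lipschitz_real hgl
    have e : ∫ x, φ x ∂ρ.toMeasure - φ 0 + r - ∫ x, g x ∂ρ.toMeasure
        = ∫ x, (φ x - φ 0 + r - g x) ∂ρ.toMeasure := by
      have i3 : Integrable (fun x => φ x - φ 0) ρ.toMeasure := i1.sub (integrable_const _)
      have i4 : Integrable (fun x => φ x - φ 0 + r) ρ.toMeasure := i3.add (integrable_const _)
      rw [integral_sub i4 i2, integral_add i3 (integrable_const _),
        integral_sub i1 (integrable_const _)]
      simp
    rw [e, ← Real.norm_eq_abs]
    exact norm_integral_le_of_norm_le (ρ.integrable_lipschitz_real (lipschitzWith_tail r))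
      (Eventually.of_forall hgφ)
  have d1 := abs_le.1 (diff μ)
  have d2 := abs_le.1 (diff ν)
  have : ε * ‖gb‖ ≤ ε * (2 * r) := by gcongr
  linarith [d1.2, d2.1]

theorem isTightMeasureSet_of_tail_le {A : Set (P1 n)} {ω : ℝ → ℝ} (hω : Tendsto ω atTop (𝓝 0))
    (h : ∀ μ ∈ A, ∀ r, 0 < r → μ.tail r ≤ ω r) :
    IsTightMeasureSet (P1.toMeasure '' A) := by
  refine isTightMeasureSet_of_tendsto_measure_norm_gt ?_
  have h1 : Tendsto (fun r : ℝ => ENNReal.ofReal (ω (r / 2))) atTop (𝓝 0) := by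
    have := (ENNReal.tendsto_ofReal hω).comp (tendsto_id.atTop_div_const (two_pos (α := ℝ)))
    simpa using! this
  refine tendsto_of_tendsto_of_tendsto_of_le_of_le' tendsto_const_nhds h1
    (Eventually.of_forall fun _ => zero_le) ?_
  -- For `r ≥ 2` the condition `‖x‖ > r` forces `‖x‖ - r / 2 ≥ 1`, so Markov's inequality at height
  -- 1 bounds the mass there by the tail at `r / 2`.
  filter_upwards [eventually_ge_atTop 2] with r hr
  refine iSup₂_le ?_
  rintro _ ⟨μ, hμ, rfl⟩
  have mk := mul_meas_ge_le_integral_of_nonneg (μ := μ.toMeasure)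
    (f := fun x => max (‖x‖ - r / 2) 0) (Eventually.of_forall fun _ => le_max_right _ _)
    (μ.integrable_lipschitz_real (lipschitzWith_tail (r / 2))) 1
  have hsub : {x : E n | r < ‖x‖} ⊆ {x | 1 ≤ max (‖x‖ - r / 2) 0} := by
    intro x hx
    have hx' : r < ‖x‖ := hx
    show (1 : ℝ) ≤ max (‖x‖ - r / 2) 0
    exact le_max_of_le_left (by linarith)
  have h2 : μ.toMeasure.real {x : E n | r < ‖x‖} ≤ ω (r / 2) := by
    rw [one_mul] at mk
    exact (measureReal_mono hsub).trans (mk.trans (h μ hμ _ (by linarith)))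
  rw [← ENNReal.ofReal_toReal (measure_ne_top μ.toMeasure {x : E n | r < ‖x‖})]
  exact ENNReal.ofReal_le_ofReal h2

/-- Families with uniformly small tails are relatively compact in `𝒫₁`. -/
theorem exists_tendsto_of_tail_le {κ : Type*} (U : Ultrafilter κ) (μk : κ → P1 n) {ω : ℝ → ℝ}
    (hω : Tendsto ω atTop (𝓝 0)) (h : ∀ k, ∀ r, 0 < r → (μk k).tail r ≤ ω r) :
    ∃ μ : P1 n, Tendsto μk U (𝓝 μ) := by
  have htight := isTightMeasureSet_of_tail_le (A := range μk) hω
    (by rintro _ ⟨k, rfl⟩ r hr; exact h k r hr)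
  have hcomp : IsCompact (closure (range fun k => (μk k).toProb)) := by
    refine isCompact_closure_of_isTightMeasureSet (htight.subset ?_)
    rintro _ ⟨_, ⟨k, rfl⟩, rfl⟩
    exact ⟨_, ⟨k, rfl⟩, rfl⟩
  obtain ⟨m, -, hm⟩ := hcomp.ultrafilter_le_nhds (U.map fun k => (μk k).toProb) (by
    refine le_principal_iff.2 ?_
    exact Filter.mem_map.2 (Eventually.of_forall fun k => subset_closure ⟨k, rfl⟩))
  have hm' : Tendsto (fun k => (μk k).toProb) U (𝓝 m) := hm
  -- Weak convergence only tests bounded functions; the tail bounds reach the limit through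
  -- truncation at height `N` and Fatou's lemma. They also give the limit a finite first moment.
  have hbound : ∀ r, 0 < r → ∫⁻ x, ENNReal.ofReal (max (‖x‖ - r) 0) ∂(m : Measure (E n))
      ≤ ENNReal.ofReal (ω r) := by
    intro r hr
    have hlim : ∀ x : E n, ENNReal.ofReal (max (‖x‖ - r) 0)
        = liminf (fun N : ℕ => ENNReal.ofReal (min (max (‖x‖ - r) 0) N)) atTop := fun x => by
      refine (Tendsto.liminf_eq (tendsto_const_nhds.congr' ?_)).symm
      obtain ⟨N, hN⟩ := exists_nat_ge (max (‖x‖ - r) 0)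
      filter_upwards [eventually_ge_atTop N] with k hk
      rw [min_eq_left (hN.trans (by exact_mod_cast hk))]
    have hcont : ∀ N : ℕ, Continuous fun x : E n => min (max (‖x‖ - r) 0) (N : ℝ) := fun N => by
      fun_prop
    simp_rw [hlim]
    refine (lintegral_liminf_le fun N => (hcont N).measurable.ennreal_ofReal).trans ?_
    refine liminf_le_of_le (by isBoundedDefault) fun b hb => ?_
    obtain ⟨N, hN⟩ := hb.exists
    refine hN.trans ?_
    have hb0 : ∀ x : E n, 0 ≤ min (max (‖x‖ - r) 0) (N : ℝ) := fun x =>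
      le_min (le_max_right _ _) (Nat.cast_nonneg _)
    let gb : E n →ᵇ ℝ := BoundedContinuousFunction.ofNormedAddCommGroup _ (hcont N) N
      fun x => by rw [Real.norm_of_nonneg (hb0 x)]; exact min_le_right _ _
    have ht := (ProbabilityMeasure.tendsto_iff_forall_integral_tendsto.1 hm') gb
    change ∫⁻ x, ENNReal.ofReal (gb x) ∂(m : Measure (E n)) ≤ _
    rw [← ofReal_integral_eq_lintegral_ofReal (gb.integrable (m : Measure (E n)))
      (Eventually.of_forall hb0)]
    refine ENNReal.ofReal_le_ofReal (le_of_tendsto ht (Eventually.of_forall fun k => ?_))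
    refine le_trans ?_ (h k r hr)
    exact integral_mono (gb.integrable (μk k).toMeasure)
      ((μk k).integrable_lipschitz_real (lipschitzWith_tail r)) fun x => min_le_left _ _
  have htm : ∀ r : ℝ, AEStronglyMeasurable (fun x : E n => max (‖x‖ - r) 0) (m : Measure (E n)) :=
    fun r => (lipschitzWith_tail r).continuous.aestronglyMeasurable
  have hint : ∀ r, 0 < r → Integrable (fun x : E n => max (‖x‖ - r) 0) (m : Measure (E n)) := by
    intro r hr
    refine (lintegral_ofReal_ne_top_iff_integrable (htm r)
      (Eventually.of_forall fun _ => le_max_right _ _)).1 ?_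
    exact ((hbound r hr).trans_lt ENNReal.ofReal_lt_top).ne
  let μ : P1 n := ⟨m, inferInstance, by
    refine ((hint 1 one_pos).add (integrable_const (1 : ℝ))).mono'
      continuous_norm.aestronglyMeasurable (Eventually.of_forall fun x => ?_)
    have := le_max_left (‖x‖ - 1) 0
    simp only [Pi.add_apply, norm_norm]
    linarith⟩
  have hμt : ∀ r, 0 < r → μ.tail r ≤ ω r := by
    intro r hr
    have h0 : 0 ≤ ω r := by
      obtain ⟨k⟩ := U.nonempty_of_mem univ_mem
      exact (tail_nonneg _ _).trans (h k r hr)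
    have := hbound r hr
    rw [← ofReal_integral_eq_lintegral_ofReal (hint r hr)
      (Eventually.of_forall fun _ => le_max_right _ _)] at this
    exact (ENNReal.ofReal_le_ofReal_iff h0).1 this
  refine ⟨μ, Metric.tendsto_nhds.2 fun η hη => ?_⟩
  -- The radius is fixed by the tails first; then `ε` is chosen with `ε (1 + 2r) = η / 4`.
  obtain ⟨r, hrω, hr⟩ := ((hω.eventually_lt_const (show (0 : ℝ) < η / 4 by positivity)).and
    (eventually_gt_atTop 0)).exists
  obtain ⟨ε, hε, hεη⟩ : ∃ ε : ℝ, 0 < ε ∧ ε + ε * (2 * r) < η / 2 := by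
    refine ⟨η / 4 / (1 + 2 * r), by positivity, ?_⟩
    have : η / 4 / (1 + 2 * r) + η / 4 / (1 + 2 * r) * (2 * r) = η / 4 := by
      field_simp
    linarith
  have hLP := (LevyProkhorov.continuous_ofMeasure_probabilityMeasure.tendsto m).comp hm'
  have := EMetric.tendsto_nhds.1 hLP (ENNReal.ofReal ε) (ENNReal.ofReal_pos.2 hε)
  filter_upwards [this] with k hk
  have hd := dist_le_of_levyProkhorov (μ := μk k) (ν := μ) hε hr.le hk
  linarith [h k r hr, hμt r hr]

end P1

end Compactness

/-! ### Compactness of curves -/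

/-- Arzelà–Ascoli along an ultrafilter, for curves in `𝒫₁`. -/
theorem exists_tendsto_curve {n : ℕ} {κ : Type*} (U : Ultrafilter κ) {S : ℝ}
    (νk : κ → C(Icc (0 : ℝ) S, P1 n)) {C : ℝ≥0} (hC : ∀ k, LipschitzWith C (νk k))
    {ω : ℝ → ℝ} (hω : Tendsto ω atTop (𝓝 0)) (h : ∀ k s r, 0 < r → (νk k s).tail r ≤ ω r) :
    ∃ ν : C(Icc (0 : ℝ) S, P1 n), Tendsto νk U (𝓝 ν) := by
  choose g hg using fun s => P1.exists_tendsto_of_tail_le U (fun k => νk k s) hω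
    fun k r hr => h k s r hr
  have hgl : LipschitzWith C g := LipschitzWith.of_dist_le_mul fun s t =>
    le_of_tendsto ((hg s).dist (hg t)) (Eventually.of_forall fun k => (hC k).dist_le_mul s t)
  refine ⟨⟨g, hgl.continuous⟩, ?_⟩
  rw [ContinuousMap.tendsto_iff_tendstoUniformly]
  -- On the compact interval, equicontinuity upgrades pointwise to uniform convergence.
  have he : Equicontinuous fun k => (νk k : Icc (0 : ℝ) S → P1 n) :=
    (LipschitzWith.uniformEquicontinuous _ C hC).equicontinuous
  exact UniformFun.tendsto_iff_tendstoUniformly.1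
    ((he.tendsto_uniformFun_iff_pi U g).2 (tendsto_pi_nhds.2 hg))

/-! ### Weak-* compactness -/

section WeakStar

variable {X κ : Type*} [MeasurableSpace X] {m : Measure X}

/-- Truncating `p` at height `N` gives a bounded function `q N`; since `|a k| ≤ 1`, the error is at
most `‖p - q N‖₁`, uniformly in `k`. -/
theorem tendsto_integral_mul_of_memLp_two [IsFiniteMeasure m] {l : Filter κ} {a : κ → X → ℝ}
    {b : X → ℝ} (ha : ∀ k, AEStronglyMeasurable (a k) m) (ha1 : ∀ k, ∀ᵐ x ∂m, |a k x| ≤ 1)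
    (hb : AEStronglyMeasurable b m) (hb1 : ∀ᵐ x ∂m, |b x| ≤ 1)
    (h : ∀ p : X → ℝ, MemLp p 2 m → Tendsto (fun k => ∫ x, a k x * p x ∂m) l (𝓝 (∫ x, b x * p x ∂m)))
    {p : X → ℝ} (hp : Integrable p m) :
    Tendsto (fun k => ∫ x, a k x * p x ∂m) l (𝓝 (∫ x, b x * p x ∂m)) := by
  wlog hpm : StronglyMeasurable p generalizing p
  · obtain ⟨q, hq, hpq⟩ := hp.aestronglyMeasurable
    have e : ∀ c : X → ℝ, ∫ x, c x * p x ∂m = ∫ x, c x * q x ∂m := fun c =>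
      integral_congr_ae (by filter_upwards [hpq] with x hx; rw [hx])
    simp only [e]
    exact this (hp.congr hpq) hq
  set q : ℕ → X → ℝ := fun N => {x | |p x| ≤ N}.indicator p with hq
  have hms : ∀ N : ℕ, MeasurableSet {x | |p x| ≤ N} := fun N =>
    measurableSet_le hpm.measurable.abs measurable_const
  have hqi : ∀ N, Integrable (q N) m := fun N => hp.indicator (hms N)
  have hq2 : ∀ N, MemLp (q N) 2 m := fun N => by
    refine MemLp.of_bound (hqi N).aestronglyMeasurable N (Eventually.of_forall fun x => ?_)
    by_cases hx : |p x| ≤ N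
    · rw [hq]
      simp only
      rw [indicator_of_mem (by exact hx)]
      exact hx
    · rw [hq]
      simp only
      rw [indicator_of_notMem (by exact hx)]
      simp
  have hlim : Tendsto (fun N => ∫ x, |p x - q N x| ∂m) atTop (𝓝 0) := by
    have := tendsto_integral_of_dominated_convergence (μ := m) (F := fun N x => |p x - q N x|)
      (f := fun _ => 0) (fun x => |p x|) (fun N => (hp.sub (hqi N)).abs.aestronglyMeasurable)
      hp.abs (fun N => Eventually.of_forall fun x => by
        by_cases hx : |p x| ≤ N
        · simp [hq, hx]
        · simp [hq, hx]) (Eventually.of_forall fun x => by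
        refine tendsto_const_nhds.congr' ?_
        obtain ⟨N, hN⟩ := exists_nat_ge |p x|
        filter_upwards [eventually_ge_atTop N] with k hk
        have hx : |p x| ≤ k := hN.trans (by exact_mod_cast hk)
        simp [hq, hx])
    simpa using this
  have approx : ∀ c : X → ℝ, AEStronglyMeasurable c m → (∀ᵐ x ∂m, |c x| ≤ 1) → ∀ N,
      |∫ x, c x * p x ∂m - ∫ x, c x * q N x ∂m| ≤ ∫ x, |p x - q N x| ∂m := by
    intro c hc hc1 N
    have hc1' : ∀ᵐ x ∂m, ‖c x‖ ≤ 1 := hc1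
    rw [← integral_sub (hp.bdd_mul hc hc1') ((hqi N).bdd_mul hc hc1')]
    rw [← Real.norm_eq_abs]
    refine norm_integral_le_of_norm_le (hp.sub (hqi N)).abs ?_
    filter_upwards [hc1] with x hx
    rw [← mul_sub, norm_mul]
    exact mul_le_of_le_one_left (norm_nonneg _) hx
  rw [Metric.tendsto_nhds]
  intro ε hε
  obtain ⟨N, hN⟩ := (hlim.eventually_lt_const (show (0 : ℝ) < ε / 3 by positivity)).exists
  filter_upwards [Metric.tendsto_nhds.1 (h (q N) (hq2 N)) (ε / 3) (by positivity)] with k hk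
  rw [Real.dist_eq] at hk ⊢
  have h1 := abs_lt.1 hk
  have h2 := abs_le.1 (approx (a k) (ha k) (ha1 k) N)
  have h3 := abs_le.1 (approx b hb hb1 N)
  rw [abs_lt]
  constructor <;> linarith [h1.1, h1.2, h2.1, h2.2, h3.1, h3.2]

/-- Weak-* compactness of the unit ball of `L∞` on a finite measure space, along an
ultrafilter. -/
theorem exists_tendsto_integral_mul [IsFiniteMeasure m] (U : Ultrafilter κ) {a : κ → X → ℝ}
    (ha : ∀ k, AEStronglyMeasurable (a k) m) (ha1 : ∀ k, ∀ᵐ x ∂m, |a k x| ≤ 1) :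
    ∃ b : X → ℝ, AEStronglyMeasurable b m ∧ (∀ᵐ x ∂m, |b x| ≤ 1) ∧
      ∀ p : X → ℝ, Integrable p m →
        Tendsto (fun k => ∫ x, a k x * p x ∂m) U (𝓝 (∫ x, b x * p x ∂m)) := by
  -- On a finite measure space the unit ball of `L∞` is bounded in `L²`, where the Riesz isomorphism
  -- and Banach–Alaoglu supply a weak limit.
  have haL : ∀ k, MemLp (a k) 2 m := fun k => MemLp.of_bound (ha k) 1 (ha1 k)
  set r : ℝ := (measureUnivNNReal m : ℝ) ^ (2 : ℝ≥0∞).toReal⁻¹ * 1 with hr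
  have hnorm : ∀ k, ‖(haL k).toLp‖ ≤ r := fun k => by
    refine Lp.norm_le_of_ae_bound zero_le_one ?_
    filter_upwards [(haL k).coeFn_toLp, ha1 k] with x hx hx1
    rwa [hx]
  set Λ : κ → WeakDual ℝ (Lp ℝ 2 m) := fun k =>
    StrongDual.toWeakDual (InnerProductSpace.toDual ℝ _ (haL k).toLp) with hΛ
  obtain ⟨Φ, -, hΦ⟩ := (WeakDual.isCompact_closedBall (𝕜 := ℝ)
    (0 : StrongDual ℝ (Lp ℝ 2 m)) r).ultrafilter_le_nhds (U.map Λ) (by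
      refine le_principal_iff.2 (Filter.mem_map.2 (Eventually.of_forall fun k => ?_))
      simp only [hΛ, mem_preimage, mem_closedBall_zero_iff]
      exact (LinearIsometryEquiv.norm_map (InnerProductSpace.toDual ℝ (Lp ℝ 2 m)) _).trans_le
        (hnorm k))
  have hΦ' : Tendsto Λ U (𝓝 Φ) := hΦ
  set b : Lp ℝ 2 m := (InnerProductSpace.toDual ℝ _).symm (WeakDual.toStrongDual Φ) with hb
  have h2 : ∀ p : X → ℝ, MemLp p 2 m →
      Tendsto (fun k => ∫ x, a k x * p x ∂m) U (𝓝 (∫ x, b x * p x ∂m)) := by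
    intro p hp
    have ht := ((WeakDual.eval_continuous (𝕜 := ℝ) hp.toLp).tendsto Φ).comp hΦ'
    have e1 : ∀ k, Λ k hp.toLp = ∫ x, a k x * p x ∂m := fun k => by
      have : Λ k hp.toLp = inner ℝ (haL k).toLp hp.toLp := rfl
      rw [this, L2.inner_def]
      refine integral_congr_ae ?_
      filter_upwards [(haL k).coeFn_toLp, hp.coeFn_toLp] with x h1 h2
      rw [h1, h2]
      simp [mul_comm]
    have e2 : Φ hp.toLp = ∫ x, b x * p x ∂m := by
      have : Φ hp.toLp = inner ℝ b hp.toLp := by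
        rw [hb, InnerProductSpace.toDual_symm_apply]
        rfl
      rw [this, L2.inner_def]
      refine integral_congr_ae ?_
      filter_upwards [hp.coeFn_toLp] with x h2
      rw [h2]
      simp [mul_comm]
    simpa only [Function.comp_def, e1, e2] using ht
  have hbi : Integrable b m := (Lp.memLp b).integrable (by norm_num)
  -- The `L²` limit is not bounded by 1 a priori; the bound is recovered from its integrals over
  -- measurable sets.
  have hset : ∀ s, MeasurableSet s → |∫ x in s, b x ∂m| ≤ m.real s := by
    intro s hs
    have hp : MemLp (s.indicator fun _ => (1 : ℝ)) 2 m :=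
      memLp_indicator_const 2 hs 1 (Or.inr (measure_ne_top m s))
    have e : ∀ c : X → ℝ, ∫ x, c x * s.indicator (fun _ => (1 : ℝ)) x ∂m = ∫ x in s, c x ∂m := by
      intro c
      rw [← integral_indicator hs]
      congr 1
      ext x
      by_cases hx : x ∈ s <;> simp [hx]
    have ht := (h2 _ hp).abs
    simp only [e] at ht
    refine le_of_tendsto ht (Eventually.of_forall fun k => ?_)
    have := norm_setIntegral_le_of_norm_le_const_ae' (μ := m) (s := s) (f := a k) (C := 1)
      (measure_lt_top m s) (by filter_upwards [ha1 k] with x hx _ using hx)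
    simpa using this
  have hb1 : ∀ᵐ x ∂m, |b x| ≤ 1 := by
    have h1 : (b : X → ℝ) ≤ᵐ[m] fun _ => 1 :=
      ae_le_of_forall_setIntegral_le hbi (integrable_const _) fun s hs _ => by
        have := (abs_le.1 (hset s hs)).2
        simpa using this
    have h2 : (fun _ => -1) ≤ᵐ[m] (b : X → ℝ) :=
      ae_le_of_forall_setIntegral_le (integrable_const _) hbi fun s hs _ => by
        have := (abs_le.1 (hset s hs)).1
        simpa using this
    filter_upwards [h1, h2] with x h3 h4 using abs_le.2 ⟨h4, h3⟩
  exact ⟨b, Lp.aestronglyMeasurable b, hb1, fun p hp =>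
    tendsto_integral_mul_of_memLp_two ha ha1 (Lp.aestronglyMeasurable b) hb1 h2 hp⟩

end WeakStar

/-! ### Weak-* convergence of reduced controls -/

namespace WeakLinf

variable {S : ℝ} {m : ℕ}

theorem aestronglyMeasurable_α (c : WeakLinf S m) :
    AEStronglyMeasurable c.α (volume.restrict (Icc 0 S)) :=
  (Lp.aestronglyMeasurable (show Lp (ℝ × E m) ∞ (volume.restrict (Icc (0 : ℝ) S)) from c)).fst

theorem aestronglyMeasurable_β' (c : WeakLinf S m) :
    AEStronglyMeasurable c.β (volume.restrict (Icc 0 S)) :=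
  (Lp.aestronglyMeasurable (show Lp (ℝ × E m) ∞ (volume.restrict (Icc (0 : ℝ) S)) from c)).snd

theorem aestronglyMeasurable_β (c : WeakLinf S m) (i : Fin m) :
    AEStronglyMeasurable (fun s => c.β s i) (volume.restrict (Icc 0 S)) :=
  (PiLp.continuous_apply 1 (fun _ : Fin m => ℝ) i).comp_aestronglyMeasurable
    c.aestronglyMeasurable_β'

theorem tendsto_iff {κ : Type*} {l : Filter κ} {ck : κ → WeakLinf S m} {c : WeakLinf S m} :
    Tendsto ck l (𝓝 c) ↔ ∀ h, Tendsto (fun k => (ck k).pairing h) l (𝓝 (c.pairing h)) := by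
  rw [(Topology.IsInducing.mk rfl : Topology.IsInducing
    (fun c : WeakLinf S m => c.pairing)).tendsto_nhds_iff, tendsto_pi_nhds]
  rfl

theorem norm_rep_le (c : WeakLinf S m) :
    ∃ B : ℝ, ∀ᵐ s ∂volume.restrict (Icc 0 S), ‖c.rep s‖ ≤ B := by
  have h := (Lp.memLp (show Lp (ℝ × E m) ∞ (volume.restrict (Icc (0 : ℝ) S)) from c)).2
  rw [eLpNorm_exponent_top] at h
  refine ⟨(eLpNormEssSup c.rep (volume.restrict (Icc 0 S))).toReal, ?_⟩
  filter_upwards [enorm_ae_le_eLpNormEssSup c.rep (volume.restrict (Icc (0 : ℝ) S))] with s hs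
  have := ENNReal.toReal_mono h.ne hs
  rwa [toReal_enorm] at this

theorem abs_β_le (c : WeakLinf S m) (s : ℝ) (i : Fin m) : |c.β s i| ≤ ‖c.rep s‖ :=
  (PiLp.norm_apply_le (c.rep s).2 i).trans (norm_snd_le _)

theorem integrable_α (c : WeakLinf S m) : Integrable c.α (volume.restrict (Icc 0 S)) := by
  obtain ⟨B, hB⟩ := c.norm_rep_le
  exact Integrable.of_bound c.aestronglyMeasurable_α B
    (hB.mono fun s hs => (norm_fst_le _).trans hs)

theorem integrable_β' (c : WeakLinf S m) : Integrable c.β (volume.restrict (Icc 0 S)) := by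
  obtain ⟨B, hB⟩ := c.norm_rep_le
  exact Integrable.of_bound c.aestronglyMeasurable_β' B
    (hB.mono fun s hs => (norm_snd_le _).trans hs)

theorem integrable_β (c : WeakLinf S m) (i : Fin m) :
    Integrable (fun s => c.β s i) (volume.restrict (Icc 0 S)) := by
  obtain ⟨B, hB⟩ := c.norm_rep_le
  exact Integrable.of_bound (c.aestronglyMeasurable_β i) B
    (hB.mono fun s hs => (c.abs_β_le s i).trans hs)

variable {κ : Type*} {l : Filter κ} {ck : κ → WeakLinf S m} {c : WeakLinf S m} {p : ℝ → ℝ}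

theorem tendsto_integral_α (h : Tendsto ck l (𝓝 c))
    (hp : Integrable p (volume.restrict (Icc 0 S))) :
    Tendsto (fun k => ∫ s in Icc 0 S, (ck k).α s * p s) l (𝓝 (∫ s in Icc 0 S, c.α s * p s)) := by
  have hi : Integrable (fun s => (p s, (0 : E m))) (volume.restrict (Icc 0 S)) :=
    hp.prodMk (integrable_zero _ _ _)
  have e : ∀ c : WeakLinf S m, c.pairing hi.toL1 = ∫ s in Icc 0 S, c.α s * p s := fun c => by
    refine integral_congr_ae ?_
    filter_upwards [hi.coeFn_toL1] with s hs
    rw [hs]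
    simp
  simpa only [e] using tendsto_iff.1 h hi.toL1

theorem tendsto_integral_β (h : Tendsto ck l (𝓝 c)) (i : Fin m)
    (hp : Integrable p (volume.restrict (Icc 0 S))) :
    Tendsto (fun k => ∫ s in Icc 0 S, (ck k).β s i * p s) l
      (𝓝 (∫ s in Icc 0 S, c.β s i * p s)) := by
  have hi : Integrable (fun s => ((0 : ℝ), p s • (WithLp.toLp 1 (Pi.single i 1) : E m)))
      (volume.restrict (Icc 0 S)) :=
    (integrable_zero _ _ _).prodMk (hp.smul_const _)
  have e : ∀ c : WeakLinf S m, c.pairing hi.toL1 = ∫ s in Icc 0 S, c.β s i * p s := fun c => by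
    refine integral_congr_ae ?_
    filter_upwards [hi.coeFn_toL1] with s hs
    rw [hs]
    simp
  simpa only [e] using tendsto_iff.1 h hi.toL1

theorem exists_tendsto (U : Ultrafilter κ)
    (hα : ∀ k, ∀ᵐ s ∂volume.restrict (Icc 0 S), |(ck k).α s| ≤ 1)
    (hβ : ∀ k i, ∀ᵐ s ∂volume.restrict (Icc 0 S), |(ck k).β s i| ≤ 1) :
    ∃ c, Tendsto ck U (𝓝 c) := by
  obtain ⟨a, ham, ha1, ha⟩ := exists_tendsto_integral_mul U
    (fun k => (ck k).aestronglyMeasurable_α) hα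
  choose b hbm hb1 hb using fun i => exists_tendsto_integral_mul U
    (fun k => (ck k).aestronglyMeasurable_β i) (fun k => hβ k i)
  have hbm' : AEStronglyMeasurable (fun s => (WithLp.toLp 1 (fun i => b i s) : E m))
      (volume.restrict (Icc 0 S)) :=
    (PiLp.continuous_toLp 1 (fun _ : Fin m => ℝ)).comp_aestronglyMeasurable
      (aemeasurable_pi_lambda _ fun i => (hbm i).aemeasurable).aestronglyMeasurable
  have hmem : MemLp (fun s => (a s, (WithLp.toLp 1 (fun i => b i s) : E m))) ∞
      (volume.restrict (Icc 0 S)) := by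
    refine memLp_top_of_bound (ham.prodMk hbm') (max 1 m) ?_
    filter_upwards [ha1, eventually_all.2 hb1] with s h1 h2
    refine max_le (h1.trans (le_max_left _ _)) (le_max_of_le_right ?_)
    rw [PiLp.norm_eq_of_nat 1 (by simp)]
    simp only [pow_one, Nat.cast_one, one_div, inv_one, Real.rpow_one]
    exact (Finset.sum_le_sum fun i _ => h2 i).trans (by simp)
  refine ⟨hmem.toLp, tendsto_iff.2 fun h => ?_⟩
  have h1 : Integrable (fun s => (h s).1) (volume.restrict (Icc 0 S)) :=
    (L1.integrable_coeFn h).fst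
  have h2 : ∀ i, Integrable (fun s => (h s).2 i) (volume.restrict (Icc 0 S)) := fun i =>
    (PiLp.proj (𝕜 := ℝ) 1 (fun _ : Fin m => ℝ) i).integrable_comp (L1.integrable_coeFn h).snd
  have key : ∀ (a' : ℝ → ℝ) (b' : Fin m → ℝ → ℝ),
      AEStronglyMeasurable a' (volume.restrict (Icc 0 S)) →
      (∀ᵐ s ∂volume.restrict (Icc 0 S), |a' s| ≤ 1) →
      (∀ i, AEStronglyMeasurable (b' i) (volume.restrict (Icc 0 S))) →
      (∀ i, ∀ᵐ s ∂volume.restrict (Icc 0 S), |b' i s| ≤ 1) →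
      ∫ s in Icc 0 S, (a' s * (h s).1 + ∑ i, b' i s * (h s).2 i)
        = (∫ s in Icc 0 S, a' s * (h s).1) + ∑ i, ∫ s in Icc 0 S, b' i s * (h s).2 i := by
    intro a' b' m1 l1 m2 l2
    have i2 : ∀ i ∈ Finset.univ, Integrable (fun s => b' i s * (h s).2 i)
      (volume.restrict (Icc 0 S)) := fun i _ => (h2 i).bdd_mul (m2 i) (l2 i)
    rw [integral_add (h1.bdd_mul m1 l1) (integrable_finsetSum _ i2), integral_finsetSum _ i2]
  have hlim : WeakLinf.pairing (S := S) (m := m) hmem.toLp h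
      = (∫ s in Icc 0 S, a s * (h s).1) + ∑ i, ∫ s in Icc 0 S, b i s * (h s).2 i := by
    rw [← key a b ham ha1 hbm hb1]
    refine integral_congr_ae ?_
    filter_upwards [hmem.coeFn_toLp] with s hs
    have : rep (S := S) (m := m) hmem.toLp s = (a s, WithLp.toLp 1 fun i => b i s) := hs
    simp only [α, β, this]
  rw [hlim]
  have hk : ∀ k, (ck k).pairing h = (∫ s in Icc 0 S, (ck k).α s * (h s).1)
      + ∑ i, ∫ s in Icc 0 S, (ck k).β s i * (h s).2 i := fun k =>
    key _ (fun i s => (ck k).β s i) (ck k).aestronglyMeasurable_α (hα k)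
      (ck k).aestronglyMeasurable_β (hβ k)
  simp only [hk]
  exact (ha _ h1).add (tendsto_finsetSum _ fun i _ => hb i _ (h2 i))

end WeakLinf

/-! ### The vector fields of the control system -/

section Convolution

variable {n : ℕ} {g : E n → E n} {C L : ℝ≥0}

theorem integrable_comp_sub (hL : LipschitzWith L g) (μ : P1 n) (x : E n) :
    Integrable (fun y => g (x - y)) μ.toMeasure := by
  have h : LipschitzWith L (fun y => g (x - y)) := LipschitzWith.of_dist_le_mul fun y z =>
    (hL.dist_le_mul _ _).trans (by rw [dist_sub_left])
  exact μ.integrable_lipschitz h h.continuous.aestronglyMeasurable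

theorem norm_conv_le (hC : ∀ x, ‖g x‖ ≤ C) (μ : P1 n) (x : E n) : ‖conv g μ x‖ ≤ C := by
  have := norm_integral_le_of_norm_le_const (μ := μ.toMeasure) (f := fun y => g (x - y))
    (Eventually.of_forall fun y => hC (x - y))
  simpa [conv] using this

theorem lipschitzWith_conv (hL : LipschitzWith L g) (μ : P1 n) : LipschitzWith L (conv g μ) := by
  refine LipschitzWith.of_dist_le_mul fun x y => ?_
  rw [dist_eq_norm, conv, conv, ← integral_sub (integrable_comp_sub hL μ x)
    (integrable_comp_sub hL μ y)]
  have := norm_integral_le_of_norm_le_const (μ := μ.toMeasure)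
    (f := fun z => g (x - z) - g (y - z)) (C := L * dist x y) (Eventually.of_forall fun z => by
      have := hL.dist_le_mul (x - z) (y - z)
      rwa [dist_eq_norm, dist_sub_right] at this)
  simpa using this

/-- A norming functional `e` reduces the estimate to the scalar `L`-Lipschitz function `y ↦ e (g (x
- y))`, to which Kantorovich duality applies. -/
theorem norm_conv_sub_le (hL : LipschitzWith L g) (μ ν : P1 n) (x : E n) :
    ‖conv g μ x - conv g ν x‖ ≤ L * dist μ ν := by
  obtain ⟨e, he, hex⟩ := exists_dual_vector'' ℝ (conv g μ x - conv g ν x)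
  have hl : LipschitzWith L (fun y => e (g (x - y))) := by
    refine LipschitzWith.of_dist_le_mul fun y z => ?_
    rw [dist_eq_norm, ← map_sub]
    refine ((e.le_opNorm _).trans (mul_le_of_le_one_left (norm_nonneg _) he)).trans ?_
    have := hL.dist_le_mul (x - y) (x - z)
    rwa [dist_eq_norm, dist_sub_left] at this
  have h := P1.integral_sub_le_dist μ ν hl
  rw [e.integral_comp_comm (integrable_comp_sub hL μ x),
    e.integral_comp_comm (integrable_comp_sub hL ν x), ← map_sub] at h
  have hex' : e (conv g μ x - conv g ν x) = ‖conv g μ x - conv g ν x‖ := hex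
  rwa [← hex']

end Convolution

namespace Data

variable {n m : ℕ} (D : Data n m)

/-- The vector fields that the controls multiply: `f₀ + g * μ` and `f₁, …, f_m`. -/
def vectorFields (μ : P1 n) : Option (Fin m) → E n → E n
  | none => fun x => D.f₀ x + conv D.g μ x
  | some i => D.f i

theorem exists_isRegular {D : Data n m} (hD : D.BoundedLipschitz) :
    ∃ C L : ℝ≥0, IsRegular D.vectorFields C L := by
  obtain ⟨C, L, hC, hL, hb, hl⟩ := hD
  lift C to ℝ≥0 using hC.le
  lift L to ℝ≥0 using hL.le
  have hsum : ∀ x, 0 ≤ ∑ i, ‖D.f i x‖ := fun x => Finset.sum_nonneg fun _ _ => norm_nonneg _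
  have hsum' : ∀ x y, 0 ≤ ∑ i, ‖D.f i x - D.f i y‖ :=
    fun x y => Finset.sum_nonneg fun _ _ => norm_nonneg _
  have hle : ∀ x i, ‖D.f i x‖ ≤ ∑ i, ‖D.f i x‖ := fun x i =>
    Finset.single_le_sum (f := fun i => ‖D.f i x‖) (fun _ _ => norm_nonneg _) (Finset.mem_univ i)
  have hle' : ∀ x y i, ‖D.f i x - D.f i y‖ ≤ ∑ i, ‖D.f i x - D.f i y‖ := fun x y i =>
    Finset.single_le_sum (f := fun i => ‖D.f i x - D.f i y‖) (fun _ _ => norm_nonneg _)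
      (Finset.mem_univ i)
  have hgC : ∀ x, ‖D.g x‖ ≤ C := fun x => by
    linarith [hb x, hsum x, norm_nonneg (D.f₀ x)]
  have hfC : ∀ x, ‖D.f₀ x‖ ≤ C := fun x => by
    linarith [hb x, hsum x, norm_nonneg (D.g x)]
  have hgL : LipschitzWith L D.g := LipschitzWith.of_dist_le_mul fun x y => by
    rw [dist_eq_norm, dist_eq_norm]
    linarith [hl x y, hsum' x y, norm_nonneg (D.f₀ x - D.f₀ y)]
  have hfL : LipschitzWith L D.f₀ := LipschitzWith.of_dist_le_mul fun x y => by
    rw [dist_eq_norm, dist_eq_norm]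
    linarith [hl x y, hsum' x y, norm_nonneg (D.g x - D.g y)]
  -- The doubling is for the component `f₀ + g * μ`, whose two summands are estimated separately.
  refine ⟨C + C, L + L, ?_, ?_, ?_⟩
  · rintro μ (_ | i) x
    · exact (norm_add_le _ _).trans (add_le_add (hfC x) (norm_conv_le hgC μ x))
    · refine (hle x i).trans ?_
      push_cast
      linarith [hb x, norm_nonneg (D.f₀ x), norm_nonneg (D.g x), C.coe_nonneg]
  · rintro μ (_ | i)
    · exact hfL.add (lipschitzWith_conv hgL μ)
    · refine LipschitzWith.of_dist_le_mul fun x y => ?_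
      rw [dist_eq_norm, dist_eq_norm]
      refine (hle' x y i).trans ?_
      push_cast
      have : 0 ≤ L * ‖x - y‖ := by positivity
      linarith [hl x y, norm_nonneg (D.f₀ x - D.f₀ y), norm_nonneg (D.g x - D.g y)]
  · rintro μ ν (_ | i) x
    · have := norm_conv_sub_le hgL μ ν x
      have h0 : 0 ≤ L * dist μ ν := by positivity
      simp only [vectorFields, add_sub_add_left_eq_sub]
      push_cast
      linarith
    · simp only [vectorFields, sub_self, norm_zero]
      positivity

/-- The coefficients of the original equation in terms of `vectorFields`. -/
def coeff (u : ℝ → E m) (t : ℝ) : Option (Fin m) → ℝ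
  | none => 1
  | some i => u t i

theorem field_eq_sum (u : ℝ → E m) (μ : ℝ → P1 n) (t : ℝ) (x : E n) :
    D.field u μ t x = ∑ i, coeff u t i • D.vectorFields (μ t) i x := by
  simp only [field, coeff, vectorFields, Fintype.sum_option, one_smul]
  abel

end Data

/-- The coefficients of the reduced equation in terms of `Data.vectorFields`. -/
def WeakLinf.coeff {S : ℝ} {m : ℕ} (c : WeakLinf S m) (s : ℝ) : Option (Fin m) → ℝ
  | none => c.α s
  | some i => c.β s i

theorem WeakLinf.integrable_coeff {S : ℝ} {m : ℕ} (c : WeakLinf S m) (i : Option (Fin m)) :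
    Integrable (fun s => c.coeff s i) (volume.restrict (Icc 0 S)) := by
  cases i with
  | none => exact c.integrable_α
  | some i => exact c.integrable_β i

theorem Data.reducedField_eq_sum {n m : ℕ} (D : Data n m) (c : WeakLinf D.S m) (ν : ℝ → P1 n)
    (s : ℝ) (x : E n) :
    D.reducedField c ν s x = ∑ i, c.coeff s i • D.vectorFields (ν s) i x := by
  simp only [reducedField, WeakLinf.coeff, vectorFields, Fintype.sum_option]

theorem WeakLinf.tendsto_integral_coeff {S : ℝ} {m : ℕ} {κ : Type*} {l : Filter κ}
    {ck : κ → WeakLinf S m} {c : WeakLinf S m} (h : Tendsto ck l (𝓝 c)) (i : Option (Fin m))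
    {p : ℝ → ℝ} (hp : Integrable p (volume.restrict (Icc 0 S))) :
    Tendsto (fun k => ∫ s in Icc 0 S, (ck k).coeff s i * p s) l
      (𝓝 (∫ s in Icc 0 S, c.coeff s i * p s)) := by
  cases i with
  | none => exact tendsto_integral_α h hp
  | some i => exact tendsto_integral_β h i hp

/-! ### Change of the time variable -/

/-- A locally integrable speed `w ≥ 1` defines an increasing change of the time variable. -/
theorem exists_orderIso_of_one_le {w : ℝ → ℝ} (hw : Measurable w) (hwi : LocallyIntegrable w)
    (h1 : ∀ t, 1 ≤ w t) : ∃ Θ : ℝ ≃o ℝ, (∀ t, Θ t = ∫ τ in (0 : ℝ)..t, w τ) ∧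
      (∀ (G : ℝ → ℝ) t, 0 ≤ t → ∫ s in (0 : ℝ)..Θ t, G s = ∫ τ in (0 : ℝ)..t, w τ * G (Θ τ)) ∧
      ∀ P : ℝ → Prop, (∀ᵐ s, P s) → ∀ᵐ τ, P (Θ τ) := by
  have hint : ∀ a b, IntervalIntegrable w volume a b := fun a b =>
    (hwi.integrableOn_isCompact isCompact_uIcc).intervalIntegrable
  set W : ℝ → ℝ := fun t => ∫ τ in (0 : ℝ)..t, w τ with hW
  have hsub : ∀ a b, W b - W a = ∫ τ in a..b, w τ := fun a b =>
    intervalIntegral.integral_interval_sub_left (hint _ _) (hint _ _)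
  have hinc : ∀ a b, a ≤ b → b - a ≤ W b - W a := fun a b hab => by
    rw [hsub]
    have := intervalIntegral.integral_mono_on (f := fun _ => (1 : ℝ)) hab (by simp) (hint a b)
      fun x _ => h1 x
    simpa using this
  have hW0 : W 0 = 0 := by simp [hW]
  have hmono : StrictMono W := fun a b hab => by linarith [hinc a b hab.le]
  have hcont : Continuous W := intervalIntegral.continuous_primitive hint 0
  have hsurj : Function.Surjective W := by
    refine hcont.surjective ?_ ?_
    · refine tendsto_atTop_mono' _ ?_ tendsto_id
      filter_upwards [eventually_ge_atTop 0] with t ht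
      have := hinc 0 t ht
      simp only [id]
      linarith
    · refine tendsto_atBot_mono' _ ?_ tendsto_id
      filter_upwards [eventually_le_atBot 0] with t ht
      have := hinc t 0 ht
      simp only [id]
      linarith
  set Θ : ℝ ≃o ℝ := hmono.orderIsoOfSurjective W hsurj with hΘ
  have hΘW : ∀ t, Θ t = W t := fun t => rfl
  have hemb : MeasurableEmbedding Θ := Θ.toHomeomorph.measurableEmbedding
  set d : ℝ → ℝ≥0 := fun t => (w t).toNNReal with hd
  have hdm : Measurable d := hw.real_toNNReal
  have hdw : ∀ t, (d t : ℝ) = w t := fun t => Real.coe_toNNReal _ (zero_le_one.trans (h1 t))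
  set m : Measure ℝ := volume.withDensity fun t => (d t : ℝ≥0∞) with hm
  -- The image of `w dt` under `Θ` is Lebesgue measure, as a comparison on intervals shows. This
  -- yields the substitution rule for arbitrary `G`.
  have hmap : m.map Θ = volume := by
    have key : ∀ a b : ℝ, a < b → m.map Θ (Ioo a b) = ENNReal.ofReal (b - a) := by
      intro a b hab
      have hpre : Θ ⁻¹' Ioo a b = Ioo (Θ.symm a) (Θ.symm b) := Θ.preimage_Ioo a b
      rw [hemb.map_apply, hpre, hm, withDensity_apply _ measurableSet_Ioo]
      have e : ∀ t, (d t : ℝ≥0∞) = ENNReal.ofReal (w t) := fun t => rfl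
      simp only [e]
      have hle : Θ.symm a ≤ Θ.symm b := Θ.symm.monotone hab.le
      rw [← ofReal_integral_eq_lintegral_ofReal
        ((intervalIntegrable_iff_integrableOn_Ioo_of_le hle).1 (hint _ _))
        (Eventually.of_forall fun t => zero_le_one.trans (h1 t)),
        ← integral_Ioc_eq_integral_Ioo, ← intervalIntegral.integral_of_le hle, ← hsub,
        ← hΘW, ← hΘW]
      simp
    have : IsLocallyFiniteMeasure (m.map Θ) := ⟨fun x => ⟨Ioo (x - 1) (x + 1),
      Ioo_mem_nhds (by linarith) (by linarith), by
        rw [key _ _ (by linarith)]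
        exact ENNReal.ofReal_lt_top⟩⟩
    refine Real.measure_ext_Ioo_rat fun a b => ?_
    rw [Real.volume_Ioo]
    rcases lt_or_ge (a : ℝ) b with hab | hab
    · exact key _ _ hab
    · rw [Ioo_eq_empty (not_lt.2 hab), measure_empty, ENNReal.ofReal_of_nonpos (by linarith)]
  refine ⟨Θ, hΘW, fun G t ht => ?_, fun P hP => ?_⟩
  · have h0 : Θ 0 = 0 := hW0
    have ht' : 0 ≤ Θ t := h0 ▸ Θ.monotone ht
    have hpre : Θ ⁻¹' Ioc 0 (Θ t) = Ioc 0 t := by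
      rw [Θ.preimage_Ioc, Θ.symm_apply_apply, ← h0, Θ.symm_apply_apply]
      simp [h0]
    rw [intervalIntegral.integral_of_le ht', intervalIntegral.integral_of_le ht]
    conv_lhs => rw [← hmap]
    rw [hemb.setIntegral_map, hpre, hm,
      setIntegral_withDensity_eq_setIntegral_smul hdm _ measurableSet_Ioc]
    simp only [NNReal.smul_def, hdw, smul_eq_mul]
  -- The density `w` is positive, so null sets of `w dt` are Lebesgue null.
  · rw [← hmap, hemb.ae_map_iff] at hP
    refine (withDensity_absolutelyContinuous' hdm.coe_nnreal_ennreal.aemeasurable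
      (Eventually.of_forall fun t => ?_)).ae_le hP
    have := h1 t
    rw [← hdw] at this
    have h2 : (0 : ℝ) < d t := by linarith
    simpa using (show (d t) ≠ 0 by exact_mod_cast h2.ne')

namespace Data

variable {n m : ℕ} {D : Data n m} {u : ℝ → E m}

theorem IsControl.integrableOn_apply (hu : D.IsControl u) (i : Fin m) :
    IntegrableOn (fun t => u t i) (Icc 0 D.T) := by
  obtain ⟨h1, ⟨B, hB⟩, -⟩ := hu
  refine Integrable.of_bound
    ((PiLp.continuous_apply 1 (fun _ : Fin m => ℝ) i).measurable.comp h1).aestronglyMeasurable B ?_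
  filter_upwards [hB] with t ht
  exact (Finset.single_le_sum (f := fun i => |u t i|) (fun _ _ => abs_nonneg _)
    (Finset.mem_univ i)).trans ht

theorem IsControl.exists_timeChange (hu : D.IsControl u) :
    ∃ Θ : ℝ ≃o ℝ, (∀ t ∈ Icc 0 D.T, Θ t = Xi u t) ∧ Θ 0 = 0 ∧ Θ D.T = D.S ∧
      (∀ (G : ℝ → ℝ), ∀ t ∈ Icc 0 D.T,
        ∫ s in (0 : ℝ)..Θ t, G s = ∫ τ in (0 : ℝ)..t, (1 + ∑ i, |u τ i|) * G (Θ τ)) ∧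
      ∀ P : ℝ → Prop, (∀ᵐ s ∂volume.restrict (Icc 0 D.S), P s) →
        ∀ᵐ τ, τ ∈ Icc 0 D.T → P (Θ τ) := by
  -- Nothing is known about `u` outside `[0,T]`; with the cutoff the speed `1 + v` is locally
  -- integrable and defines a bijection of the whole line.
  set v : ℝ → ℝ := (Icc 0 D.T).indicator fun t => ∑ i, |u t i| with hv
  have hm : Measurable fun t => ∑ i, |u t i| := Finset.measurable_fun_sum _ fun i _ =>
    ((PiLp.continuous_apply 1 (fun _ : Fin m => ℝ) i).measurable.comp hu.1).abs
  have hi : IntegrableOn (fun t => ∑ i, |u t i|) (Icc 0 D.T) :=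
    integrable_finsetSum _ fun i _ => (hu.integrableOn_apply i).abs
  have hvi : Integrable v := hi.integrable_indicator measurableSet_Icc
  have hv0 : ∀ t, 0 ≤ v t := fun t =>
    indicator_nonneg (fun _ _ => Finset.sum_nonneg fun _ _ => abs_nonneg _) t
  have hvu : ∀ t ∈ Icc 0 D.T, v t = ∑ i, |u t i| := fun t ht => indicator_of_mem ht _
  obtain ⟨Θ, h1, h2, h3⟩ := exists_orderIso_of_one_le (w := fun t => 1 + v t)
    ((hm.indicator measurableSet_Icc).const_add 1)
    ((locallyIntegrable_const 1).add hvi.locallyIntegrable) fun t => by linarith [hv0 t]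
  have hXi : ∀ t ∈ Icc 0 D.T, Θ t = Xi u t := by
    intro t ht
    rw [h1, intervalIntegral.integral_add (by simp) hvi.intervalIntegrable, Xi]
    congr 1
    · simp
    · refine intervalIntegral.integral_congr fun s hs => hvu s ?_
      rw [uIcc_of_le ht.1] at hs
      exact ⟨hs.1, hs.2.trans ht.2⟩
  have hS : Θ D.T = D.S := by
    rw [hXi _ ⟨D.T_pos.le, le_rfl⟩, Xi, hu.2.2, S]
  have h0 : Θ 0 = 0 := by rw [h1]; simp
  refine ⟨Θ, hXi, h0, hS, fun G t ht => ?_, fun P hP => ?_⟩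
  · rw [h2 G t ht.1]
    refine intervalIntegral.integral_congr fun s hs => ?_
    rw [uIcc_of_le ht.1] at hs
    simp only [hvu s ⟨hs.1, hs.2.trans ht.2⟩]
  · rw [ae_restrict_iff' measurableSet_Icc] at hP
    filter_upwards [h3 _ hP] with τ h hτ
    refine h ⟨?_, ?_⟩
    · rw [← h0]
      exact Θ.monotone hτ.1
    · rw [← hS]
      exact Θ.monotone hτ.2

end Data

/-! ### Control processes of the reduced system -/

namespace Data

variable {n m : ℕ} {D : Data n m} {u : ℝ → E m} {c : WeakLinf D.S m} {ν : D.Curve}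

theorem ext_apply (ν : D.Curve) {s : ℝ} (hs : s ∈ Icc 0 D.S) : D.ext ν s = ν ⟨s, hs⟩ :=
  IccExtend_of_mem _ _ hs

theorem continuous_ext (ν : D.Curve) : Continuous (D.ext ν) := ν.continuous.Icc_extend'

theorem S_pos (D : Data n m) : 0 < D.S := add_pos D.T_pos D.M_pos

theorem intervalIntegrable_coeff (c : WeakLinf D.S m) (i : Option (Fin m)) :
    IntervalIntegrable (fun s => c.coeff s i) volume 0 D.S :=
  (intervalIntegrable_iff_integrableOn_Icc_of_le D.S_nonneg).2 (c.integrable_coeff i)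

theorem IsReducedSolution.isNormalizedEvolution {C L : ℝ≥0}
    (hF : IsRegular D.vectorFields C L) (h : D.IsReducedSolution ν c)
    (h1 : ∀ᵐ s ∂volume.restrict (Icc 0 D.S), ∑ i, |c.coeff s i| ≤ 1) :
    IsNormalizedEvolution D.S D.vectorFields c.coeff (D.ext ν) where
  integrable := intervalIntegrable_coeff c
  le_one := (ae_restrict_iff' measurableSet_Icc).1 h1
  continuousOn := (continuous_ext ν).continuousOn
  evolution := IsWeakSolution.isEvolution hF D.S_pos h (D.reducedField_eq_sum c _)
    (intervalIntegrable_coeff c)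

namespace IsAssociated

theorem ae_eq_coeff (h : D.IsAssociated u ν c) : ∀ᵐ s ∂volume.restrict (Icc 0 D.S), ∀ i,
    c.coeff s i = coeff u (D.XiInv u s) i / (1 + ∑ j, |u (D.XiInv u s) j|) := by
  filter_upwards [h.1] with s hs
  rintro (_ | i)
  · exact hs.1
  · exact hs.2 i

theorem ae_nonneg_sum_eq (h : D.IsAssociated u ν c) : ∀ᵐ s ∂volume.restrict (Icc 0 D.S),
    0 ≤ c.α s ∧ c.α s + ∑ j, |c.β s j| = 1 := by
  filter_upwards [h.1] with s hs
  have hp : 0 < 1 + ∑ j, |u (D.XiInv u s) j| :=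
    add_pos_of_pos_of_nonneg one_pos (Finset.sum_nonneg fun _ _ => abs_nonneg _)
  refine ⟨?_, ?_⟩
  · rw [hs.1]
    positivity
  · rw [hs.1]
    simp only [hs.2, abs_div, abs_of_pos hp]
    rw [← Finset.sum_div, ← add_div, div_self hp.ne']

theorem ae_sum_abs_coeff_le (h : D.IsAssociated u ν c) :
    ∀ᵐ s ∂volume.restrict (Icc 0 D.S), ∑ i, |c.coeff s i| ≤ 1 := by
  filter_upwards [h.ae_nonneg_sum_eq] with s hs
  rw [Fintype.sum_option]
  simp only [WeakLinf.coeff]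
  rw [abs_of_nonneg hs.1, hs.2]

end IsAssociated

/-- The change of the time variable that turns a control process of the original system into
the associated control process of the reduced system. -/
theorem exists_timeChange_of_isAssociated (hu : D.IsControl u) (h : D.IsAssociated u ν c) :
    ∃ Θ : ℝ ≃o ℝ, Θ 0 = 0 ∧ Θ D.T = D.S ∧
      ∀ (p : Option (Fin m) → ℝ → ℝ), ∀ t ∈ Icc 0 D.T,
        ∫ s in (0 : ℝ)..Θ t, ∑ i, c.coeff s i * p i s
          = ∫ τ in (0 : ℝ)..t, ∑ i, coeff u τ i * p i (Θ τ) := by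
  obtain ⟨Θ, hXi, h0, hS, hint, hae⟩ := hu.exists_timeChange
  refine ⟨Θ, h0, hS, fun p t ht => ?_⟩
  rw [hint _ t ht]
  have hinv : ∀ τ ∈ Icc 0 D.T, D.XiInv u (Θ τ) = τ := by
    intro τ hτ
    have hinj : InjOn (Xi u) (Icc 0 D.T) := fun a ha b hb hab => by
      rw [← hXi a ha, ← hXi b hb] at hab
      exact Θ.injective hab
    rw [hXi τ hτ]
    exact hinj.leftInvOn_invFunOn hτ
  refine intervalIntegral.integral_congr_ae ?_
  filter_upwards [hae _ h.ae_eq_coeff] with τ h1 hτ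
  rw [uIoc_of_le ht.1] at hτ
  have hτ' : τ ∈ Icc 0 D.T := ⟨hτ.1.le, hτ.2.trans ht.2⟩
  have hp : 0 < 1 + ∑ j, |u τ j| :=
    add_pos_of_pos_of_nonneg one_pos (Finset.sum_nonneg fun _ _ => abs_nonneg _)
  -- The Jacobian `1 + ∑ |u_j|` cancels the common denominator of `α` and `β`.
  rw [Finset.mul_sum]
  refine Finset.sum_congr rfl fun i _ => ?_
  rw [h1 hτ' i, hinv τ hτ']
  field_simp

theorem IsControl.intervalIntegrable_coeff (hu : D.IsControl u) (i : Option (Fin m)) :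
    IntervalIntegrable (fun s => coeff u s i) volume 0 D.T := by
  cases i with
  | none => exact (continuous_const (y := (1 : ℝ))).intervalIntegrable 0 D.T
  | some i =>
    exact (intervalIntegrable_iff_integrableOn_Icc_of_le D.T_pos.le).2 (hu.integrableOn_apply i)

theorem cumul_apply (hu : D.IsControl u) {t : ℝ} (ht : t ∈ Icc 0 D.T) (i : Fin m) :
    cumul u t i = ∫ s in (0 : ℝ)..t, u s i := by
  have hi : IntervalIntegrable u volume 0 t := by
    obtain ⟨h1, ⟨B, hB⟩, -⟩ := hu
    refine (intervalIntegrable_iff_integrableOn_Icc_of_le ht.1).2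
      (IntegrableOn.mono_set (t := Icc 0 D.T) ?_ (Icc_subset_Icc_right ht.2))
    refine Integrable.of_bound h1.aestronglyMeasurable B ?_
    filter_upwards [hB] with t ht
    rw [PiLp.norm_eq_of_nat 1 (by simp)]
    simpa using ht
  exact ((PiLp.proj (𝕜 := ℝ) 1 (fun _ : Fin m => ℝ) i).intervalIntegral_comp_comm hi).symm

theorem integral_β_apply (c : WeakLinf D.S m) {s : ℝ} (hs : s ∈ Icc 0 D.S) (i : Fin m) :
    (∫ σ in (0 : ℝ)..s, c.β σ) i = ∫ σ in (0 : ℝ)..s, c.β σ i := by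
  have hi : IntervalIntegrable c.β volume 0 s :=
    (intervalIntegrable_iff_integrableOn_Icc_of_le hs.1).2
      (IntegrableOn.mono_set (t := Icc 0 D.S) c.integrable_β' (Icc_subset_Icc_right hs.2))
  exact ((PiLp.proj (𝕜 := ℝ) 1 (fun _ : Fin m => ℝ) i).intervalIntegral_comp_comm hi).symm

/-- The substitution turns the integrated equation of `μ` into that of `μ ∘ Θ⁻¹` with the reduced
coefficients, so uniqueness identifies this curve with `ν`. Working with the integrated form, only
continuity of `μ ∘ Θ⁻¹` has to be checked. -/
theorem exists_reparametrization {C L : ℝ≥0} (hF : IsRegular D.vectorFields C L)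
    {μ : ℝ → P1 n} (hμ : D.IsControlPair μ u) (h : D.IsAssociated u ν c) :
    ∃ Θ : ℝ → ℝ, MapsTo Θ (Icc 0 D.T) (Icc 0 D.S) ∧ Θ D.T = D.S ∧
      ∀ t ∈ Icc 0 D.T, D.xi c (Θ t) = t ∧ ∫ s in (0 : ℝ)..Θ t, c.β s = cumul u t ∧
        D.ext ν (Θ t) = μ t := by
  obtain ⟨hu, hμ⟩ := hμ
  obtain ⟨Θ, h0, hS, hint⟩ := exists_timeChange_of_isAssociated hu h
  have hmaps : MapsTo Θ (Icc 0 D.T) (Icc 0 D.S) := fun t ht =>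
    ⟨h0 ▸ Θ.monotone ht.1, hS ▸ Θ.monotone ht.2⟩
  have hmaps' : MapsTo Θ.symm (Icc 0 D.S) (Icc 0 D.T) := fun s hs =>
    ⟨by rw [← Θ.le_iff_le, Θ.apply_symm_apply, h0]; exact hs.1,
      by rw [← Θ.le_iff_le, Θ.apply_symm_apply, hS]; exact hs.2⟩
  have hsingle : ∀ i, ∀ t ∈ Icc 0 D.T,
      ∫ s in (0 : ℝ)..Θ t, c.coeff s i = ∫ τ in (0 : ℝ)..t, coeff u τ i := fun i t ht => by
    simpa [Pi.single_apply] using hint (fun j _ => (Pi.single i (1 : ℝ) : Option (Fin m) → ℝ) j) t ht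
  have hμc : ContinuousOn μ (Icc 0 D.T) := by
    have := continuousOn_of_absolutelyContinuousOnInterval hμ.1
    rwa [uIcc_of_le D.T_pos.le] at this
  have hev : IsNormalizedEvolution D.S D.vectorFields c.coeff (μ ∘ Θ.symm) := by
    refine ⟨D.intervalIntegrable_coeff c, (ae_restrict_iff' measurableSet_Icc).1
      h.ae_sum_abs_coeff_le, hμc.comp Θ.symm.continuous.continuousOn hmaps', ?_⟩
    intro ψ hψ hc s hs
    have h1 := IsWeakSolution.isEvolution hF D.T_pos hμ (D.field_eq_sum u μ)
      hu.intervalIntegrable_coeff ψ hψ hc _ (hmaps' hs)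
    have h2 := hint (fun i s => transport D.vectorFields ψ i (μ (Θ.symm s))) _ (hmaps' hs)
    simp only [Θ.symm_apply_apply, Θ.apply_symm_apply] at h2
    have h0' : Θ.symm 0 = 0 := by rw [← h0, Θ.symm_apply_apply, h0]
    simp only [Function.comp_apply, h0', h1, h2]
  refine ⟨Θ, hmaps, hS, fun t ht => ⟨?_, ?_, ?_⟩⟩
  · have := hsingle none t ht
    simp only [coeff, intervalIntegral.integral_const, sub_zero, smul_eq_mul,
      mul_one] at this
    exact this
  · ext i
    rw [integral_β_apply c (hmaps ht), cumul_apply hu ht]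
    exact hsingle (some i) t ht
  · have := (h.2.isNormalizedEvolution hF h.ae_sum_abs_coeff_le).unique hF hev
      (by
        have h0' : Θ.symm 0 = 0 := by rw [← h0, Θ.symm_apply_apply, h0]
        rw [Function.comp_apply, h0', h.2.2.1, hμ.2.1]) (hmaps ht)
    simpa using this

end Data

/-! ### Limits of reduced controls -/

section LimitControl

variable {S : ℝ} {m : ℕ} {κ : Type*} {l : Filter κ} {ck : κ → WeakLinf S m}
  {c : WeakLinf S m}

/-- Half-space constraints are weak-* closed: tested against indicators of measurable sets, they
pass to the limit and can be read off again a.e. -/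
theorem WeakLinf.ae_sum_mul_coeff_le_of_tendsto [l.NeBot] (h : Tendsto ck l (𝓝 c))
    (σ : Option (Fin m) → ℝ) (b : ℝ)
    (hk : ∀ k, ∀ᵐ s ∂volume.restrict (Icc 0 S), ∑ i, σ i * (ck k).coeff s i ≤ b) :
    ∀ᵐ s ∂volume.restrict (Icc 0 S), ∑ i, σ i * c.coeff s i ≤ b := by
  have hint : ∀ c : WeakLinf S m,
      Integrable (fun s => ∑ i, σ i * c.coeff s i) (volume.restrict (Icc 0 S)) := fun c =>
    integrable_finsetSum _ fun i _ => (c.integrable_coeff i).const_mul _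
  refine ae_le_of_forall_setIntegral_le (hint c) (integrable_const b) fun A hA _ => ?_
  have hp : Integrable (A.indicator fun _ => (1 : ℝ)) (volume.restrict (Icc 0 S)) :=
    (integrable_const 1).indicator hA
  have e : ∀ c : WeakLinf S m, ∫ s in A, ∑ i, σ i * c.coeff s i ∂volume.restrict (Icc 0 S)
      = ∑ i, σ i * ∫ s in Icc 0 S, c.coeff s i * A.indicator (fun _ => (1 : ℝ)) s := by
    intro c
    rw [integral_finsetSum _ fun i _ => ((c.integrable_coeff i).const_mul _).integrableOn]
    refine Finset.sum_congr rfl fun i _ => ?_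
    rw [integral_const_mul, ← integral_indicator hA]
    congr 2
    ext s
    by_cases hs : s ∈ A <;> simp [hs]
  have hlim := tendsto_finsetSum Finset.univ fun i _ =>
    (WeakLinf.tendsto_integral_coeff h i hp).const_mul (σ i)
  simp only [← e] at hlim
  exact le_of_tendsto hlim (Eventually.of_forall fun k =>
    setIntegral_mono_ae (hint _).integrableOn (integrable_const b).integrableOn (hk k))

/-- The set of admissible values is an intersection of finitely many half-spaces, `0 ≤ a` and `a + ∑
± b_j ≤ 1` over all sign patterns. -/
theorem WeakLinf.ae_mem_of_tendsto [l.NeBot] (h : Tendsto ck l (𝓝 c))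
    (hk : ∀ k, ∀ᵐ s ∂volume.restrict (Icc 0 S),
      0 ≤ (ck k).α s ∧ (ck k).α s + ∑ j, |(ck k).β s j| ≤ 1) :
    ∀ᵐ s ∂volume.restrict (Icc 0 S), 0 ≤ c.α s ∧ c.α s + ∑ j, |c.β s j| ≤ 1 := by
  have h1 := ae_sum_mul_coeff_le_of_tendsto h (fun i => i.elim (-1) 0) 0 fun k => by
    filter_upwards [hk k] with s hs
    simpa [coeff] using hs.1
  have h2 : ∀ ε : Fin m → Bool, ∀ᵐ s ∂volume.restrict (Icc 0 S),
      ∑ i : Option (Fin m), (i.elim 1 fun j => if ε j then (1 : ℝ) else -1) * c.coeff s i ≤ 1 :=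
    fun ε => ae_sum_mul_coeff_le_of_tendsto h _ 1 fun k => by
      filter_upwards [hk k] with s hs
      refine le_trans ?_ hs.2
      simp only [Fintype.sum_option, Option.elim, coeff, one_mul]
      gcongr with j
      split_ifs
      · rw [one_mul]
        exact le_abs_self _
      · rw [neg_one_mul]
        exact neg_le_abs _
  filter_upwards [h1, ae_all_iff.2 h2] with s h3 h4
  refine ⟨by simpa [coeff] using h3, ?_⟩
  have := h4 fun j => decide (0 ≤ c.β s j)
  simp only [Fintype.sum_option, Option.elim, coeff, one_mul, decide_eq_true_eq] at this
  convert this using 3 with j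
  split_ifs with hj
  · rw [one_mul, abs_of_nonneg hj]
  · rw [neg_one_mul, abs_of_neg (not_le.1 hj)]

theorem WeakLinf.tendsto_intervalIntegral_coeff (h : Tendsto ck l (𝓝 c)) (i : Option (Fin m))
    {s : ℝ} (hs : s ∈ Icc 0 S) : Tendsto (fun k => ∫ σ in (0 : ℝ)..s, (ck k).coeff σ i) l
      (𝓝 (∫ σ in (0 : ℝ)..s, c.coeff σ i)) := by
  have hp : Integrable ((Ioc 0 s).indicator fun _ => (1 : ℝ)) (volume.restrict (Icc 0 S)) :=
    (integrable_const 1).indicator measurableSet_Ioc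
  have e : ∀ c : WeakLinf S m, ∫ σ in (0 : ℝ)..s, c.coeff σ i
      = ∫ σ in Icc 0 S, c.coeff σ i * (Ioc 0 s).indicator (fun _ => (1 : ℝ)) σ := by
    intro c
    have e1 : (fun σ => c.coeff σ i * (Ioc 0 s).indicator (fun _ => (1 : ℝ)) σ)
        = (Ioc 0 s).indicator fun σ => c.coeff σ i := by
      ext σ
      by_cases hs : σ ∈ Ioc 0 s <;> simp [hs]
    have e2 : Ioc 0 s ⊆ Icc 0 S := Ioc_subset_Icc_self.trans (Icc_subset_Icc_right hs.2)
    rw [intervalIntegral.integral_of_le hs.1, e1, setIntegral_indicator measurableSet_Ioc,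
      inter_eq_right.2 e2]
  simp only [e]
  exact WeakLinf.tendsto_integral_coeff h i hp

end LimitControl

theorem Data.isReducedControl_of_tendsto {n m : ℕ} {D : Data n m} {κ : Type*} {l : Filter κ}
    [l.NeBot] {ck : κ → WeakLinf D.S m} {c : WeakLinf D.S m} (h : Tendsto ck l (𝓝 c))
    (hk : ∀ k, D.IsReducedControl (ck k)) : D.IsReducedControl c := by
  refine ⟨WeakLinf.ae_mem_of_tendsto h fun k => (hk k).1, ?_⟩
  have := WeakLinf.tendsto_intervalIntegral_coeff h none (s := D.S) ⟨D.S_nonneg, le_rfl⟩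
  refine tendsto_nhds_unique this (tendsto_const_nhds.congr fun k => ((hk k).2).symm)

/-! ### Limits of reduced solutions -/

/-- Weak convergence handles the fixed factor `G`, and the bound on `a k` makes the error from `H k
- G` at most `δ k * S`. -/
theorem tendsto_integral_mul_of_uniform {S : ℝ} {κ : Type*} {l : Filter κ} {a : κ → ℝ → ℝ}
    {b : ℝ → ℝ} (hS : 0 ≤ S)
    (ham : ∀ k, AEStronglyMeasurable (a k) (volume.restrict (Icc 0 S)))
    (ha : ∀ k, ∀ᵐ s ∂volume.restrict (Icc 0 S), |a k s| ≤ 1) {H : κ → ℝ → ℝ} {G : ℝ → ℝ}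
    (hH : ∀ k, ContinuousOn (H k) (Icc 0 S)) (hG : ContinuousOn G (Icc 0 S)) {δ : κ → ℝ}
    (hδ : Tendsto δ l (𝓝 0)) (hle : ∀ k, ∀ s ∈ Icc 0 S, |H k s - G s| ≤ δ k)
    (hab : Tendsto (fun k => ∫ s in Icc 0 S, a k s * G s) l (𝓝 (∫ s in Icc 0 S, b s * G s))) :
    Tendsto (fun k => ∫ s in Icc 0 S, a k s * H k s) l (𝓝 (∫ s in Icc 0 S, b s * G s)) := by
  have hHi := fun k => (hH k).integrableOn_compact (μ := volume) isCompact_Icc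
  have hGi := hG.integrableOn_compact (μ := volume) isCompact_Icc
  have hd : Tendsto (fun k => ∫ s in Icc 0 S, a k s * (H k s - G s)) l (𝓝 0) := by
    refine squeeze_zero_norm (fun k => ?_) (by simpa using hδ.mul_const S)
    have := norm_setIntegral_le_of_norm_le_const_ae' (μ := volume) (s := Icc 0 S)
      (f := fun s => a k s * (H k s - G s)) (C := δ k) measure_Icc_lt_top (by
        filter_upwards [(ae_restrict_iff' measurableSet_Icc).1 (ha k)] with s h1 hs
        rw [norm_mul]
        exact (mul_le_of_le_one_left (norm_nonneg _) (h1 hs)).trans (hle k s hs))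
    simpa [hS] using this
  have := hab.add hd
  rw [add_zero] at this
  refine this.congr fun k => ?_
  have e : ∀ s, a k s * H k s = a k s * G s + a k s * (H k s - G s) := fun s => by ring
  simp only [e]
  exact (integral_add (hGi.bdd_mul (ham k) (ha k))
    (((hHi k).sub hGi).bdd_mul (ham k) (ha k))).symm

/-! ### The weak formulation as an affine expression in the controls -/

section WeakForm

variable {V : Type*} [NormedAddCommGroup V] [NormedSpace ℝ V] {φ : ℝ × V → ℝ}

theorem fderiv_section (hφ : ContDiff ℝ (⊤ : ℕ∞) φ) (s : ℝ) (x v : V) :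
    fderiv ℝ (fun x => φ (s, x)) x v = fderiv ℝ φ (s, x) (0, v) := by
  have := ((hφ.differentiable (by simp)) (s, x)).hasFDerivAt.comp x (hasFDerivAt_prodMk_right s x)
  have h2 : HasFDerivAt (fun x => φ (s, x)) _ x := this
  rw [h2.fderiv]
  simp

theorem norm_zero_prod {V : Type*} [NormedAddCommGroup V] (v : V) : ‖((0 : ℝ), v)‖ = ‖v‖ := by
  simp [Prod.norm_def]

theorem exists_bounds_of_smooth_prod (hφ : ContDiff ℝ (⊤ : ℕ∞) φ) (hc : HasCompactSupport φ) :
    ∃ ℓ K : ℝ≥0, (∀ s x, ‖fderiv ℝ (fun x => φ (s, x)) x‖ ≤ ℓ) ∧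
      (∀ s, LipschitzWith K (fderiv ℝ fun x => φ (s, x))) ∧
      (∀ s s' x, ‖fderiv ℝ (fun x => φ (s, x)) x - fderiv ℝ (fun x => φ (s', x)) x‖
        ≤ K * |s - s'|) ∧
      ∀ s s' x y, |fderiv ℝ φ (s, x) (1, 0) - fderiv ℝ φ (s', y) (1, 0)|
        ≤ K * max |s - s'| (dist x y) := by
  obtain ⟨ℓ, hℓ⟩ := ContDiff.lipschitzWith_of_hasCompactSupport hc hφ (by simp)
  obtain ⟨K, hK⟩ := ContDiff.lipschitzWith_of_hasCompactSupport (hc.fderiv ℝ)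
    (hφ.fderiv_right (m := (⊤ : ℕ∞)) (by simp)) (by simp)
  have hd : ∀ s x s' y, ‖fderiv ℝ φ (s, x) - fderiv ℝ φ (s', y)‖ ≤ K * max |s - s'| (dist x y) :=
    fun s x s' y => by
      have := hK.dist_le_mul (s, x) (s', y)
      rwa [dist_eq_norm, Prod.dist_eq, Real.dist_eq] at this
  have hsec : ∀ s x s' y, ‖fderiv ℝ (fun x => φ (s, x)) x - fderiv ℝ (fun x => φ (s', x)) y‖
      ≤ K * max |s - s'| (dist x y) := fun s x s' y => by
    refine ContinuousLinearMap.opNorm_le_bound _ (by positivity) fun v => ?_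
    rw [_root_.sub_apply, fderiv_section hφ, fderiv_section hφ,
      ← _root_.sub_apply]
    refine (ContinuousLinearMap.le_opNorm _ _).trans ?_
    rw [norm_zero_prod]
    gcongr
    exact hd s x s' y
  refine ⟨ℓ, K, fun s x => ?_, fun s => ?_, fun s s' x => ?_, fun s s' x y => ?_⟩
  · refine ContinuousLinearMap.opNorm_le_bound _ ℓ.2 fun v => ?_
    rw [fderiv_section hφ]
    refine (ContinuousLinearMap.le_opNorm _ _).trans ?_
    rw [norm_zero_prod]
    gcongr
    exact norm_fderiv_le_of_lipschitz ℝ hℓ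
  · refine LipschitzWith.of_dist_le_mul fun x y => ?_
    rw [dist_eq_norm]
    simpa using hsec s x s y
  · simpa using hsec s x s' x
  · rw [← _root_.sub_apply]
    refine ((fderiv ℝ φ (s, x) - fderiv ℝ φ (s', y)).le_opNorm (1, 0)).trans ?_
    refine (mul_le_mul_of_nonneg_right (hd s x s' y) (norm_nonneg _)).trans ?_
    simp [Prod.norm_def]

end WeakForm

/-- The space integral in the weak formulation is an affine function of the coefficients, whose
coefficients are Lipschitz functions of time and measure. -/
theorem IsRegular.exists_weakForm {n : ℕ} {ι : Type*} [Fintype ι] {F : P1 n → ι → E n → E n}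
    {C L : ℝ≥0} (hF : IsRegular F C L) {φ : ℝ × E n → ℝ} (hφ : ContDiff ℝ (⊤ : ℕ∞) φ)
    (hc : HasCompactSupport φ) :
    ∃ (q : ℝ → P1 n → ℝ) (p : ι → ℝ → P1 n → ℝ) (A : ℝ≥0),
      (∀ s μ (a : ι → ℝ) (v : E n → E n), (∀ x, v x = ∑ i, a i • F μ i x) →
        ∫ x, (fderiv ℝ φ (s, x) (1, 0) + fderiv ℝ φ (s, x) (0, v x)) ∂μ.toMeasure
          = q s μ + ∑ i, a i * p i s μ) ∧
      (∀ s s' μ μ', |q s μ - q s' μ'| ≤ A * (|s - s'| + dist μ μ')) ∧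
      ∀ i s s' μ μ', |p i s μ - p i s' μ'| ≤ A * (|s - s'| + dist μ μ') := by
  obtain ⟨ℓ, K, h1, h2, h3, h4⟩ := exists_bounds_of_smooth_prod hφ hc
  have hql : ∀ s, LipschitzWith K fun x => fderiv ℝ φ (s, x) (1, 0) := fun s =>
    LipschitzWith.of_dist_le_mul fun x y => by
      rw [Real.dist_eq]
      simpa using h4 s s x y
  have hqi : ∀ s (μ : P1 n), Integrable (fun x => fderiv ℝ φ (s, x) (1, 0)) μ.toMeasure :=
    fun s μ => μ.integrable_lipschitz_real (hql s)
  -- One constant for three estimates: `K` for `q`, `K * C` for `p` in time, `K * C + 2 * ℓ * L` for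
  -- `p` in the measure.
  set A : ℝ≥0 := K + (K * C + (K * C + 2 * ℓ * L)) with hA
  have hAK : (K : ℝ) ≤ A := by
    rw [hA]
    push_cast
    have : (0 : ℝ) ≤ K * C + (K * C + 2 * ℓ * L) := by positivity
    linarith
  have hAC : (K * C : ℝ) ≤ A := by
    rw [hA]
    push_cast
    have : (0 : ℝ) ≤ K + (K * C + 2 * ℓ * L) := by positivity
    linarith
  have hAL : (K * C + 2 * ℓ * L : ℝ) ≤ A := by
    rw [hA]
    push_cast
    have : (0 : ℝ) ≤ K + K * C := by positivity
    linarith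
  refine ⟨fun s μ => ∫ x, fderiv ℝ φ (s, x) (1, 0) ∂μ.toMeasure,
    fun i s μ => transport F (fun x => φ (s, x)) i μ, A, fun s μ a v hv => ?_,
    fun s s' μ μ' => ?_, fun i s s' μ μ' => ?_⟩
  · have hi : ∀ i ∈ Finset.univ, Integrable (fun x => a i * fderiv ℝ (fun x => φ (s, x)) x (F μ i x))
        μ.toMeasure := fun i _ => (hF.integrable_fderiv (h1 s) (h2 s) μ μ i).const_mul _
    have e : ∀ x, fderiv ℝ φ (s, x) (0, v x)
        = ∑ i, a i * fderiv ℝ (fun x => φ (s, x)) x (F μ i x) := fun x => by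
      rw [← fderiv_section hφ, hv, map_sum]
      simp
    simp only [e]
    rw [integral_add (hqi s μ) (integrable_finsetSum _ hi), integral_finsetSum _ hi]
    simp only [transport, integral_const_mul]
  · have a1 := P1.abs_integral_sub_le_dist μ μ' (hql s)
    have a2 : |∫ x, fderiv ℝ φ (s, x) (1, 0) ∂μ'.toMeasure
        - ∫ x, fderiv ℝ φ (s', x) (1, 0) ∂μ'.toMeasure| ≤ K * |s - s'| := by
      rw [← integral_sub (hqi s μ') (hqi s' μ'), ← Real.norm_eq_abs]
      have := norm_integral_le_of_norm_le_const (μ := μ'.toMeasure)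
        (f := fun x => fderiv ℝ φ (s, x) (1, 0) - fderiv ℝ φ (s', x) (1, 0)) (C := K * |s - s'|)
        (Eventually.of_forall fun x => by simpa using h4 s s' x x)
      simpa using this
    have a3 := abs_sub_le (∫ x, fderiv ℝ φ (s, x) (1, 0) ∂μ.toMeasure)
      (∫ x, fderiv ℝ φ (s, x) (1, 0) ∂μ'.toMeasure) (∫ x, fderiv ℝ φ (s', x) (1, 0) ∂μ'.toMeasure)
    have a4 := mul_le_mul_of_nonneg_right hAK (add_nonneg (abs_nonneg (s - s'))
      (dist_nonneg (x := μ) (y := μ')))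
    linarith
  · have a1 := hF.abs_transport_sub_le (h1 s) (h2 s) i μ μ'
    have a2 : |transport F (fun x => φ (s, x)) i μ' - transport F (fun x => φ (s', x)) i μ'|
        ≤ K * C * |s - s'| := by
      rw [transport, transport, ← integral_sub (hF.integrable_fderiv (h1 s) (h2 s) μ' μ' i)
        (hF.integrable_fderiv (h1 s') (h2 s') μ' μ' i), ← Real.norm_eq_abs]
      have := norm_integral_le_of_norm_le_const (μ := μ'.toMeasure)
        (f := fun x => fderiv ℝ (fun x => φ (s, x)) x (F μ' i x)
          - fderiv ℝ (fun x => φ (s', x)) x (F μ' i x)) (C := K * C * |s - s'|)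
        (Eventually.of_forall fun x => by
          have b1 := (fderiv ℝ (fun x => φ (s, x)) x - fderiv ℝ (fun x => φ (s', x)) x).le_opNorm
            (F μ' i x)
          rw [_root_.sub_apply] at b1
          refine b1.trans ?_
          refine (mul_le_mul (h3 s s' x) (hF.bound μ' i x) (norm_nonneg _) (by positivity)).trans ?_
          exact le_of_eq (by ring))
      simpa using this
    have a3 := abs_sub_le (transport F (fun x => φ (s, x)) i μ)
      (transport F (fun x => φ (s, x)) i μ') (transport F (fun x => φ (s', x)) i μ')
    have a4 := mul_le_mul_of_nonneg_right hAL (dist_nonneg (x := μ) (y := μ'))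
    have a5 := mul_le_mul_of_nonneg_right hAC (abs_nonneg (s - s'))
    linarith

theorem continuous_of_lipschitz_prod {X : Type*} [PseudoMetricSpace X] {p : ℝ → X → ℝ} {A : ℝ≥0}
    (h : ∀ s s' μ μ', |p s μ - p s' μ'| ≤ A * (|s - s'| + dist μ μ')) {ν : ℝ → X}
    (hν : Continuous ν) : Continuous fun s => p s (ν s) := by
  rw [continuous_iff_continuousAt]
  intro s
  rw [ContinuousAt, tendsto_iff_dist_tendsto_zero]
  have h0 : Tendsto (fun s' => A * (|s' - s| + dist (ν s') (ν s))) (𝓝 s) (𝓝 0) := by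
    have h1 : Continuous fun s' => A * (|s' - s| + dist (ν s') (ν s)) := by fun_prop
    simpa using h1.tendsto s
  exact squeeze_zero (fun _ => dist_nonneg) (fun s' => h s' s _ _) h0

namespace Data

variable {n m : ℕ} {D : Data n m} {κ : Type*} {l : Filter κ} {νk : κ → D.Curve}
  {ck : κ → WeakLinf D.S m} {ν : D.Curve} {c : WeakLinf D.S m}

theorem IsReducedControl.ae_sum_abs_coeff_le (h : D.IsReducedControl c) :
    ∀ᵐ s ∂volume.restrict (Icc 0 D.S), ∑ i, |c.coeff s i| ≤ 1 := by
  filter_upwards [h.1] with s hs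
  rw [Fintype.sum_option]
  simp only [WeakLinf.coeff]
  rw [abs_of_nonneg hs.1]
  exact hs.2

theorem dist_ext_le (ν ν' : D.Curve) (s : ℝ) : dist (D.ext ν s) (D.ext ν' s) ≤ dist ν ν' :=
  ContinuousMap.dist_apply_le_dist _

theorem tendsto_ext (h : Tendsto νk l (𝓝 ν)) (s : ℝ) :
    Tendsto (fun k => D.ext (νk k) s) l (𝓝 (D.ext ν s)) :=
  tendsto_iff_dist_tendsto_zero.2 (squeeze_zero (fun _ => dist_nonneg)
    (fun k => dist_ext_le (νk k) ν s) (tendsto_iff_dist_tendsto_zero.1 h))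

/-- The common Lipschitz bound gives absolute continuity of the limit curve. In the weak
formulation, the coefficients converge weak-* and their factors uniformly, so every product passes
to the limit. -/
theorem isReducedPair_of_tendsto [l.NeBot] {C L : ℝ≥0} (hF : IsRegular D.vectorFields C L)
    (hν : Tendsto νk l (𝓝 ν)) (hc : Tendsto ck l (𝓝 c))
    (hk : ∀ k, D.IsReducedPair (νk k) (ck k)) : D.IsReducedPair ν c := by
  have hcc := isReducedControl_of_tendsto hc fun k => (hk k).1
  refine ⟨hcc, ?_, ?_, fun φ hφ hφc hφs => ?_⟩
  · refine LipschitzOnWith.absolutelyContinuousOnInterval (K := C) ?_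
    rw [uIcc_of_le D.S_nonneg]
    refine LipschitzOnWith.of_dist_le_mul fun s hs t ht => ?_
    exact le_of_tendsto ((tendsto_ext hν s).dist (tendsto_ext hν t)) (Eventually.of_forall fun k =>
      ((hk k).2.isNormalizedEvolution hF (hk k).1.ae_sum_abs_coeff_le).dist_le hF hs ht)
  · refine tendsto_nhds_unique (tendsto_ext hν 0) (tendsto_const_nhds.congr fun k => ?_)
    exact (hk k).2.2.1.symm
  obtain ⟨q, p, A, h1, h2, h3⟩ := hF.exists_weakForm hφ hφc
  have hδ : Tendsto (fun k => A * dist (νk k) ν) l (𝓝 0) := by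
    simpa using (tendsto_iff_dist_tendsto_zero.1 hν).const_mul (A : ℝ)
  have hle : ∀ k s, (|s - s| + dist (D.ext (νk k) s) (D.ext ν s)) ≤ dist (νk k) ν := fun k s => by
    simpa using dist_ext_le (νk k) ν s
  have hqc : ∀ ν : D.Curve, Continuous fun s => q s (D.ext ν s) := fun ν =>
    continuous_of_lipschitz_prod h2 (continuous_ext ν)
  have hpc : ∀ (ν : D.Curve) i, Continuous fun s => p i s (D.ext ν s) := fun ν i =>
    continuous_of_lipschitz_prod (h3 i) (continuous_ext ν)
  have hform : ∀ (ν : D.Curve) (c : WeakLinf D.S m), D.IsReducedControl c →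
      ∫ t in (0 : ℝ)..D.S, ∫ x, (fderiv ℝ φ (t, x) (1, 0)
        + fderiv ℝ φ (t, x) (0, D.reducedField c (D.ext ν) t x)) ∂(D.ext ν t).toMeasure
      = (∫ s in Icc 0 D.S, 1 * q s (D.ext ν s))
        + ∑ i, ∫ s in Icc 0 D.S, c.coeff s i * p i s (D.ext ν s) := by
    intro ν c hc
    have hi : ∀ i ∈ Finset.univ, Integrable (fun s => c.coeff s i * p i s (D.ext ν s))
        (volume.restrict (Icc 0 D.S)) := fun i _ =>
      ((hpc ν i).continuousOn.integrableOn_compact isCompact_Icc).bdd_mul (c := 1)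
        (c.integrable_coeff i).aestronglyMeasurable (by
          filter_upwards [hc.ae_sum_abs_coeff_le] with s hs
          exact (Finset.single_le_sum (f := fun i => |c.coeff s i|) (fun _ _ => abs_nonneg _)
            (Finset.mem_univ i)).trans hs)
    rw [← integral_finsetSum _ hi, ← integral_add
      (((hqc ν).const_mul 1).continuousOn.integrableOn_compact isCompact_Icc)
      (integrable_finsetSum _ hi), intervalIntegral.integral_of_le D.S_nonneg,
      ← integral_Icc_eq_integral_Ioc]
    congr 1
    ext s
    rw [one_mul]
    exact h1 s _ _ _ (D.reducedField_eq_sum c _ s)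
  have hlim : Tendsto (fun k => (∫ s in Icc 0 D.S, 1 * q s (D.ext (νk k) s))
        + ∑ i, ∫ s in Icc 0 D.S, (ck k).coeff s i * p i s (D.ext (νk k) s)) l
      (𝓝 ((∫ s in Icc 0 D.S, 1 * q s (D.ext ν s))
        + ∑ i, ∫ s in Icc 0 D.S, c.coeff s i * p i s (D.ext ν s))) := by
    refine Tendsto.add ?_ (tendsto_finsetSum _ fun i _ => ?_)
    -- The time-derivative term is treated as one more product, with constant coefficient 1.
    · exact tendsto_integral_mul_of_uniform (a := fun _ _ => 1) D.S_nonneg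
        (fun _ => aestronglyMeasurable_const)
        (fun _ => Eventually.of_forall fun _ => by simp) (fun k => (hqc (νk k)).continuousOn)
        (hqc ν).continuousOn hδ (fun k s _ => (h2 s s _ _).trans
          (mul_le_mul_of_nonneg_left (hle k s) A.2)) tendsto_const_nhds
    · refine tendsto_integral_mul_of_uniform (a := fun k s => (ck k).coeff s i) D.S_nonneg
        (fun k => ((ck k).integrable_coeff i).aestronglyMeasurable)
        (fun k => ?_) (fun k => (hpc (νk k) i).continuousOn)
        (hpc ν i).continuousOn hδ (fun k s _ => (h3 i s s _ _).trans
          (mul_le_mul_of_nonneg_left (hle k s) A.2))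
        (WeakLinf.tendsto_integral_coeff hc i
          ((hpc ν i).continuousOn.integrableOn_compact isCompact_Icc))
      filter_upwards [(hk k).1.ae_sum_abs_coeff_le] with s hs
      exact (Finset.single_le_sum (f := fun i => |(ck k).coeff s i|) (fun _ _ => abs_nonneg _)
        (Finset.mem_univ i)).trans hs
  rw [hform ν c hcc]
  refine tendsto_nhds_unique hlim (tendsto_const_nhds.congr fun k => ?_)
  rw [← hform (νk k) (ck k) (hk k).1]
  exact ((hk k).2.2.2 φ hφ hφc hφs).symm

end Data

/-! ### Points of continuity of functions of bounded variation -/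

/-- Increments of `f` are dominated by those of its variation function, which is monotone and so has
countably many discontinuities. -/
theorem countable_not_continuousWithinAt_of_boundedVariationOn {X : Type*} [PseudoMetricSpace X]
    {f : ℝ → X} {s : Set ℝ} (hf : BoundedVariationOn f s) :
    {x ∈ s | ¬ContinuousWithinAt f s x}.Countable := by
  rcases s.eq_empty_or_nonempty with rfl | ⟨a, ha⟩
  · simp
  have hl := hf.locallyBoundedVariationOn
  have hle : ∀ b ∈ s, ∀ c ∈ s, dist (f c) (f b)
      ≤ dist (variationOnFromTo f s a c) (variationOnFromTo f s a b) := by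
    have key : ∀ b ∈ s, ∀ c ∈ s, b ≤ c → dist (f c) (f b)
        ≤ dist (variationOnFromTo f s a c) (variationOnFromTo f s a b) := fun b hb c hc hbc => by
      rw [Real.dist_eq, ← variationOnFromTo.add hl ha hb hc, add_sub_cancel_left,
        variationOnFromTo.eq_of_le f s hbc, abs_of_nonneg ENNReal.toReal_nonneg, dist_edist]
      exact ENNReal.toReal_mono (hl b c hb hc)
        (eVariationOn.edist_le f ⟨hc, hbc, le_rfl⟩ ⟨hb, le_rfl, hbc⟩)
    intro b hb c hc
    rcases le_total b c with h | h
    · exact key b hb c hc h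
    · rw [dist_comm, dist_comm (variationOnFromTo f s a c)]
      exact key c hc b hb h
  refine (variationOnFromTo.monotoneOn hl ha).countable_not_continuousWithinAt.mono ?_
  rintro b ⟨hb, hfb⟩
  refine ⟨hb, fun hV => hfb ?_⟩
  rw [ContinuousWithinAt, tendsto_iff_dist_tendsto_zero] at hV ⊢
  refine squeeze_zero' (Eventually.of_forall fun _ => dist_nonneg) ?_ hV
  filter_upwards [self_mem_nhdsWithin] with c hc using hle b hb c hc

theorem frequently_nhdsGT_of_countable {P : ℝ → Prop} {t T : ℝ} (ht : t < T)
    (h : {x ∈ Icc t T | ¬P x}.Countable) : ∃ᶠ x in 𝓝[>] t, x ∈ Ioo t T ∧ P x := by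
  intro hn
  obtain ⟨b, hb, hsub⟩ := (mem_nhdsGT_iff_exists_Ioo_subset' ht).1 hn
  obtain ⟨x, hx, hx'⟩ := (h.dense_compl ℝ).inter_open_nonempty (Ioo t (min b T)) isOpen_Ioo
    (nonempty_Ioo.2 (lt_min hb ht))
  have hxT : x < T := hx.2.trans_le (min_le_right _ _)
  have hxb : x < b := hx.2.trans_le (min_le_left _ _)
  refine hsub ⟨hx.1, hxb⟩ ⟨⟨hx.1, hxT⟩, ?_⟩
  by_contra hP
  exact hx' ⟨⟨hx.1.le, hxT.le⟩, hP⟩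

namespace Data

variable {n m : ℕ} {D : Data n m} {κ : Type*} {c : WeakLinf D.S m}

/-! ### The pseudo-inverse of the time change -/

theorem intervalIntegrable_coeff_of_mem (c : WeakLinf D.S m) (i : Option (Fin m)) {s s' : ℝ}
    (hs : s ∈ Icc 0 D.S) (hs' : s' ∈ Icc 0 D.S) :
    IntervalIntegrable (fun σ => c.coeff σ i) volume s s' :=
  (intervalIntegrable_coeff c i).mono_set (by
    rw [uIcc_of_le D.S_nonneg]
    exact uIcc_subset_Icc hs hs')

theorem IsReducedControl.abs_integral_coeff_sub_le (hc : D.IsReducedControl c)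
    (i : Option (Fin m)) {s s' : ℝ} (hs : s ∈ Icc 0 D.S) (hs' : s' ∈ Icc 0 D.S) :
    |(∫ σ in (0 : ℝ)..s, c.coeff σ i) - ∫ σ in (0 : ℝ)..s', c.coeff σ i| ≤ |s - s'| := by
  have h0 : (0 : ℝ) ∈ Icc 0 D.S := ⟨le_rfl, D.S_nonneg⟩
  rw [intervalIntegral.integral_interval_sub_left (intervalIntegrable_coeff_of_mem c i h0 hs)
    (intervalIntegrable_coeff_of_mem c i h0 hs'), ← Real.norm_eq_abs]
  have := intervalIntegral.norm_integral_le_of_norm_le_const_ae (a := s') (b := s)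
    (f := fun σ => c.coeff σ i) (C := 1) (by
      filter_upwards [(ae_restrict_iff' measurableSet_Icc).1 hc.ae_sum_abs_coeff_le] with σ h hσ
      refine (Finset.single_le_sum (f := fun i => |c.coeff σ i|) (fun _ _ => abs_nonneg _)
        (Finset.mem_univ i)).trans (h ?_)
      exact uIcc_subset_Icc hs' hs (uIoc_subset_uIcc hσ))
  rwa [one_mul] at this

theorem IsReducedControl.xi_monotoneOn (hc : D.IsReducedControl c) :
    MonotoneOn (D.xi c) (Icc 0 D.S) := by
  intro s hs s' hs' hle
  have h0 : (0 : ℝ) ∈ Icc 0 D.S := ⟨le_rfl, D.S_nonneg⟩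
  have hi := intervalIntegrable_coeff_of_mem c none hs hs'
  have e := intervalIntegral.integral_add_adjacent_intervals
    (intervalIntegrable_coeff_of_mem c none h0 hs) hi
  have hnn : 0 ≤ ∫ σ in s..s', c.coeff σ none := by
    refine intervalIntegral.integral_nonneg_of_ae_restrict hle ?_
    filter_upwards [ae_restrict_of_ae_restrict_of_subset
      (Icc_subset_Icc hs.1 hs'.2) hc.1] with σ h using h.1
  simp only [WeakLinf.coeff] at e hnn
  simp only [xi]
  linarith

theorem xiPseudoInv_T (c : WeakLinf D.S m) : D.xiPseudoInv c D.T = D.S := by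
  simp [xiPseudoInv]

theorem IsReducedControl.xiPseudoInv_mem (hc : D.IsReducedControl c) {t : ℝ} :
    D.xiPseudoInv c t ∈ Icc 0 D.S := by
  unfold xiPseudoInv
  split_ifs with h
  · have hS : D.S ∈ {s | s ∈ Icc 0 D.S ∧ t < D.xi c s} :=
      ⟨⟨D.S_nonneg, le_rfl⟩, by rw [xi, hc.2]; exact h⟩
    exact ⟨le_csInf ⟨_, hS⟩ fun s hs => hs.1.1, csInf_le ⟨0, fun s hs => hs.1.1⟩ hS⟩
  · exact ⟨D.S_nonneg, le_rfl⟩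

/-- A selection of preimages under `ξ` of points decreasing to `t` converges to `ξ^←(t)`. -/
theorem IsReducedControl.tendsto_xiPseudoInv (hc : D.IsReducedControl c) {t : ℝ} (ht : t < D.T)
    {l : Filter ℝ} (hl : l ≤ 𝓝[>] t) {σ : ℝ → ℝ}
    (hσ : ∀ᶠ x in l, σ x ∈ Icc 0 D.S ∧ D.xi c (σ x) = x) :
    Tendsto σ l (𝓝 (D.xiPseudoInv c t)) := by
  have e : D.xiPseudoInv c t = sInf {s | s ∈ Icc 0 D.S ∧ t < D.xi c s} := if_pos ht
  have hS : D.S ∈ {s | s ∈ Icc 0 D.S ∧ t < D.xi c s} :=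
    ⟨⟨D.S_nonneg, le_rfl⟩, by rw [xi, hc.2]; exact ht⟩
  rw [e, tendsto_order]
  refine ⟨fun a ha => ?_, fun b hb => ?_⟩
  -- Since `ξ(σ x) = x > t`, the point `σ x` competes in the infimum.
  · filter_upwards [hσ, hl self_mem_nhdsWithin] with x hx hxt
    exact ha.trans_le (csInf_le ⟨0, fun s hs => hs.1.1⟩ ⟨hx.1, by rw [hx.2]; exact hxt⟩)
  -- Once `x < ξ(s)`, monotonicity of `ξ` keeps `σ x` below `s`, which is below `b`.
  · obtain ⟨s, hs, hsb⟩ := exists_lt_of_csInf_lt ⟨_, hS⟩ hb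
    filter_upwards [hσ, hl (nhdsWithin_le_nhds (Iio_mem_nhds hs.2))] with x hx hxs
    refine lt_of_not_ge fun hbx => ?_
    have := hc.xi_monotoneOn hs.1 hx.1 (hsb.le.trans hbx)
    rw [hx.2] at this
    exact absurd hxs (not_lt.2 this)

/-! ### Identification of the limit -/

section Limit

variable {U : Ultrafilter κ} {μk : κ → ℝ → P1 n} {uk : κ → ℝ → E m} {νk : κ → D.Curve}
  {ck : κ → WeakLinf D.S m} {μ : ℝ → P1 n} {𝔘 : ℝ → E m} {ν : D.Curve}

theorem IsAssociated.isReducedPair {u : ℝ → E m} {μ : ℝ → P1 n} {c : WeakLinf D.S m}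
    {C L : ℝ≥0} (hF : IsRegular D.vectorFields C L)
    (h : D.IsAssociated u ν c) (hμ : D.IsControlPair μ u) : D.IsReducedPair ν c := by
  refine ⟨⟨h.ae_nonneg_sum_eq.mono fun s hs => ⟨hs.1, hs.2.le⟩, ?_⟩, h.2⟩
  obtain ⟨Θ, -, hS, hΘ⟩ := exists_reparametrization hF hμ h
  have := (hΘ D.T ⟨D.T_pos.le, le_rfl⟩).1
  rwa [hS] at this

/-- The time `s` is the limit along `U` of the reparametrized times `Θ_k(t)` in the compact interval
`[0,S]`; the identities of `exists_reparametrization` pass to the limit there. -/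
theorem exists_time_of_tendsto {C L : ℝ≥0} (hF : IsRegular D.vectorFields C L)
    (hproc : ∀ k, D.IsControlPair (μk k) (uk k)) (hassoc : ∀ k, D.IsAssociated (uk k) (νk k) (ck k))
    (hν : Tendsto νk U (𝓝 ν)) (hc : Tendsto ck U (𝓝 c)) {t : ℝ} (ht : t ∈ Icc 0 D.T)
    (hμ : Tendsto (fun k => μk k t) U (𝓝 (μ t)))
    (hu : Tendsto (fun k => cumul (uk k) t) U (𝓝 (𝔘 t))) :
    ∃ s ∈ Icc 0 D.S, (t = D.T → s = D.S) ∧ D.xi c s = t ∧ D.ext ν s = μ t ∧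
      ∫ σ in (0 : ℝ)..s, c.β σ = 𝔘 t := by
  choose Θ hmaps hT hΘ using fun k => exists_reparametrization hF (hproc k) (hassoc k)
  have hmem : ∀ k, Θ k t ∈ Icc 0 D.S := fun k => hmaps k ht
  obtain ⟨s, hs, hlim⟩ := (isCompact_Icc (a := (0 : ℝ)) (b := D.S)).ultrafilter_le_nhds
    (U.map fun k => Θ k t) (le_principal_iff.2
      (Filter.mem_map.2 (Eventually.of_forall hmem)))
  have hlim' : Tendsto (fun k => Θ k t) U (𝓝 s) := hlim
  have hcoeff : ∀ i, Tendsto (fun k => ∫ σ in (0 : ℝ)..Θ k t, (ck k).coeff σ i) U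
      (𝓝 (∫ σ in (0 : ℝ)..s, c.coeff σ i)) := by
    intro i
    have h1 := WeakLinf.tendsto_intervalIntegral_coeff hc i hs
    -- The primitives are 1-Lipschitz uniformly in `k`, so the moving end point may be replaced by
    -- `s`.
    have h2 : Tendsto (fun k => (∫ σ in (0 : ℝ)..Θ k t, (ck k).coeff σ i)
        - ∫ σ in (0 : ℝ)..s, (ck k).coeff σ i) U (𝓝 0) := by
      refine squeeze_zero_norm (fun k => ?_) (tendsto_iff_dist_tendsto_zero.1 hlim')
      exact ((hassoc k).isReducedPair hF (hproc k)).1.abs_integral_coeff_sub_le i (hmem k) hs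
    simpa using h2.add h1
  refine ⟨s, hs, fun hTt => ?_, ?_, ?_, ?_⟩
  · subst hTt
    refine tendsto_nhds_unique hlim' (tendsto_const_nhds.congr fun k => (hT k).symm)
  · refine tendsto_nhds_unique (hcoeff none) (tendsto_const_nhds.congr fun k => ?_)
    exact (hΘ k t ht).1.symm
  · have h1 : Tendsto (fun k => D.ext ν (Θ k t)) U (𝓝 (D.ext ν s)) :=
      ((continuous_ext ν).tendsto s).comp hlim'
    refine tendsto_nhds_unique h1 (hμ.congr_dist ?_)
    refine squeeze_zero (fun _ => dist_nonneg) (fun k => ?_) (tendsto_iff_dist_tendsto_zero.1 hν)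
    rw [← (hΘ k t ht).2.2]
    exact dist_ext_le _ _ _
  · ext i
    rw [integral_β_apply c hs]
    refine tendsto_nhds_unique (hcoeff (some i))
      ((((PiLp.continuous_apply 1 (fun _ : Fin m => ℝ) i).tendsto _).comp hu).congr fun k => ?_)
    rw [Function.comp_apply, ← (hΘ k t ht).2.1, integral_β_apply (ck k) (hmem k)]
    rfl

end Limit

/-- For `t < T` nothing is known about `μk k t` if `t` is a jump, so `t` is approached from the
right through common continuity points, where `exists_time_of_tendsto` applies. -/
theorem limit_eq {C L : ℝ≥0} (hF : IsRegular D.vectorFields C L) {U : Ultrafilter ℕ}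
    (hU : (U : Filter ℕ) ≤ atTop) {μk : ℕ → ℝ → P1 n} {uk : ℕ → ℝ → E m} {νk : ℕ → D.Curve}
    {ck : ℕ → WeakLinf D.S m} {μ : ℝ → P1 n} {𝔘 : ℝ → E m} {ν : D.Curve}
    (hproc : ∀ k, D.IsControlPair (μk k) (uk k)) (hassoc : ∀ k, D.IsAssociated (uk k) (νk k) (ck k))
    (hν : Tendsto νk U (𝓝 ν)) (hc : Tendsto ck U (𝓝 c))
    (hμ : IsBVPlus D.T μ) (h𝔘 : IsBVPlus D.T 𝔘)
    (hμk : BVTendsto D.T μk μ) (huk : BVTendsto D.T (fun k => cumul (uk k)) 𝔘)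
    {t : ℝ} (ht : t ∈ Icc 0 D.T) :
    μ t = D.ext ν (D.xiPseudoInv c t) ∧ 𝔘 t = ∫ s in (0 : ℝ)..D.xiPseudoInv c t, c.β s := by
  have hcc : D.IsReducedControl c :=
    isReducedControl_of_tendsto hc fun k => ((hassoc k).isReducedPair hF (hproc k)).1
  rcases ht.2.eq_or_lt with rfl | htT
  · obtain ⟨s, -, h1, -, h2, h3⟩ := exists_time_of_tendsto hF hproc hassoc hν hc ht
      ((hμk _ ht (Or.inr (Or.inr rfl))).mono_left hU) ((huk _ ht (Or.inr (Or.inr rfl))).mono_left hU)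
    rw [(xiPseudoInv_T c).trans (h1 rfl).symm]
    exact ⟨h2.symm, h3.symm⟩
  set P : ℝ → Prop := fun x => ContinuousWithinAt μ (Icc 0 D.T) x ∧
    ContinuousWithinAt 𝔘 (Icc 0 D.T) x with hP
  have hcount : {x ∈ Icc t D.T | ¬P x}.Countable := by
    refine ((countable_not_continuousWithinAt_of_boundedVariationOn hμ.1).union
      (countable_not_continuousWithinAt_of_boundedVariationOn h𝔘.1)).mono ?_
    rintro x ⟨hx, hxP⟩
    have hx0 : x ∈ Icc 0 D.T := ⟨ht.1.trans hx.1, hx.2⟩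
    rcases not_and_or.1 hxP with h | h
    · exact Or.inl ⟨hx0, h⟩
    · exact Or.inr ⟨hx0, h⟩
  have hsel : ∀ x, ∃ s, x ∈ Ioo t D.T ∧ P x → s ∈ Icc 0 D.S ∧ D.xi c s = x ∧ D.ext ν s = μ x ∧
      ∫ σ in (0 : ℝ)..s, c.β σ = 𝔘 x := by
    intro x
    by_cases hx : x ∈ Ioo t D.T ∧ P x
    · have hx0 : x ∈ Icc 0 D.T := ⟨ht.1.trans hx.1.1.le, hx.1.2.le⟩
      obtain ⟨s, h0, -, h1⟩ := exists_time_of_tendsto hF hproc hassoc hν hc hx0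
        ((hμk _ hx0 (Or.inl hx.2.1)).mono_left hU) ((huk _ hx0 (Or.inl hx.2.2)).mono_left hU)
      exact ⟨s, fun _ => ⟨h0, h1⟩⟩
    · exact ⟨0, fun h => absurd h hx⟩
  choose σ hσ using hsel
  -- Right neighbourhoods restricted to common continuity points; the filter is nontrivial because
  -- only countably many points are excluded.
  set l : Filter ℝ := 𝓝[>] t ⊓ 𝓟 {x | x ∈ Ioo t D.T ∧ P x} with hl
  have hne : l.NeBot := frequently_mem_iff_neBot.1 (frequently_nhdsGT_of_countable htT hcount)
  have hlP : ∀ᶠ x in l, x ∈ Ioo t D.T ∧ P x := mem_inf_of_right (mem_principal_self _)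
  have hlt : l ≤ 𝓝[>] t := inf_le_left
  have hlI : l ≤ 𝓝[Icc t D.T] t := le_inf (hlt.trans nhdsWithin_le_nhds)
    (le_principal_iff.2 (hlP.mono fun x hx => ⟨hx.1.1.le, hx.1.2.le⟩))
  have hlim : Tendsto σ l (𝓝 (D.xiPseudoInv c t)) := hcc.tendsto_xiPseudoInv htT hlt
    (hlP.mono fun x hx => ⟨(hσ x hx).1, (hσ x hx).2.1⟩)
  have hlim' : Tendsto σ l (𝓝[Icc 0 D.S] (D.xiPseudoInv c t)) :=
    tendsto_nhdsWithin_iff.2 ⟨hlim, hlP.mono fun x hx => (hσ x hx).1⟩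
  have htI : t ∈ Ico 0 D.T := ⟨ht.1, htT⟩
  constructor
  · refine tendsto_nhds_unique ((hμ.2 t htI).mono_left hlI) ?_
    refine (((continuous_ext ν).tendsto _).comp hlim).congr' ?_
    exact hlP.mono fun x hx => (hσ x hx).2.2.1
  · refine tendsto_nhds_unique ((h𝔘.2 t htI).mono_left hlI) ?_
    have hcont := intervalIntegral.continuousOn_primitive_interval (μ := volume) (f := c.β)
      (a := 0) (b := D.S) (by
        rw [uIcc_of_le D.S_nonneg]
        exact c.integrable_β')
    rw [uIcc_of_le D.S_nonneg] at hcont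
    refine ((hcont _ hcc.xiPseudoInv_mem).tendsto.comp hlim').congr' ?_
    exact hlP.mono fun x hx => (hσ x hx).2.2.2

/-- All curves start at `ϑ`, so Lipschitz constant and tail bound do not depend on `k`. -/
theorem exists_tendsto_reducedPair {C L : ℝ≥0} (hF : IsRegular D.vectorFields C L)
    (U : Ultrafilter κ) {νk : κ → D.Curve} {ck : κ → WeakLinf D.S m}
    (hk : ∀ k, D.IsReducedPair (νk k) (ck k)) :
    ∃ (ν : D.Curve) (c : WeakLinf D.S m), Tendsto νk U (𝓝 ν) ∧ Tendsto ck U (𝓝 c) := by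
  have hN := fun k => (hk k).2.isNormalizedEvolution hF (hk k).1.ae_sum_abs_coeff_le
  have hle : ∀ k (i : Option (Fin m)), ∀ᵐ s ∂volume.restrict (Icc 0 D.S),
      |(ck k).coeff s i| ≤ 1 := fun k i => by
    filter_upwards [(hk k).1.ae_sum_abs_coeff_le] with s hs
    exact (Finset.single_le_sum (f := fun i => |(ck k).coeff s i|) (fun _ _ => abs_nonneg _)
      (Finset.mem_univ i)).trans hs
  obtain ⟨c, hc⟩ := WeakLinf.exists_tendsto U (fun k => hle k none) fun k i => hle k (some i)
  have hω : Tendsto (fun r : ℝ => D.ϑ.tail r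
      + C / (r / 2) * (D.ϑ.moment + C * D.S) * D.S) atTop (𝓝 0) := by
    have h1 : Tendsto (fun r : ℝ => (C : ℝ) / (r / 2)) atTop (𝓝 0) :=
      tendsto_const_nhds.div_atTop (tendsto_id.atTop_div_const two_pos)
    simpa using D.ϑ.tendsto_tail.add ((h1.mul_const (D.ϑ.moment + C * D.S)).mul_const D.S)
  have hlip : ∀ k, LipschitzWith C (νk k) := fun k => LipschitzWith.of_dist_le_mul fun s t => by
    have := (hN k).dist_le hF s.2 t.2
    rwa [ext_apply _ s.2, ext_apply _ t.2] at this
  obtain ⟨ν, hν⟩ := exists_tendsto_curve U νk hlip hω fun k s r hr => by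
    have := (hN k).tail_le hF s.2 hr
    rwa [ext_apply _ s.2, (hk k).2.2.1] at this
  exact ⟨ν, c, hν, hc⟩

end Data

end ImpulsiveTransport

end

/-! ### The main theorem -/

theorem mainTheorem4 {n m : ℕ} (D : Data n m) (hD : D.BoundedLipschitz)
    -- a sequence of control processes of the original system
    (μk : ℕ → ℝ → P1 n) (uk : ℕ → ℝ → E m) (hproc : ∀ k, D.IsControlPair (μk k) (uk k))
    -- converging to a pair of right-continuous functions of bounded variation
    (μ : ℝ → P1 n) (𝔘 : ℝ → E m) (hμ : IsBVPlus D.T μ) (h𝔘 : IsBVPlus D.T 𝔘)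
    (hμk : BVTendsto D.T μk μ) (huk : BVTendsto D.T (fun k => Data.cumul (uk k)) 𝔘)
    -- the associated control processes of the reduced system
    (νk : ℕ → D.Curve) (ck : ℕ → WeakLinf D.S m)
    (hassoc : ∀ k, D.IsAssociated (uk k) (νk k) (ck k)) :
    (∃ (ν : D.Curve) (c : WeakLinf D.S m),
      MapClusterPt (ν, c) atTop (fun k => (νk k, ck k))) ∧
    ∀ (ν : D.Curve) (c : WeakLinf D.S m),
      MapClusterPt (ν, c) atTop (fun k => (νk k, ck k)) →
        D.IsReducedPair ν c ∧
        ∀ t ∈ Icc 0 D.T,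
          μ t = D.ext ν (D.xiPseudoInv c t) ∧
          𝔘 t = ∫ s in (0 : ℝ)..D.xiPseudoInv c t, c.β s := by
  obtain ⟨C, L, hF⟩ := Data.exists_isRegular hD
  have hred := fun k => (hassoc k).isReducedPair hF (hproc k)
  constructor
  · obtain ⟨ν, c, hν, hc⟩ := Data.exists_tendsto_reducedPair hF (Ultrafilter.of atTop) hred
    refine ⟨ν, c, mapClusterPt_iff_ultrafilter.2 ⟨Ultrafilter.of atTop, Ultrafilter.of_le _, ?_⟩⟩
    rw [nhds_prod_eq]
    exact hν.prodMk hc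
  · intro ν c h
    obtain ⟨U, hU, hlim⟩ := mapClusterPt_iff_ultrafilter.1 h
    rw [nhds_prod_eq] at hlim
    have hν := tendsto_fst.comp hlim
    have hc := tendsto_snd.comp hlim
    exact ⟨Data.isReducedPair_of_tendsto hF hν hc hred,
      fun t ht => Data.limit_eq hF hU hproc hassoc hν hc hμ h𝔘 hμk huk ht⟩
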